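/- **Setting.** Let $1\le k_1<k_2$, $D\ge 3$, $d_D\ge1$ be integers, $q>1$, $\epsilon_0>0$, $\frac1\kappa=\frac1{k_1}-\frac1{k_2}$. For $1\le\ell\le D-1$ let $I_\ell$ be a finite nonempty set of nonnegative integers, $\delta_\ell\ge1$ integers with $\delta_1=1$ and $\delta_\ell<\delta_{\ell+1}$, and for $\lambda\in I_\ell$ let $d_{\lambda,\ell}\ge1$, $\Delta_{\lambda,\ell}\ge0$ be integers with $$\Delta_{\lambda,\ell}\ge d_{\lambda,\ell},\qquad \tfrac{d_{\lambda,\ell}}{k_2}+1\ge\delta_\ell,\qquad \tfrac{d_D-1}{k_2}+1\ge\delta_\ell .$$ Let $Q,R_\ell\in\mathbb C[X]$ ($1\le\ell\le D$) satisfy $\deg Q\ge\deg R_D\ge\deg R_\ell$ and $Q(im)\ne0$, $R_D(im)\neq0$ for all $m\in\mathbb R$; let $\beta>0$, $\mu>\deg(R_D)+1$. Let $E_{(\beta,\mu)}$ be the space of continuous $h:\mathbb R\to\mathbb C$ with $\|h\|_{(\beta,\mu)}=\sup_m(1+|m|)^\mu e^{\beta|m|}|h(m)|<\infty$. Let $C_{\lambda,\ell}(\cdot,\epsilon)\in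 E_{(\beta,\mu)}$ depend holomorphically on $\epsilon\in D(0,\epsilon_0)$, with $\|C_{\lambda,\ell}(\cdot,\epsilon)\|_{(\beta,\mu)}\le\tilde C_{\lambda,\ell}$ for all $\epsilon\in D(0,\epsilon_0)$. Let $d,\alpha\in\mathbb R$, $\rho,\delta>0$, and let $U_d$ be an infinite open sector with vertex $0$ and bisecting direction $d$ such that $U_d\cup D(0,\rho)$ has positive distance to $-\delta$. Let $F_n(\cdot,\epsilon)\in E_{(\beta,\mu)}$, $n\ge 0$, be holomorphic in $\epsilon\in D(0,\epsilon_0)$, with $\|F_n(\cdot,\epsilon)\|_{(\beta,\mu)}\le C_F\rho^{-n}q^{n(n-1)/(2k_1)}$ for some $C_F>0$ independent of $n$ and $\epsilon$. Assume that the sum $\sum_n F_n(m,\epsilon)\tau^n/(q^{1/k_1})^{n(n-1)/2}$, $|\tau|<\rho$, extends to a function $\psi_{k_1}(\tau,m,\epsilon)$ which is continuous in $(\tau,m)\in(U_d\cup\overline D(0,\rho))\times\mathbb R$, holomorphic in $\tau\in U_d\cup D(0,\rho)$ and in $\epsilon\in D(0,\epsilon_0)$, and satisfies, for some $C_{\psi_{k_1}}>0$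 independent of $\epsilon$, $$|\psi_{k_1}(\tau,m,\epsilon)|\le C_{\psi_{k_1}}\frac{e^{-\beta|m|}}{(1+|m|)^{\mu}}\exp\Big(\frac{k_1\log^2|\tau+\delta|}{2\log q}+\alpha\log|\tau+\delta|\Big).$$ Put $$\psi_{k_2}(\tau,m,\epsilon)=\mathcal L^d_{q;1/\kappa}\psi_{k_1}(\tau,m,\epsilon)=\frac1{\pi_{q^{1/\kappa}}}\int_{\mathbb R_+e^{id}}\frac{\psi_{k_1}(u,m,\epsilon)}{\Theta_{q^{1/\kappa}}(u/\tau)}\frac{du}u,$$ with $\Theta_{q^{1/\kappa}}(x)=\sum_{n\in\mathbb Z}q^{-n(n-1)/(2\kappa)}x^n$ and $\pi_{q^{1/\kappa}}=\frac{\log q}{\kappa}\prod_{n\ge0}(1-q^{-(n+1)/\kappa})^{-1}$. For $\tilde\delta>0$ let $\mathcal R_{d,\tilde\delta}=\{T\neq0:|1+e^{id}r/T|>\tilde\delta\text{ for all }r\ge0\}$. Let $S_d$ be an infinite open sector and $\mathcal R_d^b$ a bounded open sector, both with vertex $0$, bisecting direction $d$ and contained in $\mathcal R_{d,\tilde\delta}$,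 and let $\rho_1>0$ with $\mathcal R^b_d\subseteq\overline D(0,\rho_1)$. Let $\mathrm{Exp}^d_{(k_2,\beta,\mu,\nu)}$ be the space of continuous functions $h$ on $\Omega\times\mathbb R$, $\Omega=(S_d\cup\overline{\mathcal R_d^b})\setminus\{0\}$, holomorphic in $\tau\in S_d\cup\mathcal R_d^b$, with $$\|h\|_{(k_2,\beta,\mu,\nu)}=\sup_{\tau\in\Omega,\,m\in\mathbb R}(1+|m|)^\mu e^{\beta|m|}\exp\Big(-\frac{k_2\log^2|\tau|}{2\log q}-\nu\log|\tau|\Big)|h(\tau,m)|<\infty .$$ Assume that there are $r_{Q,R_D},\eta_{Q,R_D}>0$ and $d_{Q,R_D}\in\mathbb R$ such that for every $m\in\mathbb R$ the number $z=Q(im)/R_D(im)$ satisfies $|z|\ge r_{Q,R_D}$ and $|\arg z-d_{Q,R_D}|\le\eta_{Q,R_D}$ for some determination of the argument. Let $$q_l(m)=\Big(\tfrac{|Q(im)|}{|R_D(im)|}(q^{1/k_2})^{\frac{(d_D+k_2)(d_D+k_2-1)-k_2(k_2-1)}2}\Big)^{1/d_D}\exp\Big(\sqrt{-1}\,\Big(\tfrac1{d_D}\arg\tfrac{Q(im)}{R_D(im)}+\tfrac{2\pi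 l}{d_D}\Big)\Big),\quad 0\le l\le d_D-1,$$ be the roots of $P_m(\tau)=\frac{Q(im)}{(q^{1/k_2})^{k_2(k_2-1)/2}}-\frac{R_D(im)}{(q^{1/k_2})^{(d_D+k_2)(d_D+k_2-1)/2}}\tau^{d_D}$, and assume: 1) there is $M_1>0$ with $|\tau-q_l(m)|\ge M_1(1+|\tau|)$ for all $0\le l\le d_D-1$, $m\in\mathbb R$, $\tau\in S_d\cup\overline D(0,\rho_1)$; 2) there are $M_2>0$ and $l_0\in\{0,\dots,d_D-1\}$ with $|\tau-q_{l_0}(m)|\ge M_2|q_{l_0}(m)|$ for all $m\in\mathbb R$, $\tau\in S_d\cup\overline D(0,\rho_1)$. **Result.** There is $\nu\in\mathbb R$ such that every $\psi_{k_2}$ as above satisfies, for some $C_{\psi_{k_2}}>0$, $$|\psi_{k_2}(\tau,m,\epsilon)|\le C_{\psi_{k_2}}e^{-\beta|m|}(1+|m|)^{-\mu}\exp\Big(\frac{k_2\log^2|\tau|}{2\log q}+\nu\log|\tau|\Big)\quad\text{for }\tau\in\mathcal R_{d,\tilde\delta},\ m\in\mathbb R,\ \epsilon\in D(0,\epsilon_0).\qquad(*)$$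 For every $\nu\in\mathbb R$ and every $\varpi>0$ there are constants $\zeta_{\psi_{k_2}}>0$ and $\zeta_{\lambda,\ell}>0$ (depending only on the parameters, sectors and polynomials above, on $\nu$ and on $\varpi$, but not on $C_{\lambda,\ell}$, $F_n$, $\psi_{k_1}$) such that, if $\tilde C_{\lambda,\ell}\le\zeta_{\lambda,\ell}$ for all $\ell,\lambda$ and $(*)$ holds with this $\nu$ and some $C_{\psi_{k_2}}\le\zeta_{\psi_{k_2}}$, then for every $\epsilon\in D(0,\epsilon_0)$ the equation $$\frac{Q(im)\,\tau^{k_2}}{(q^{1/k_2})^{k_2(k_2-1)/2}}w(\tau,m,\epsilon)=\frac{R_D(im)\,\tau^{d_D+k_2}}{(q^{1/k_2})^{(d_D+k_2)(d_D+k_2-1)/2}}w(\tau,m,\epsilon)$$ $$+\sum_{\ell=1}^{D-1}\sum_{\lambda\in I_\ell}\frac{\epsilon^{\Delta_{\lambda,\ell}-d_{\lambda,\ell}}\tau^{d_{\lambda,\ell}+k_2}}{(q^{1/k_2})^{(d_{\lambda,\ell}+k_2)(d_{\lambda,\ell}+k_2-1)/2}}\frac1{(2\pi)^{1/2}}\int_{-\infty}^\infty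 C_{\lambda,\ell}(m-m_1,\epsilon)R_\ell(im_1)\,w\big(q^{\delta_\ell-\frac{d_{\lambda,\ell}}{k_2}-1}\tau,m_1,\epsilon\big)dm_1+\frac{\tau^{k_2}}{(q^{1/k_2})^{k_2(k_2-1)/2}}\psi_{k_2}(\tau,m,\epsilon)$$ ($\tau\in\Omega$, $m\in\mathbb R$) has a unique solution $w^d_{k_2}(\cdot,\cdot,\epsilon)$ in $\mathrm{Exp}^d_{(k_2,\beta,\mu,\nu)}$. Moreover $\|w^d_{k_2}(\cdot,\cdot,\epsilon)\|_{(k_2,\beta,\mu,\nu)}\le\varpi$, and $w^d_{k_2}$ is holomorphic in $\epsilon\in D(0,\epsilon_0)$. -/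

import Mathlib

open scoped ENNReal Polynomial

/-! ### Sectors and weighted function spaces -/

/-- The open infinite sector with vertex `0`, bisecting direction `d` and half-opening `θ`. -/
noncomputable def infiniteSector (d θ : ℝ) : Set ℂ :=
  {τ | τ ≠ 0 ∧ |Complex.arg (τ * Complex.exp (-(d : ℂ) * Complex.I))| < θ}

/-- The open bounded sector with vertex `0`, bisecting direction `d`, half-opening `θ`
and radius `r`. -/
noncomputable def boundedSector (d θ r : ℝ) : Set ℂ :=
  infiniteSector d θ ∩ Metric.ball 0 r

/-- The set of all `T ≠ 0` such that `|1 + e^{id} r / T| > δt` for all `r ≥ 0`. -/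
noncomputable def laplaceDomain (d δt : ℝ) : Set ℂ :=
  {T | T ≠ 0 ∧ ∀ r : ℝ, 0 ≤ r → δt < ‖1 + Complex.exp ((d : ℂ) * Complex.I) * (r : ℂ) / T‖}

/-- The norm of `E_(β,μ)`, with value `⊤` if the supremum is infinite. -/
noncomputable def normE (β μ : ℝ) (h : ℝ → ℂ) : ℝ≥0∞ :=
  ⨆ m : ℝ, ENNReal.ofReal ((1 + |m|) ^ μ * Real.exp (β * |m|) * ‖h m‖)

/-- Membership in the space `E_(β,μ)`. -/
def MemE (β μ : ℝ) (h : ℝ → ℂ) : Prop :=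
  Continuous h ∧ normE β μ h < ⊤

/-- The set on which the elements of `Exp^d_(k,β,μ,ν)` are defined: the infinite sector `S` and the
closure of the bounded sector `R`; the common vertex `0`, where the weight involving `log |τ|`
is meaningless, is left out. -/
def expDomain (S R : Set ℂ) : Set ℂ := (S ∪ closure R) \ {0}

/-- The norm of `Exp^d_(k,β,μ,ν)`, with value `⊤` if the supremum is infinite. -/
noncomputable def normExp (S R : Set ℂ) (q k β μ ν : ℝ) (h : ℂ → ℝ → ℂ) : ℝ≥0∞ :=
  ⨆ τ ∈ expDomain S R, ⨆ m : ℝ, ENNReal.ofReal ((1 + |m|) ^ μ * Real.exp (β * |m|) *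
    Real.exp (-(k * Real.log ‖τ‖ ^ 2 / (2 * Real.log q)) - ν * Real.log ‖τ‖) * ‖h τ m‖)

/-- Membership in the space `Exp^d_(k,β,μ,ν)`. -/
def MemExp (S R : Set ℂ) (q k β μ ν : ℝ) (h : ℂ → ℝ → ℂ) : Prop :=
  ContinuousOn (Function.uncurry h) (expDomain S R ×ˢ Set.univ) ∧
  (∀ m : ℝ, DifferentiableOn ℂ (fun τ => h τ m) (S ∪ R)) ∧
  normExp S R q k β μ ν h < ⊤

/-! ### Convolution, `q`-Borel and `q`-Laplace transforms -/

/-- The convolution product `(h₁ ∗^Q h₂)(m) = ∫ h₁(m - m₁) Q(i m₁) h₂(m₁) dm₁`. -/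
noncomputable def convQ (Q : ℂ[X]) (h₁ h₂ : ℝ → ℂ) (m : ℝ) : ℂ :=
  ∫ m₁ : ℝ, h₁ (m - m₁) * Q.eval (Complex.I * (m₁ : ℂ)) * h₂ m₁

/-- The factor `(q^{1/k})^{n(n-1)/2}`. -/
noncomputable def qFactor (q k : ℝ) (n : ℕ) : ℝ :=
  (q ^ (1 / k)) ^ ((n : ℝ) * ((n : ℝ) - 1) / 2)

/-- The formal `q`-Borel transform of order `k`. -/
noncomputable def formalQBorel (q k : ℝ) (a : PowerSeries ℂ) : PowerSeries ℂ :=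
  PowerSeries.mk fun n => PowerSeries.coeff n a / (qFactor q k n : ℂ)

/-- The Jacobi theta function `∑_{n ∈ ℤ} q^{-n(n-1)/(2k)} x^n` of order `k`. -/
noncomputable def qTheta (q k : ℝ) (x : ℂ) : ℂ :=
  ∑' n : ℤ, ((q ^ (-((n : ℝ) * ((n : ℝ) - 1) / (2 * k))) : ℝ) : ℂ) * x ^ n

/-- The constant `(log q / k) ∏_{n ≥ 0} (1 - q^{-(n+1)/k})⁻¹`. -/
noncomputable def qPi (q k : ℝ) : ℝ :=
  Real.log q / k * ∏' n : ℕ, (1 - 1 / q ^ (((n : ℝ) + 1) / k))⁻¹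

/-- The `q`-Laplace transform of order `k` in direction `γ`: the integral of
`f(u) / Θ(u/T)` against `du/u` along the half-line `u = r e^{iγ}`, `r > 0` (so `du/u = dr/r`). -/
noncomputable def qLaplace (q k γ : ℝ) (f : ℂ → ℂ) (T : ℂ) : ℂ :=
  1 / (qPi q k : ℂ) * ∫ r in Set.Ioi (0 : ℝ),
    f ((r : ℂ) * Complex.exp ((γ : ℂ) * Complex.I)) /
      qTheta q k ((r : ℂ) * Complex.exp ((γ : ℂ) * Complex.I) / T) / (r : ℂ)

/-! ### The data of the convolution equation -/

/-- The parameters of the equation. `I l`, `d l j`, `Δ l j`, `δ l` are only used for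
`1 ≤ l ≤ D - 1` and `j ∈ I l`, and `R l` only for `1 ≤ l ≤ D`. -/
structure EqParams where
  k₁ : ℕ
  k₂ : ℕ
  D : ℕ
  dD : ℕ
  q : ℝ
  β : ℝ
  μ : ℝ
  ε₀ : ℝ
  I : ℕ → Finset ℕ
  d : ℕ → ℕ → ℕ
  Δ : ℕ → ℕ → ℕ
  δ : ℕ → ℕ
  Q : ℂ[X]
  R : ℕ → ℂ[X]

/-- The standing assumptions on the parameters. -/
structure EqParams.Admissible (P : EqParams) : Prop where
  one_le_k₁ : 1 ≤ P.k₁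
  k₁_lt_k₂ : P.k₁ < P.k₂
  three_le_D : 3 ≤ P.D
  one_le_dD : 1 ≤ P.dD
  one_lt_q : 1 < P.q
  β_pos : 0 < P.β
  ε₀_pos : 0 < P.ε₀
  I_nonempty : ∀ l ∈ Finset.Icc 1 (P.D - 1), (P.I l).Nonempty
  one_le_d : ∀ l ∈ Finset.Icc 1 (P.D - 1), ∀ j ∈ P.I l, 1 ≤ P.d l j
  δ_one : P.δ 1 = 1
  δ_lt : ∀ l, 1 ≤ l → l + 1 ≤ P.D - 1 → P.δ l < P.δ (l + 1)
  d_le_Δ : ∀ l ∈ Finset.Icc 1 (P.D - 1), ∀ j ∈ P.I l, P.d l j ≤ P.Δ l j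
  δ_le : ∀ l ∈ Finset.Icc 1 (P.D - 1), ∀ j ∈ P.I l,
    (P.δ l : ℝ) ≤ (P.d l j : ℝ) / (P.k₂ : ℝ) + 1
  δ_le' : ∀ l ∈ Finset.Icc 1 (P.D - 1), (P.δ l : ℝ) ≤ ((P.dD : ℝ) - 1) / (P.k₂ : ℝ) + 1
  deg_Q : (P.R P.D).natDegree ≤ P.Q.natDegree
  deg_R : ∀ l ∈ Finset.Icc 1 (P.D - 1), (P.R l).natDegree ≤ (P.R P.D).natDegree
  Q_ne : ∀ m : ℝ, P.Q.eval (Complex.I * (m : ℂ)) ≠ 0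
  R_ne : ∀ m : ℝ, (P.R P.D).eval (Complex.I * (m : ℂ)) ≠ 0
  lt_μ : ((P.R P.D).natDegree : ℝ) + 1 < P.μ

/-- The number `κ` with `1/κ = 1/k₁ - 1/k₂`. -/
noncomputable def EqParams.κ (P : EqParams) : ℝ := 1 / (1 / (P.k₁ : ℝ) - 1 / (P.k₂ : ℝ))

/-- The root `q_l(m)`, `0 ≤ l ≤ d_D - 1`, of the polynomial
`P_m(τ) = Q(im) / (q^{1/k₂})^{k₂(k₂-1)/2}
  - R_D(im) τ^{d_D} / (q^{1/k₂})^{(d_D+k₂)(d_D+k₂-1)/2}`. -/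
noncomputable def EqParams.root (P : EqParams) (l : ℕ) (m : ℝ) : ℂ :=
  ((‖P.Q.eval (Complex.I * (m : ℂ))‖ / ‖(P.R P.D).eval (Complex.I * (m : ℂ))‖ *
      (qFactor P.q P.k₂ (P.dD + P.k₂) / qFactor P.q P.k₂ P.k₂)) ^ (1 / (P.dD : ℝ)) : ℝ) *
    Complex.exp (Complex.I * ((1 / (P.dD : ℝ) * Complex.arg (P.Q.eval (Complex.I * (m : ℂ)) /
      (P.R P.D).eval (Complex.I * (m : ℂ))) + 2 * Real.pi * (l : ℝ) / (P.dD : ℝ) : ℝ) : ℂ))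

/-- The set `{z : |z| ≥ r, |arg z - a| ≤ η}` (for some determination of the argument). -/
def closedSectorOutside (r a η : ℝ) : Set ℂ :=
  {z | r ≤ ‖z‖ ∧ ∃ t : ℝ, z = (‖z‖ : ℂ) * Complex.exp ((t : ℂ) * Complex.I) ∧ |t - a| ≤ η}

/-- The coefficients `C_{λ,ℓ}(m, ε)` belong to `E_(β,μ)`, depend holomorphically on `ε`, and have
norms bounded by the constants `Ct l j`, uniformly in `ε`. -/
structure IsCoeffFamily (P : EqParams) (C : ℕ → ℕ → ℝ → ℂ → ℂ) (Ct : ℕ → ℕ → ℝ) : Prop where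
  mem : ∀ l ∈ Finset.Icc 1 (P.D - 1), ∀ j ∈ P.I l, ∀ ε ∈ Metric.ball (0 : ℂ) P.ε₀,
    MemE P.β P.μ (fun m => C l j m ε)
  hol : ∀ l ∈ Finset.Icc 1 (P.D - 1), ∀ j ∈ P.I l, ∀ m : ℝ,
    DifferentiableOn ℂ (fun ε => C l j m ε) (Metric.ball (0 : ℂ) P.ε₀)
  bound : ∀ l ∈ Finset.Icc 1 (P.D - 1), ∀ j ∈ P.I l, ∀ ε ∈ Metric.ball (0 : ℂ) P.ε₀,
    normE P.β P.μ (fun m => C l j m ε) ≤ ENNReal.ofReal (Ct l j)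

/-- `ψ` is the function `ψ_{k₁}` attached to the formal series `∑ F_n(m,ε) T^n`: the
analytic extension, to the sector `U`, of the sum on the disc of radius `ρ` of the formal `q`-Borel
transform of order `k₁`, with `q`-exponential growth on `U` and the closed disc. -/
structure IsForcing (P : EqParams) (U : Set ℂ) (ρ δ₀ α : ℝ)
    (F : ℕ → ℝ → ℂ → ℂ) (ψ : ℂ → ℝ → ℂ → ℂ) : Prop where
  coeff_mem : ∀ n, ∀ ε ∈ Metric.ball (0 : ℂ) P.ε₀, MemE P.β P.μ (fun m => F n m ε)
  coeff_hol : ∀ n, ∀ m : ℝ, DifferentiableOn ℂ (fun ε => F n m ε) (Metric.ball (0 : ℂ) P.ε₀)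
  coeff_bound : ∃ CF : ℝ, 0 < CF ∧ ∀ n : ℕ, ∀ ε ∈ Metric.ball (0 : ℂ) P.ε₀,
    normE P.β P.μ (fun m => F n m ε) ≤
      ENNReal.ofReal (CF * (ρ ^ n)⁻¹ * P.q ^ ((n : ℝ) * ((n : ℝ) - 1) / (2 * (P.k₁ : ℝ))))
  borel : ∀ ε ∈ Metric.ball (0 : ℂ) P.ε₀, ∀ m : ℝ, ∀ τ ∈ Metric.ball (0 : ℂ) ρ,
    HasSum (fun n => PowerSeries.coeff n
      (formalQBorel P.q P.k₁ (PowerSeries.mk fun n => F n m ε)) * τ ^ n) (ψ τ m ε)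
  cont : ∀ ε ∈ Metric.ball (0 : ℂ) P.ε₀, ContinuousOn (fun p : ℂ × ℝ => ψ p.1 p.2 ε)
    ((U ∪ Metric.closedBall 0 ρ) ×ˢ Set.univ)
  hol_τ : ∀ ε ∈ Metric.ball (0 : ℂ) P.ε₀, ∀ m : ℝ,
    DifferentiableOn ℂ (fun τ => ψ τ m ε) (U ∪ Metric.ball 0 ρ)
  hol_ε : ∀ τ ∈ U ∪ Metric.ball 0 ρ, ∀ m : ℝ,
    DifferentiableOn ℂ (fun ε => ψ τ m ε) (Metric.ball (0 : ℂ) P.ε₀)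
  growth : ∃ Cψ : ℝ, 0 < Cψ ∧ ∀ ε ∈ Metric.ball (0 : ℂ) P.ε₀,
    ∀ τ ∈ U ∪ Metric.closedBall 0 ρ, ∀ m : ℝ,
      ‖ψ τ m ε‖ ≤ Cψ * (Real.exp (-(P.β * |m|)) / (1 + |m|) ^ P.μ) *
        Real.exp ((P.k₁ : ℝ) * Real.log ‖τ + (δ₀ : ℂ)‖ ^ 2 / (2 * Real.log P.q) +
          α * Real.log ‖τ + (δ₀ : ℂ)‖)

/-- The accelerated forcing term `ψ_{k₂}`: the `q`-Laplace transform of order `κ` in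
direction `d` of `ψ_{k₁}` in the first variable. -/
noncomputable def EqParams.accel (P : EqParams) (d : ℝ) (ψ : ℂ → ℝ → ℂ → ℂ)
    (τ : ℂ) (m : ℝ) (ε : ℂ) : ℂ :=
  qLaplace P.q P.κ d (fun h => ψ h m ε) τ

/-- The growth estimate of type `k₂` with constant `Cψ₂` and exponent `ν` for `ψ₂`,
uniform in `ε`. -/
def AccelBound (P : EqParams) (d δt ν Cψ₂ : ℝ) (ψ₂ : ℂ → ℝ → ℂ → ℂ) : Prop :=
  ∀ τ ∈ laplaceDomain d δt, ∀ m : ℝ, ∀ ε ∈ Metric.ball (0 : ℂ) P.ε₀,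
    ‖ψ₂ τ m ε‖ ≤ Cψ₂ * Real.exp (-(P.β * |m|)) * (1 + |m|) ^ (-P.μ) *
      Real.exp ((P.k₂ : ℝ) * Real.log ‖τ‖ ^ 2 / (2 * Real.log P.q) + ν * Real.log ‖τ‖)

/-- `w` solves the convolution equation with coefficients `C`, forcing term `ψ₂` and parameter
`ε`, at every `(τ, m)` with `τ ∈ Ω`. The dilation `σ_q^γ`
acts by `τ ↦ q^γ τ`. -/
def SolvesEq (P : EqParams) (C : ℕ → ℕ → ℝ → ℂ → ℂ) (ψ₂ : ℂ → ℝ → ℂ → ℂ) (ε : ℂ)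
    (Ω : Set ℂ) (w : ℂ → ℝ → ℂ) : Prop :=
  ∀ τ ∈ Ω, ∀ m : ℝ,
    P.Q.eval (Complex.I * (m : ℂ)) * (τ ^ P.k₂ / (qFactor P.q P.k₂ P.k₂ : ℂ)) * w τ m =
      (P.R P.D).eval (Complex.I * (m : ℂ)) *
          (τ ^ (P.dD + P.k₂) / (qFactor P.q P.k₂ (P.dD + P.k₂) : ℂ)) * w τ m
      + ∑ l ∈ Finset.Icc 1 (P.D - 1), ∑ j ∈ P.I l,
          ε ^ (P.Δ l j - P.d l j) * τ ^ (P.d l j + P.k₂) /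
              (qFactor P.q P.k₂ (P.d l j + P.k₂) : ℂ) *
            (1 / (Real.sqrt (2 * Real.pi) : ℂ)) *
            convQ (P.R l) (fun m' => C l j m' ε)
              (fun m' => w (((P.q ^ ((P.δ l : ℝ) - (P.d l j : ℝ) / (P.k₂ : ℝ) - 1) : ℝ) : ℂ) * τ)
                m') m
      + τ ^ P.k₂ / (qFactor P.q P.k₂ P.k₂ : ℂ) * ψ₂ τ m ε

/-! Two independent facts are proved: a growth estimate for the accelerated forcing term, and a
contraction argument for the equation.

Growth. The theta series satisfies Θ(e^σ x) = e^σ x Θ(x), and so does the weight exp(log²|x|/(2σ) +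
log|x|/2) up to absolute values. A lower bound of Θ by this weight, away from the negative axis, is
therefore a compactness statement on one annulus once Θ is known to have no zeros there. The zeros
are read off the Jacobi triple product, obtained as a limit of the finite q-binomial theorem
(`thetaSeries_ne_zero`, `exists_thetaWeight_le_norm_thetaSeries`). With u = e^x e^{id} and t =
log|τ|, the q-Laplace integrand is dominated by a Gaussian in x with rates a = k₁/(2 log q) for
ψ_{k₁} and b = κ/(2 log q) for 1/Θ. As a < b the integral converges. Completing the square gives
growth at rate ab/(b-a) = k₂/(2 log q), which is the relation 1/k₁ - 1/κ = 1/k₂. The exponent ν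
depends on the parameters only (`exists_integral_exp_laplaceExponent_le`, `exists_accelBound`).

Contraction. Dividing by τ^{k₂} P_m(τ) turns the equation into w = Lw + f. The operator L loses a
factor (1+|m|)^{deg R_D} through R_ℓ, and a power of |τ| with exponent k₂(δ_ℓ-1) ≤ d_D - 1 through
τ^{d_{λ,ℓ}} and the dilation. Assumption 1) and the absence of zeros of R_D on the imaginary axis
give |P_m(τ)| ≥ c(1+|m|)^{deg R_D}(1+|τ|)^{d_D}, which pays for both
(`EqParams.exists_le_norm_symbol`, `EqParams.exists_norm_convTerm_le`). Thus the norm of L is at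
most a constant times the size of the coefficients. When it is at most 1/2, the Neumann series
converges and keeps continuity and holomorphy in τ and ε, and the solution is unique
(`IsHalving.exists_fixedPoint`, `IsHalving.unique`). -/

/-! ### Finite q-products and the q-binomial theorem. -/

/-- The finite product `∏_{j<n} (1 - s^{j+1})`. -/
noncomputable def qPoch (s : ℝ) (n : ℕ) : ℝ := ∏ j ∈ Finset.range n, (1 - s ^ (j + 1))

lemma qPoch_succ (s : ℝ) (n : ℕ) : qPoch s (n + 1) = qPoch s n * (1 - s ^ (n + 1)) :=
  Finset.prod_range_succ _ _

lemma qPoch_zero (s : ℝ) : qPoch s 0 = 1 := rfl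

lemma qPoch_pos {s : ℝ} (h0 : 0 < s) (h1 : s < 1) (n : ℕ) : 0 < qPoch s n :=
  Finset.prod_pos fun j _ => sub_pos.2 (pow_lt_one₀ h0.le h1 (by omega))

lemma qPoch_le_one {s : ℝ} (h0 : 0 < s) (h1 : s < 1) (n : ℕ) : qPoch s n ≤ 1 :=
  Finset.prod_le_one (fun j _ => (sub_pos.2 (pow_lt_one₀ h0.le h1 (by omega))).le)
    fun j _ => by linarith [pow_pos h0 (j + 1)]

lemma qPoch_antitone {s : ℝ} (h0 : 0 < s) (h1 : s < 1) : Antitone (qPoch s) := by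
  refine antitone_nat_of_succ_le fun n => ?_
  rw [qPoch_succ]
  have := qPoch_pos h0 h1 n
  have := pow_pos h0 (n + 1)
  nlinarith

/-- The limit is positive because a convergent product without zero factors is nonzero. The lower
bound c serves later to dominate the q-binomial coefficients uniformly. -/
lemma exists_tendsto_qPoch {s : ℝ} (h0 : 0 < s) (h1 : s < 1) :
    ∃ c : ℝ, 0 < c ∧ Filter.Tendsto (qPoch s) Filter.atTop (nhds c) ∧ ∀ n, c ≤ qPoch s n := by
  have hsum : Summable fun j : ℕ => ‖-s ^ (j + 1)‖ := by
    simp only [norm_neg, norm_pow, Real.norm_eq_abs, abs_of_pos h0]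
    exact (summable_nat_add_iff 1).2 (summable_geometric_of_lt_one h0.le h1)
  have hne : ∏' j : ℕ, (1 + -s ^ (j + 1)) ≠ 0 := by
    refine tprod_one_add_ne_zero_of_summable (f := fun j : ℕ => -s ^ (j + 1)) (fun j => ?_) hsum
    have := pow_lt_one₀ h0.le h1 (n := j + 1) (by omega)
    intro h
    linarith
  have ht : Filter.Tendsto (qPoch s) Filter.atTop (nhds (∏' j : ℕ, (1 + -s ^ (j + 1)))) := by
    have := (multipliable_one_add_of_summable hsum).hasProd.tendsto_prod_nat
    simpa only [qPoch, sub_eq_add_neg] using! this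
  have hle : ∀ n, ∏' j : ℕ, (1 + -s ^ (j + 1)) ≤ qPoch s n :=
    fun n => (qPoch_antitone h0 h1).le_of_tendsto ht n
  exact ⟨_, lt_of_le_of_ne (ge_of_tendsto' ht fun n => (qPoch_pos h0 h1 n).le) hne.symm, ht, hle⟩

/-- The Cauchy `q`-binomial theorem. -/
lemma prod_one_add_mul_pow {s : ℝ} (h0 : 0 < s) (h1 : s < 1) (y : ℂ) (N : ℕ) :
    ∏ j ∈ Finset.range N, (1 + y * (s : ℂ) ^ j) =
      ∑ k ∈ Finset.range (N + 1),
        (s : ℂ) ^ (k.choose 2) * ((qPoch s N / (qPoch s k * qPoch s (N - k)) : ℝ) : ℂ) * y ^ k := by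
  have hpos := fun n => (qPoch_pos h0 h1 n).ne'
  induction N with
  | zero => simp [qPoch_zero]
  | succ N ih =>
    rw [Finset.prod_range_succ, ih, mul_add, mul_one, Finset.sum_mul]
    have key : ∀ k ∈ Finset.range N,
        (s : ℂ) ^ ((k + 1).choose 2) *
            ((qPoch s (N + 1) / (qPoch s (k + 1) * qPoch s (N + 1 - (k + 1))) : ℝ) : ℂ) * y ^ (k + 1)
          = (s : ℂ) ^ ((k + 1).choose 2) *
            ((qPoch s N / (qPoch s (k + 1) * qPoch s (N - (k + 1))) : ℝ) : ℂ) * y ^ (k + 1)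
          + (s : ℂ) ^ (k.choose 2) *
            ((qPoch s N / (qPoch s k * qPoch s (N - k)) : ℝ) : ℂ) * y ^ k * (y * (s : ℂ) ^ N) := by
      intro k hk
      obtain ⟨r, rfl⟩ := Nat.exists_eq_add_of_lt (Finset.mem_range.1 hk)
      have e1 : k + r + 1 + 1 - (k + 1) = r + 1 := by omega
      have e2 : k + r + 1 - (k + 1) = r := by omega
      have e3 : k + r + 1 - k = r + 1 := by omega
      have e4 : (k + 1).choose 2 = k + k.choose 2 := by
        rw [Nat.choose_succ_succ' k 1, Nat.choose_one_right]
      rw [e1, e2, e3, e4]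
      -- The q-Pascal rule, with N = k + r + 1 and N - k = r + 1.
      have hreal : qPoch s (k + r + 1 + 1) / (qPoch s (k + 1) * qPoch s (r + 1)) =
          qPoch s (k + r + 1) / (qPoch s (k + 1) * qPoch s r) +
            qPoch s (k + r + 1) / (qPoch s k * qPoch s (r + 1)) * s ^ (r + 1) := by
        have a1 := hpos k
        have a2 := hpos r
        have a3 := hpos (k + 1)
        have a4 := hpos (r + 1)
        rw [qPoch_succ s (k + r + 1)]
        have b1 := qPoch_succ s k
        have b2 := qPoch_succ s r
        rw [b1] at a3 ⊢
        rw [b2] at a4 ⊢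
        have a5 := right_ne_zero_of_mul a3
        have a6 := right_ne_zero_of_mul a4
        field_simp
        ring
      rw [hreal]
      push_cast
      ring
    have e : (N + 1).choose 2 = N + N.choose 2 := by
      rw [Nat.choose_succ_succ' N 1, Nat.choose_one_right]
    rw [Finset.sum_range_succ _ (N + 1), Finset.sum_range_succ' (fun k => (s : ℂ) ^ (k.choose 2) *
        ((qPoch s (N + 1) / (qPoch s k * qPoch s (N + 1 - k)) : ℝ) : ℂ) * y ^ k) N,
      Finset.sum_range_succ' (fun k => (s : ℂ) ^ (k.choose 2) *
        ((qPoch s N / (qPoch s k * qPoch s (N - k)) : ℝ) : ℂ) * y ^ k) N,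
      Finset.sum_congr rfl key, Finset.sum_add_distrib,
      Finset.sum_range_succ (fun k => (s : ℂ) ^ (k.choose 2) *
        ((qPoch s N / (qPoch s k * qPoch s (N - k)) : ℝ) : ℂ) * y ^ k * (y * (s : ℂ) ^ N))]
    simp only [Nat.sub_self, qPoch_zero, Nat.choose_zero_succ, pow_zero, Nat.sub_zero, mul_one,
      one_mul, div_self (hpos _), e, Complex.ofReal_one]
    ring

/-! ### The theta series and the Jacobi triple product. -/

/-- The theta series `∑_{n ∈ ℤ} e^{-σ n(n-1)/2} x^n`. -/
noncomputable def thetaSeries (σ : ℝ) (x : ℂ) : ℂ :=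
  ∑' n : ℤ, ((Real.exp (-(σ * ((n : ℝ) * ((n : ℝ) - 1) / 2))) : ℝ) : ℂ) * x ^ n

lemma qTheta_eq_thetaSeries {q k : ℝ} (hq : 1 < q) (x : ℂ) :
    qTheta q k x = thetaSeries (Real.log q / k) x := by
  unfold qTheta thetaSeries
  congr 1
  ext n
  rw [Real.rpow_def_of_pos (by linarith)]
  congr 4
  ring

/-- The bound is uniform on the annulus |log|x|| ≤ M, as locally uniform convergence requires, and
has the shape of the majorant used for `jacobiTheta₂`. -/
lemma norm_theta_term_le {σ M : ℝ} {x : ℂ} (hx : x ≠ 0) (hM : |Real.log ‖x‖| ≤ M) (n : ℤ) :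
    ‖((Real.exp (-(σ * ((n : ℝ) * ((n : ℝ) - 1) / 2))) : ℝ) : ℂ) * x ^ n‖ ≤
      Real.exp (-Real.pi * (σ / (2 * Real.pi) * (n : ℝ) ^ 2 -
        2 * ((|σ| / 2 + M) / (2 * Real.pi)) * |(n : ℝ)|)) := by
  have hx' : 0 < ‖x‖ := norm_pos_iff.2 hx
  rw [norm_mul, norm_zpow, Complex.norm_real, Real.norm_eq_abs, Real.abs_exp,
    ← Real.exp_log (zpow_pos hx' n), ← Real.exp_add, Real.exp_le_exp, Real.log_zpow]
  have e : -Real.pi * (σ / (2 * Real.pi) * (n : ℝ) ^ 2 -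
        2 * ((|σ| / 2 + M) / (2 * Real.pi)) * |(n : ℝ)|) =
      -(σ / 2) * (n : ℝ) ^ 2 + (|σ| / 2) * |(n : ℝ)| + M * |(n : ℝ)| := by
    field_simp
    ring
  rw [e]
  have h1 : (n : ℝ) * Real.log ‖x‖ ≤ M * |(n : ℝ)| := by
    refine (le_abs_self _).trans ?_
    rw [abs_mul, mul_comm]
    exact mul_le_mul_of_nonneg_right hM (abs_nonneg _)
  have h2 : σ / 2 * (n : ℝ) ≤ (|σ| / 2) * |(n : ℝ)| := by
    refine (le_abs_self _).trans (le_of_eq ?_)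
    rw [abs_mul, abs_div]
    norm_num
  nlinarith

lemma summable_theta_bound {σ : ℝ} (hσ : 0 < σ) (M : ℝ) :
    Summable fun n : ℤ => Real.exp (-Real.pi * (σ / (2 * Real.pi) * (n : ℝ) ^ 2 -
        2 * ((|σ| / 2 + M) / (2 * Real.pi)) * |(n : ℝ)|)) := by
  have := summable_pow_mul_jacobiTheta₂_term_bound ((|σ| / 2 + M) / (2 * Real.pi))
    (T := σ / (2 * Real.pi)) (by positivity) 0
  simpa using this

lemma summable_theta_term {σ : ℝ} (hσ : 0 < σ) {x : ℂ} (hx : x ≠ 0) :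
    Summable fun n : ℤ =>
      ‖((Real.exp (-(σ * ((n : ℝ) * ((n : ℝ) - 1) / 2))) : ℝ) : ℂ) * x ^ n‖ :=
  Summable.of_nonneg_of_le (fun _ => norm_nonneg _) (norm_theta_term_le hx le_rfl)
    (summable_theta_bound hσ _)

lemma differentiableAt_thetaSeries {σ : ℝ} (hσ : 0 < σ) {x : ℂ} (hx : x ≠ 0) :
    DifferentiableAt ℂ (thetaSeries σ) x := by
  set M := |Real.log ‖x‖| + 1
  set U : Set ℂ := {y | y ≠ 0} ∩ (fun y : ℂ => |Real.log ‖y‖|) ⁻¹' Set.Iio M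
  have hU : IsOpen U := by
    refine ContinuousOn.isOpen_inter_preimage (fun y hy => ContinuousAt.continuousWithinAt ?_)
      isOpen_ne isOpen_Iio
    exact ((Real.continuousAt_log (norm_ne_zero_iff.2 hy)).comp continuous_norm.continuousAt).abs
  have hxU : x ∈ U := ⟨hx, by simp [M]⟩
  refine (Complex.differentiableOn_tsum_of_summable_norm (summable_theta_bound hσ M) (fun n => ?_) hU
    fun n w hw => norm_theta_term_le hw.1 (le_of_lt hw.2) n).differentiableAt (hU.mem_nhds hxU)
  intro y hy
  exact ((differentiableAt_zpow.2 (Or.inl hy.1)).const_mul _).differentiableWithinAt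

lemma thetaSeries_exp_mul {σ : ℝ} {x : ℂ} (hx : x ≠ 0) :
    thetaSeries σ ((Real.exp σ : ℝ) * x) = (Real.exp σ : ℝ) * x * thetaSeries σ x := by
  unfold thetaSeries
  rw [← tsum_mul_left, ← (Equiv.addRight (1 : ℤ)).tsum_eq]
  congr 1
  ext n
  simp only [Equiv.coe_addRight]
  have h1 : Real.exp σ ^ (n + 1) = Real.exp (σ * (n + 1)) := by
    rw [← Real.exp_log (zpow_pos (Real.exp_pos σ) (n + 1)), Real.log_zpow, Real.log_exp]
    push_cast
    ring_nf
  have h2 : Real.exp (-(σ * (((n : ℝ) + 1) * (((n : ℝ) + 1) - 1) / 2))) * Real.exp (σ * (n + 1)) =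
      Real.exp σ * Real.exp (-(σ * ((n : ℝ) * ((n : ℝ) - 1) / 2))) := by
    rw [← Real.exp_add, ← Real.exp_add]
    ring_nf
  rw [mul_zpow, zpow_add_one₀ hx, ← Complex.ofReal_zpow, h1]
  have h3 := congrArg (Complex.ofReal) h2
  push_cast at h3 ⊢
  linear_combination (x ^ n * x) * h3

/-- The coefficients of the finite form of the Jacobi triple product. -/
noncomputable def tripleCoeff (s : ℝ) (N : ℕ) (n : ℤ) : ℝ :=
  if n ∈ Finset.Icc (-(N : ℤ)) N then
    qPoch s (2 * N) / (qPoch s (N + n).toNat * qPoch s (N - n).toNat) else 0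

/-- All three q-products tend to c, so the quotient tends to c/(c·c). -/
lemma tendsto_tripleCoeff {s c : ℝ} (hc : 0 < c)
    (ht : Filter.Tendsto (qPoch s) Filter.atTop (nhds c)) (n : ℤ) :
    Filter.Tendsto (fun N => tripleCoeff s N n) Filter.atTop (nhds (1 / c)) := by
  have h0 : Filter.Tendsto (fun N : ℕ => qPoch s (2 * N) /
      (qPoch s (N + n).toNat * qPoch s (N - n).toNat)) Filter.atTop (nhds (c / (c * c))) := by
    refine (ht.comp ?_).div ((ht.comp ?_).mul (ht.comp ?_)) (by positivity)
    · exact Filter.tendsto_atTop_mono (fun N => by simp; omega) Filter.tendsto_id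
    · refine Filter.tendsto_atTop.2 fun b => ?_
      filter_upwards [Filter.eventually_ge_atTop (b + n.natAbs)] with N hN
      omega
    · refine Filter.tendsto_atTop.2 fun b => ?_
      filter_upwards [Filter.eventually_ge_atTop (b + n.natAbs)] with N hN
      omega
  rw [show 1 / c = c / (c * c) by field_simp]
  refine h0.congr' ?_
  filter_upwards [Filter.eventually_ge_atTop n.natAbs] with N hN
  rw [tripleCoeff, if_pos (Finset.mem_Icc.2 (by omega))]

lemma abs_tripleCoeff_le {s c : ℝ} (h0 : 0 < s) (h1 : s < 1) (hc : 0 < c)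
    (hle : ∀ n, c ≤ qPoch s n) (N : ℕ) (n : ℤ) : |tripleCoeff s N n| ≤ 1 / (c * c) := by
  unfold tripleCoeff
  split_ifs
  · have hp := fun n => (qPoch_pos h0 h1 n).le
    rw [abs_of_nonneg (div_nonneg (hp _) (mul_nonneg (hp _) (hp _)))]
    have := hle (N + n).toNat
    have := hle (N - n).toNat
    exact div_le_div₀ zero_le_one (qPoch_le_one h0 h1 _) (by positivity) (mul_le_mul ‹_› ‹_› hc.le (hp _))
  · simp only [abs_zero]
    positivity

/-- The finite form of the Jacobi triple product. -/
lemma finite_triple_product {s : ℝ} (h0 : 0 < s) (h1 : s < 1) {x : ℂ} (hx : x ≠ 0) (N : ℕ) :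
    (∏ j ∈ Finset.range N, (1 + x * (s : ℂ) ^ j)) *
        ∏ j ∈ Finset.range N, (1 + (s : ℂ) ^ (j + 1) / x) =
      ∑ n ∈ Finset.Icc (-(N : ℤ)) N,
        (tripleCoeff s N n : ℂ) * ((s ^ ((n : ℝ) * ((n : ℝ) - 1) / 2) : ℝ) : ℂ) * x ^ n := by
  have hs : (s : ℂ) ≠ 0 := by exact_mod_cast h0.ne'
  -- The q-binomial theorem with 2N factors and y = x s^{-N}: the last N factors are 1 + x s^j, and
  -- the first N are reflected below.
  have hsplit := prod_one_add_mul_pow h0 h1 (x * ((s : ℂ) ^ N)⁻¹) (2 * N)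
  -- Reflection 1 + x s^{-i} = x s^{-i}(1 + s^i/x) for 1 ≤ i ≤ M; the powers s^i multiply to
  -- s^{M(M+1)/2}.
  have hlow : ∀ M : ℕ, (∏ j ∈ Finset.range M, (1 + x * ((s : ℂ) ^ M)⁻¹ * (s : ℂ) ^ j)) *
      (s : ℂ) ^ ((M + 1).choose 2) = x ^ M * ∏ j ∈ Finset.range M, (1 + (s : ℂ) ^ (j + 1) / x) := by
    intro M
    induction M with
    | zero => simp
    | succ M ih =>
      rw [Finset.prod_range_succ', Finset.prod_range_succ _ M]
      have e : ∀ j ∈ Finset.range M, 1 + x * ((s : ℂ) ^ (M + 1))⁻¹ * (s : ℂ) ^ (j + 1) =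
          1 + x * ((s : ℂ) ^ M)⁻¹ * (s : ℂ) ^ j := by
        intro j _
        field_simp
        ring
      rw [Finset.prod_congr rfl e, Nat.choose_succ_succ' (M + 1) 1, Nat.choose_one_right,
        pow_add _ (M + 1)]
      have e2 : (1 + x * ((s : ℂ) ^ (M + 1))⁻¹ * (s : ℂ) ^ 0) * (s : ℂ) ^ (M + 1) =
          x * (1 + (s : ℂ) ^ (M + 1) / x) := by
        field_simp
        ring
      calc _ = ((∏ j ∈ Finset.range M, (1 + x * ((s : ℂ) ^ M)⁻¹ * (s : ℂ) ^ j)) *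
            (s : ℂ) ^ ((M + 1).choose 2)) *
            ((1 + x * ((s : ℂ) ^ (M + 1))⁻¹ * (s : ℂ) ^ 0) * (s : ℂ) ^ (M + 1)) := by ring
        _ = _ := by rw [ih, e2]; ring
  rw [two_mul, Finset.prod_range_add] at hsplit
  have e1 : ∀ j ∈ Finset.range N, 1 + x * ((s : ℂ) ^ N)⁻¹ * (s : ℂ) ^ (N + j) =
      1 + x * (s : ℂ) ^ j := by
    intro j _
    rw [pow_add]
    field_simp
  rw [Finset.prod_congr rfl e1] at hsplit
  have hxN : x ^ N ≠ 0 := pow_ne_zero _ hx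
  apply mul_left_cancel₀ hxN
  calc _ = (x ^ N * ∏ j ∈ Finset.range N, (1 + (s : ℂ) ^ (j + 1) / x)) *
        ∏ j ∈ Finset.range N, (1 + x * (s : ℂ) ^ j) := by ring
    _ = ((∏ j ∈ Finset.range N, (1 + x * ((s : ℂ) ^ N)⁻¹ * (s : ℂ) ^ j)) *
        ∏ j ∈ Finset.range N, (1 + x * (s : ℂ) ^ j)) * (s : ℂ) ^ ((N + 1).choose 2) := by
      rw [← hlow]; ring
    _ = _ := by
      rw [hsplit, Finset.sum_mul, Finset.mul_sum]
      refine Finset.sum_nbij' (fun k => (k : ℤ) - N) (fun n => (n + N).toNat) ?_ ?_ ?_ ?_ ?_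
      · intro k hk
        simp at hk ⊢
        omega
      · intro n hn
        simp at hn ⊢
        omega
      · intro k hk
        simp
      · intro n hn
        simp at hn ⊢
        omega
      · intro k hk
        simp only [Finset.mem_range] at hk
        rw [tripleCoeff, if_pos (Finset.mem_Icc.2 (by omega)),
          show ((N : ℤ) + ((k : ℤ) - N)).toNat = k by omega,
          show ((N : ℤ) - ((k : ℤ) - N)).toNat = N + N - k by omega, two_mul]
        have e3 : x ^ N * x ^ ((k : ℤ) - N) = x ^ k := by
          rw [← zpow_natCast x N, ← zpow_add₀ hx, ← zpow_natCast x k]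
          congr 1
          ring
        -- With n = k - N: k(k-1)/2 - Nk + N(N+1)/2 = n(n-1)/2.
        have e4 : s ^ (k.choose 2) * (s ^ (N * k))⁻¹ * s ^ ((N + 1).choose 2) =
            s ^ ((((k : ℤ) - N : ℤ) : ℝ) * ((((k : ℤ) - N : ℤ) : ℝ) - 1) / 2) := by
          rw [← Real.rpow_natCast, ← Real.rpow_natCast, ← Real.rpow_natCast, ← Real.rpow_neg h0.le,
            ← Real.rpow_add h0, ← Real.rpow_add h0, Nat.cast_choose_two, Nat.cast_choose_two]
          congr 1
          push_cast
          ring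
        have e5 := congrArg Complex.ofReal e4
        push_cast at e5 ⊢
        rw [mul_pow, ← e3, inv_pow, ← pow_mul]
        linear_combination ((qPoch s (N + N) : ℂ) / ((qPoch s k : ℂ) * (qPoch s (N + N - k) : ℂ))) *
          x ^ N * x ^ ((k : ℤ) - N) * e5

/-- The theta series vanishes only on the negative real axis. -/
lemma thetaSeries_ne_zero {σ : ℝ} (hσ : 0 < σ) {x : ℂ} (hx : x ≠ 0)
    (hneg : ∀ r : ℝ, 0 ≤ r → 1 + (r : ℂ) * x ≠ 0) : thetaSeries σ x ≠ 0 := by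
  set s := Real.exp (-σ)
  have h0 : 0 < s := Real.exp_pos _
  have h1 : s < 1 := Real.exp_lt_one_iff.mpr (by linarith)
  have hsn : ‖(s : ℂ)‖ = s := by rw [Complex.norm_real, Real.norm_eq_abs, abs_of_pos h0]
  obtain ⟨c, hc, ht, hle⟩ := exists_tendsto_qPoch h0 h1
  have hterm : ∀ n : ℤ, s ^ ((n : ℝ) * ((n : ℝ) - 1) / 2) =
      Real.exp (-(σ * ((n : ℝ) * ((n : ℝ) - 1) / 2))) := by
    intro n
    rw [← Real.exp_mul]
    congr 1
    ring
  -- The coefficients of the finite identity tend to 1/c and are bounded by 1/c², so the theta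
  -- series itself provides the dominating sum.
  have hlim : Filter.Tendsto (fun N : ℕ => ∑' n : ℤ, (tripleCoeff s N n : ℂ) *
      (((Real.exp (-(σ * ((n : ℝ) * ((n : ℝ) - 1) / 2))) : ℝ) : ℂ) * x ^ n)) Filter.atTop
      (nhds (∑' n : ℤ, ((1 / c : ℝ) : ℂ) *
      (((Real.exp (-(σ * ((n : ℝ) * ((n : ℝ) - 1) / 2))) : ℝ) : ℂ) * x ^ n))) := by
    refine tendsto_tsum_of_dominated_convergence
      ((summable_theta_term hσ hx).mul_left (1 / (c * c))) (fun n => ?_)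
      (Filter.Eventually.of_forall fun N n => ?_)
    · exact (Complex.continuous_ofReal.continuousAt.tendsto.comp
        (tendsto_tripleCoeff hc ht n)).mul_const _
    · rw [norm_mul, Complex.norm_real, Real.norm_eq_abs]
      exact mul_le_mul_of_nonneg_right (abs_tripleCoeff_le h0 h1 hc hle N n) (norm_nonneg _)
  have hfin : ∀ N : ℕ, ∑' n : ℤ, (tripleCoeff s N n : ℂ) *
      (((Real.exp (-(σ * ((n : ℝ) * ((n : ℝ) - 1) / 2))) : ℝ) : ℂ) * x ^ n) =
      (∏ j ∈ Finset.range N, (1 + x * (s : ℂ) ^ j)) *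
        ∏ j ∈ Finset.range N, (1 + (s : ℂ) ^ (j + 1) / x) := by
    intro N
    rw [finite_triple_product h0 h1 hx, tsum_eq_sum (s := Finset.Icc (-(N : ℤ)) N)]
    · refine Finset.sum_congr rfl fun n _ => ?_
      rw [hterm, mul_assoc]
    · intro n hn
      rw [tripleCoeff, if_neg hn]
      simp
  simp_rw [hfin] at hlim
  rw [tsum_mul_left] at hlim
  have hsumA : Summable fun j : ℕ => ‖x * (s : ℂ) ^ j‖ := by
    simp only [norm_mul, norm_pow, hsn]
    exact (summable_geometric_of_lt_one h0.le h1).mul_left _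
  have hsumB : Summable fun j : ℕ => ‖(s : ℂ) ^ (j + 1) / x‖ := by
    simp only [norm_div, norm_pow, hsn]
    exact ((summable_nat_add_iff 1).2 (summable_geometric_of_lt_one h0.le h1)).div_const _
  have hA : ∏' j : ℕ, (1 + x * (s : ℂ) ^ j) ≠ 0 := by
    refine tprod_one_add_ne_zero_of_summable (f := fun j : ℕ => x * (s : ℂ) ^ j) (fun j => ?_) hsumA
    have := hneg (s ^ j) (by positivity)
    push_cast at this
    rwa [mul_comm x]
  have hB : ∏' j : ℕ, (1 + (s : ℂ) ^ (j + 1) / x) ≠ 0 := by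
    refine tprod_one_add_ne_zero_of_summable (f := fun j : ℕ => (s : ℂ) ^ (j + 1) / x)
      (fun j => ?_) hsumB
    have hs : (s : ℂ) ≠ 0 := by exact_mod_cast h0.ne'
    have h2 := hneg ((s ^ (j + 1))⁻¹) (by positivity)
    push_cast at h2
    intro h3
    apply h2
    field_simp at h3 ⊢
    linear_combination h3
  have hprod := ((multipliable_one_add_of_summable hsumA).hasProd.tendsto_prod_nat).mul
    ((multipliable_one_add_of_summable hsumB).hasProd.tendsto_prod_nat)
  -- This is Θ(x)/c = ∏(1 + x s^j) ∏(1 + s^{j+1}/x), and neither product vanishes.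
  have heq := tendsto_nhds_unique hlim hprod
  intro hz
  change ((1 / c : ℝ) : ℂ) * thetaSeries σ x = _ at heq
  rw [hz, mul_zero] at heq
  exact mul_ne_zero hA hB heq.symm

/-! ### Lower bound for the theta series away from the negative axis. -/

/-- The set of `x ≠ 0` such that `|1 + r x| ≥ η` for all `r ≥ 0`, a closed sector without vertex
around the positive real axis. -/
def awayFromNegReals (η : ℝ) : Set ℂ := {x | x ≠ 0 ∧ ∀ r : ℝ, 0 ≤ r → η ≤ ‖1 + (r : ℂ) * x‖}

lemma one_add_mul_ne_zero {η : ℝ} (hη : 0 < η) {x : ℂ} (hx : x ∈ awayFromNegReals η) (r : ℝ)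
    (hr : 0 ≤ r) : 1 + (r : ℂ) * x ≠ 0 :=
  norm_pos_iff.1 (hη.trans_le (hx.2 r hr))

lemma mul_mem_awayFromNegReals {η : ℝ} {x : ℂ} (hx : x ∈ awayFromNegReals η) {r : ℝ} (hr : 0 < r) :
    (r : ℂ) * x ∈ awayFromNegReals η := by
  refine ⟨mul_ne_zero (by exact_mod_cast hr.ne') hx.1, fun t ht => ?_⟩
  have := hx.2 (t * r) (by positivity)
  rwa [Complex.ofReal_mul, mul_assoc] at this

/-- The growth rate of the theta series. -/
noncomputable def thetaWeight (σ : ℝ) (x : ℂ) : ℝ :=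
  Real.exp (Real.log ‖x‖ ^ 2 / (2 * σ) + Real.log ‖x‖ / 2)

/-- Numerator and denominator both acquire the factor e^σ|x|: the weight is built so that this
quotient is invariant under x ↦ e^σ x. -/
lemma norm_thetaSeries_div_exp_mul {σ : ℝ} (hσ : 0 < σ) {x : ℂ} (hx : x ≠ 0) :
    ‖thetaSeries σ ((Real.exp σ : ℝ) * x)‖ / thetaWeight σ ((Real.exp σ : ℝ) * x) =
      ‖thetaSeries σ x‖ / thetaWeight σ x := by
  have hx' : 0 < ‖x‖ := norm_pos_iff.2 hx
  have hw : thetaWeight σ ((Real.exp σ : ℝ) * x) = Real.exp σ * ‖x‖ * thetaWeight σ x := by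
    unfold thetaWeight
    rw [norm_mul, Complex.norm_real, Real.norm_eq_abs, Real.abs_exp,
      Real.log_mul (Real.exp_pos _).ne' hx'.ne', Real.log_exp]
    rw [show Real.exp σ * ‖x‖ = Real.exp σ * Real.exp (Real.log ‖x‖) by rw [Real.exp_log hx'],
      ← Real.exp_add, ← Real.exp_add]
    congr 1
    field_simp
    ring
  rw [thetaSeries_exp_mul hx, hw, norm_mul, norm_mul, Complex.norm_real, Real.norm_eq_abs,
    Real.abs_exp]
  have : 0 < thetaWeight σ x := Real.exp_pos _
  field_simp

lemma norm_thetaSeries_div_exp_zpow_mul {σ : ℝ} (hσ : 0 < σ) {x : ℂ} (hx : x ≠ 0) (n : ℤ) :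
    ‖thetaSeries σ ((Real.exp (n * σ) : ℝ) * x)‖ / thetaWeight σ ((Real.exp (n * σ) : ℝ) * x) =
      ‖thetaSeries σ x‖ / thetaWeight σ x := by
  have step : ∀ n : ℤ, ‖thetaSeries σ ((Real.exp ((n + 1 : ℤ) * σ) : ℝ) * x)‖ /
      thetaWeight σ ((Real.exp ((n + 1 : ℤ) * σ) : ℝ) * x) =
      ‖thetaSeries σ ((Real.exp (n * σ) : ℝ) * x)‖ /
        thetaWeight σ ((Real.exp (n * σ) : ℝ) * x) := by
    intro n
    have hne : ((Real.exp (n * σ) : ℝ) : ℂ) * x ≠ 0 :=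
      mul_ne_zero (by exact_mod_cast (Real.exp_pos _).ne') hx
    rw [← norm_thetaSeries_div_exp_mul hσ hne, ← mul_assoc, ← Complex.ofReal_mul, ← Real.exp_add]
    push_cast
    ring_nf
  induction n with
  | zero => simp
  | succ n ih => exact (step n).trans ih
  | pred n ih =>
    have := step (-(n : ℤ) - 1)
    rw [sub_add_cancel] at this
    exact this.symm.trans ih

/-- The lower bound for the theta series away from the negative real axis. -/
lemma exists_thetaWeight_le_norm_thetaSeries {σ η : ℝ} (hσ : 0 < σ) (hη : 0 < η) :
    ∃ c : ℝ, 0 < c ∧ ∀ x ∈ awayFromNegReals η, c * thetaWeight σ x ≤ ‖thetaSeries σ x‖ := by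
  -- A compact fundamental annulus for x ↦ e^σ x, cut by the closed sector condition. It is empty
  -- when η > 1, whence the case distinction below.
  set K : Set ℂ := (Metric.closedBall 0 (Real.exp σ) ∩ {x : ℂ | 1 ≤ ‖x‖}) ∩
    {x : ℂ | ∀ r : ℝ, 0 ≤ r → η ≤ ‖1 + (r : ℂ) * x‖}
  have hK : IsCompact K := by
    have hc : IsClosed {x : ℂ | ∀ r : ℝ, 0 ≤ r → η ≤ ‖1 + (r : ℂ) * x‖} := by
      simp only [Set.ofPred_forall]
      exact isClosed_iInter fun r => isClosed_iInter fun _ =>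
        isClosed_le continuous_const (by fun_prop)
    exact ((isCompact_closedBall _ _).inter_right
      (isClosed_le continuous_const continuous_norm)).inter_right hc
  have hK0 : ∀ x ∈ K, x ≠ 0 := fun x hx h => by
    have := hx.1.2
    simp [h] at this
    linarith
  have hcont : ContinuousOn (fun x => ‖thetaSeries σ x‖ / thetaWeight σ x) K := by
    intro x hx
    have hx0 := hK0 x hx
    have hl : ContinuousAt (fun y : ℂ => Real.log ‖y‖) x :=
      (Real.continuousAt_log (norm_ne_zero_iff.2 hx0)).comp continuous_norm.continuousAt
    refine ((differentiableAt_thetaSeries hσ hx0).continuousAt.norm.div ?_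
      (Real.exp_pos _).ne').continuousWithinAt
    exact (((hl.pow 2).div_const _).add (hl.div_const _)).rexp
  have hpos : ∀ x ∈ K, 0 < ‖thetaSeries σ x‖ / thetaWeight σ x := fun x hx =>
    div_pos (norm_pos_iff.2 (thetaSeries_ne_zero hσ (hK0 x hx)
      (one_add_mul_ne_zero hη ⟨hK0 x hx, hx.2⟩))) (Real.exp_pos _)
  obtain ⟨c, hc, hcK⟩ : ∃ c : ℝ, 0 < c ∧ ∀ x ∈ K, c ≤ ‖thetaSeries σ x‖ / thetaWeight σ x := by
    rcases K.eq_empty_or_nonempty with h | h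
    · exact ⟨1, one_pos, by simp [h]⟩
    · obtain ⟨x, hx, hmin⟩ := hK.exists_isMinOn h hcont
      exact ⟨_, hpos x hx, fun y hy => hmin hy⟩
  refine ⟨c, hc, fun x hx => ?_⟩
  have hx' : 0 < ‖x‖ := norm_pos_iff.2 hx.1
  -- The scaling exponent that brings log|x| into [0, σ).
  set n : ℤ := -⌊Real.log ‖x‖ / σ⌋
  have hmem : ((Real.exp (n * σ) : ℝ) : ℂ) * x ∈ K := by
    have h1 := Int.floor_le (Real.log ‖x‖ / σ)
    have h2 := Int.lt_floor_add_one (Real.log ‖x‖ / σ)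
    rw [le_div_iff₀ hσ] at h1
    rw [div_lt_iff₀ hσ] at h2
    have hn : ‖((Real.exp (n * σ) : ℝ) : ℂ) * x‖ = Real.exp (n * σ + Real.log ‖x‖) := by
      rw [norm_mul, Complex.norm_real, Real.norm_eq_abs, Real.abs_exp, Real.exp_add,
        Real.exp_log hx']
    refine ⟨⟨?_, ?_⟩, (mul_mem_awayFromNegReals hx (Real.exp_pos _)).2⟩
    · rw [mem_closedBall_zero_iff, hn, Real.exp_le_exp]
      simp only [n]
      push_cast
      nlinarith
    · change 1 ≤ ‖_‖
      rw [hn, Real.one_le_exp_iff]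
      simp only [n]
      push_cast
      nlinarith
  have := hcK _ hmem
  rw [norm_thetaSeries_div_exp_zpow_mul hσ hx.1 n, le_div_iff₀ (show 0 < thetaWeight σ x from Real.exp_pos _)] at this
  exact this

/-! ### Parameter integrals. -/

/-- Holomorphy of parameter integrals under local domination. -/
lemma differentiableOn_integral_of_locally_dominated {X : Type*} [MeasurableSpace X]
    {ν : MeasureTheory.Measure X} {U : Set ℂ} (hU : IsOpen U) {F : ℂ → X → ℂ}
    (hd : ∀ a, DifferentiableOn ℂ (fun z => F z a) U)
    (hm : ∀ z ∈ U, MeasureTheory.AEStronglyMeasurable (F z) ν)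
    (hb : ∀ z ∈ U, ∃ V ∈ nhds z, ∃ g : X → ℝ, MeasureTheory.Integrable g ν ∧
      ∀ w ∈ V ∩ U, ∀ a, ‖F w a‖ ≤ g a) :
    DifferentiableOn ℂ (fun z => ∫ a, F z a ∂ν) U := by
  intro z hz
  obtain ⟨V, hV, g, hg, hFg⟩ := hb z hz
  obtain ⟨r, hr, hrV⟩ := Metric.nhds_basis_closedBall.mem_iff.1
    (Filter.inter_mem hV (hU.mem_nhds hz))
  have hr2 : 0 < r / 2 := by positivity
  have hsub : ∀ w ∈ Metric.ball z (r / 2), Metric.closedBall w (r / 2) ⊆ V ∩ U := by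
    intro w hw y hy
    refine hrV ?_
    rw [Metric.mem_closedBall] at hy ⊢
    rw [Metric.mem_ball] at hw
    linarith [dist_triangle y w z]
  have hUw : ∀ w ∈ Metric.ball z (r / 2), w ∈ U := fun w hw =>
    (hsub w hw (Metric.mem_closedBall_self hr2.le)).2
  have hmeas' : MeasureTheory.AEStronglyMeasurable (fun a => deriv (fun y => F y a) z) ν := by
    -- The derivative is measurable in a, being a pointwise limit of difference quotients with
    -- increments small enough to stay in U.
    set u : ℕ → ℂ := fun n => ((r / 2 / ((n : ℝ) + 1) : ℝ) : ℂ)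
    have hu0 : ∀ n, u n ≠ 0 := fun n => by
      simp only [u]
      exact_mod_cast (by positivity : r / 2 / ((n : ℝ) + 1) ≠ 0)
    have hulim : Filter.Tendsto u Filter.atTop (nhds 0) := by
      have : Filter.Tendsto (fun n : ℕ => r / 2 / ((n : ℝ) + 1)) Filter.atTop (nhds 0) :=
        tendsto_const_nhds.div_atTop
          (Filter.tendsto_atTop_add_const_right _ _ tendsto_natCast_atTop_atTop)
      simpa only [Complex.ofReal_zero] using! (Complex.continuous_ofReal.tendsto 0).comp this
    have hu : Filter.Tendsto u Filter.atTop (nhdsWithin 0 {0}ᶜ) :=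
      tendsto_nhdsWithin_iff.2 ⟨hulim, Filter.Eventually.of_forall hu0⟩
    have huU : ∀ n, z + u n ∈ U := fun n => by
      refine (hrV ?_).2
      rw [Metric.mem_closedBall, dist_eq_norm, add_sub_cancel_left]
      simp only [u]
      rw [Complex.norm_real, Real.norm_eq_abs, abs_of_pos (by positivity)]
      rw [div_div, div_le_iff₀ (by positivity)]
      have : (0 : ℝ) ≤ n := Nat.cast_nonneg n
      nlinarith
    refine aestronglyMeasurable_of_tendsto_ae Filter.atTop
      (f := fun n a => (u n)⁻¹ • (F (z + u n) a - F z a)) (fun n => ?_)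
      (Filter.Eventually.of_forall fun a => ?_)
    · exact ((hm _ (huU n)).sub (hm z hz)).const_smul (u n)⁻¹
    · have := ((hd a).differentiableAt (hU.mem_nhds hz)).hasDerivAt
      exact (hasDerivAt_iff_tendsto_slope_zero.1 this).comp hu
  have key := hasDerivAt_integral_of_dominated_loc_of_deriv_le (μ := ν) (F := F)
    (F' := fun w a => deriv (fun y => F y a) w) (x₀ := z) (bound := fun a => g a / (r / 2))
    (Metric.ball_mem_nhds z hr2)
    (Filter.eventually_of_mem (hU.mem_nhds hz) hm)
    (hg.mono' (hm z hz) (Filter.Eventually.of_forall fun a => hFg z (hrV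
      (Metric.mem_closedBall_self hr.le)) a)) hmeas'
    (Filter.Eventually.of_forall fun a w hw => ?_) (hg.div_const _)
    (Filter.Eventually.of_forall fun a w hw =>
      ((hd a).differentiableAt (hU.mem_nhds (hUw w hw))).hasDerivAt)
  · exact key.2.differentiableAt.differentiableWithinAt
  -- Cauchy's estimate on a circle of radius r/2 turns domination of F into domination of its
  -- derivative.
  · refine Complex.norm_deriv_le_of_forall_mem_sphere_norm_le hr2 ?_ fun y hy =>
      hFg y (hsub w hw (Metric.sphere_subset_closedBall hy)) a
    refine DifferentiableOn.diffContOnCl ((hd a).mono ?_)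
    exact (Metric.closure_ball_subset_closedBall).trans fun y hy => (hsub w hw hy).2

/-! ### Gaussian integrals behind the q-Laplace transform. -/

lemma integrable_exp_quadratic {p : ℝ} (hp : 0 < p) (r s : ℝ) :
    MeasureTheory.Integrable fun x : ℝ => Real.exp (-p * x ^ 2 + r * x + s) := by
  have h := ((integrable_exp_neg_mul_sq hp).comp_sub_right (r / (2 * p))).mul_const
    (Real.exp (r ^ 2 / (4 * p) + s))
  refine h.congr (Filter.Eventually.of_forall fun x => ?_)
  simp only
  rw [← Real.exp_add]
  congr 1
  field_simp
  ring

lemma integral_exp_quadratic {p : ℝ} (hp : 0 < p) (r s : ℝ) :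
    ∫ x : ℝ, Real.exp (-p * x ^ 2 + r * x + s) =
      √(Real.pi / p) * Real.exp (r ^ 2 / (4 * p) + s) := by
  rw [← integral_gaussian, ← MeasureTheory.integral_sub_right_eq_self (fun x => Real.exp (-p * x ^ 2)) (r / (2 * p)),
    ← MeasureTheory.integral_mul_const]
  congr 1
  ext x
  rw [← Real.exp_add]
  congr 1
  field_simp
  ring

/-- The exponent dominating the integrand of the `q`-Laplace transform after the substitution
`r = e^x`, where `t = log |τ|`. -/
noncomputable def laplaceExponent (a A α b t x : ℝ) : ℝ :=
  a * (max x 0 + A) ^ 2 + α * (max x 0 + A) - b * (x - t) ^ 2 - (x - t) / 2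

lemma continuous_laplaceExponent (a A α b t : ℝ) : Continuous (laplaceExponent a A α b t) := by
  unfold laplaceExponent
  fun_prop

/-- One majorant for all |t| ≤ T is what dominated convergence near a given τ needs. The exponent is
at most -(b-a)x² + r|x| + s, and e^{r|x|} is at most e^{rx} + e^{-rx}. -/
lemma exists_integrable_laplace_bound {a A α b : ℝ} (ha : 0 < a) (hA : 0 ≤ A) (hα : 0 ≤ α)
    (hab : a < b) (T : ℝ) : ∃ g : ℝ → ℝ, MeasureTheory.Integrable g ∧
      ∀ t, |t| ≤ T → ∀ x, Real.exp (laplaceExponent a A α b t x) ≤ g x := by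
  set r := 2 * a * A + α + 2 * b * T + 1 / 2
  set s := a * A ^ 2 + α * A + T / 2
  refine ⟨fun x => Real.exp (-(b - a) * x ^ 2 + r * x + s) +
    Real.exp (-(b - a) * x ^ 2 + (-r) * x + s),
    (integrable_exp_quadratic (by linarith) _ _).add (integrable_exp_quadratic (by linarith) _ _),
    fun t ht x => ?_⟩
  have hT : 0 ≤ T := (abs_nonneg t).trans ht
  have h : laplaceExponent a A α b t x ≤ -(b - a) * x ^ 2 + r * |x| + s := by
    unfold laplaceExponent
    have h1 : max x 0 ≤ |x| := max_le (le_abs_self x) (abs_nonneg x)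
    have h0 : 0 ≤ max x 0 := le_max_right _ _
    have h2 : a * (max x 0 + A) ^ 2 ≤ a * (|x| + A) ^ 2 := by gcongr
    have h3 : α * (max x 0 + A) ≤ α * (|x| + A) := by gcongr
    have h4 : x * t ≤ |x| * T := by
      refine (le_abs_self _).trans ?_
      rw [abs_mul]
      exact mul_le_mul_of_nonneg_left ht (abs_nonneg _)
    have h5 := neg_abs_le x
    have h6 := (le_abs_self t).trans ht
    have h7 : b * (x * t) ≤ b * (|x| * T) := mul_le_mul_of_nonneg_left h4 (by linarith)
    have h8 : 0 ≤ b * t ^ 2 := mul_nonneg (by linarith) (sq_nonneg t)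
    simp only [r, s]
    nlinarith [sq_abs x]
  rcases abs_cases x with ⟨hx, _⟩ | ⟨hx, _⟩
  · refine (Real.exp_le_exp.2 h).trans ?_
    rw [hx]
    exact le_add_of_nonneg_right (Real.exp_pos _).le
  · refine (Real.exp_le_exp.2 h).trans ?_
    rw [hx, mul_neg, ← neg_mul]
    exact le_add_of_nonneg_left (Real.exp_pos _).le

lemma integrable_exp_laplaceExponent {a A α b : ℝ} (ha : 0 < a) (hA : 0 ≤ A) (hα : 0 ≤ α)
    (hab : a < b) (t : ℝ) :
    MeasureTheory.Integrable fun x => Real.exp (laplaceExponent a A α b t x) := by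
  obtain ⟨g, hg, h⟩ := exists_integrable_laplace_bound ha hA hα hab |t|
  refine hg.mono' (continuous_laplaceExponent a A α b t).rexp.aestronglyMeasurable
    (Filter.Eventually.of_forall fun x => ?_)
  rw [Real.norm_eq_abs, Real.abs_exp]
  exact h t le_rfl x

/-- The integral is split at x = 0. For x ≤ 0 the rate a is absent and the Gaussian integral does
not depend on t. For x ≥ 0 completing the square gives t² the coefficient b²/(b-a) - b = ab/(b-a),
and the linear coefficient in t is the ν chosen here. -/
lemma exists_integral_exp_laplaceExponent_le {a A α b : ℝ} (ha : 0 < a) (hA : 0 ≤ A) (hα : 0 ≤ α)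
    (hab : a < b) : ∃ ν M : ℝ, 0 < M ∧ ∀ t : ℝ,
      ∫ x, Real.exp (laplaceExponent a A α b t x) ≤
        M * Real.exp (a * b / (b - a) * t ^ 2 + ν * t) := by
  have hb : 0 < b := ha.trans hab
  have hba : 0 < b - a := by linarith
  set c₁ := 2 * a * A + α - 1 / 2
  set c₂ := a * A ^ 2 + α * A
  set w := a * b / (b - a)
  have hw : 0 < w := by positivity
  set ν := b * c₁ / (b - a) + 1 / 2
  set K₁ := √(Real.pi / b) * Real.exp (1 / (16 * b) + c₂)
  set K₂ := √(Real.pi / (b - a)) * Real.exp (c₁ ^ 2 / (4 * (b - a)) + c₂)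
  have hK₁ : 0 < K₁ := by positivity
  have hK₂ : 0 < K₂ := by positivity
  refine ⟨ν, K₁ * Real.exp (ν ^ 2 / (4 * w)) + K₂, by positivity, fun t => ?_⟩
  have i1 := integrable_exp_quadratic hb (2 * b * t - 1 / 2) (-b * t ^ 2 + t / 2 + c₂)
  have i2 := integrable_exp_quadratic hba (2 * b * t + c₁) (-b * t ^ 2 + t / 2 + c₂)
  have hle : ∀ x, Real.exp (laplaceExponent a A α b t x) ≤
      Real.exp (-b * x ^ 2 + (2 * b * t - 1 / 2) * x + (-b * t ^ 2 + t / 2 + c₂)) +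
      Real.exp (-(b - a) * x ^ 2 + (2 * b * t + c₁) * x + (-b * t ^ 2 + t / 2 + c₂)) := by
    intro x
    rcases le_total x 0 with hx | hx
    · refine le_trans (le_of_eq ?_) (le_add_of_nonneg_right (Real.exp_pos _).le)
      congr 1
      rw [laplaceExponent, max_eq_right hx]
      simp only [c₂]
      ring
    · refine le_trans (le_of_eq ?_) (le_add_of_nonneg_left (Real.exp_pos _).le)
      congr 1
      rw [laplaceExponent, max_eq_left hx]
      simp only [c₁, c₂]
      ring
  refine (MeasureTheory.integral_mono (integrable_exp_laplaceExponent ha hA hα hab t)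
    (i1.add i2) hle).trans ?_
  rw [MeasureTheory.integral_add' i1 i2, integral_exp_quadratic hb, integral_exp_quadratic hba,
    add_mul]
  refine add_le_add ?_ (le_of_eq ?_)
  · simp only [K₁]
    rw [mul_assoc √(Real.pi / b), ← Real.exp_add, mul_assoc √(Real.pi / b), ← Real.exp_add]
    refine mul_le_mul_of_nonneg_left (Real.exp_le_exp.2 ?_) (Real.sqrt_nonneg _)
    have e : (2 * b * t - 1 / 2) ^ 2 / (4 * b) + (-b * t ^ 2 + t / 2 + c₂) =
        1 / (16 * b) + c₂ := by
      field_simp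
      ring
    rw [e]
    -- The part from x ≤ 0 is constant in t. It is absorbed because w t² + ν t is bounded below by
    -- -ν²/(4w).
    have : ν ^ 2 / (4 * w) + (w * t ^ 2 + ν * t) = (2 * w * t + ν) ^ 2 / (4 * w) := by
      field_simp
      ring
    have : 0 ≤ (2 * w * t + ν) ^ 2 / (4 * w) := by positivity
    linarith
  · simp only [K₂]
    rw [mul_assoc √(Real.pi / (b - a)), ← Real.exp_add]
    congr 2
    simp only [w, ν]
    field_simp
    ring

/-! ### The integration ray and the sectors for the Laplace transform. -/

/-- The parametrization `x ↦ e^x e^{id}` of the open half-line of direction `d`. -/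
noncomputable def ray (d x : ℝ) : ℂ := (Real.exp x : ℝ) * Complex.exp ((d : ℂ) * Complex.I)

lemma ray_ne_zero (d x : ℝ) : ray d x ≠ 0 :=
  mul_ne_zero (by exact_mod_cast (Real.exp_pos x).ne') (Complex.exp_ne_zero _)

lemma norm_ray (d x : ℝ) : ‖ray d x‖ = Real.exp x := by
  rw [ray, norm_mul, Complex.norm_exp_ofReal_mul_I, Complex.norm_real, Real.norm_eq_abs,
    Real.abs_exp, mul_one]

lemma continuous_ray (d : ℝ) : Continuous (ray d) :=
  (Complex.continuous_ofReal.comp Real.continuous_exp).mul continuous_const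

lemma ray_mem_infiniteSector {d θ : ℝ} (hθ : 0 < θ) (x : ℝ) : ray d x ∈ infiniteSector d θ := by
  refine ⟨ray_ne_zero d x, ?_⟩
  rw [ray, mul_assoc, ← Complex.exp_add, ← add_mul, add_neg_cancel, zero_mul, Complex.exp_zero,
    mul_one, Complex.arg_ofReal_of_nonneg (Real.exp_pos x).le, abs_zero]
  exact hθ

/-- The substitution r = e^x turns dr/r into dx, and log-quadratic growth into genuine Gaussians. -/
lemma qLaplace_eq {q k γ : ℝ} (hq : 1 < q) (f : ℂ → ℂ) (T : ℂ) :
    qLaplace q k γ f T = 1 / (qPi q k : ℂ) *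
      ∫ x : ℝ, f (ray γ x) / thetaSeries (Real.log q / k) (ray γ x / T) := by
  have h := MeasureTheory.integral_image_eq_integral_abs_deriv_smul (s := Set.univ)
    (f := Real.exp) (f' := Real.exp) MeasurableSet.univ
    (fun x _ => (Real.hasDerivAt_exp x).hasDerivWithinAt) Real.exp_injective.injOn
    (fun r => f ((r : ℂ) * Complex.exp ((γ : ℂ) * Complex.I)) /
      qTheta q k ((r : ℂ) * Complex.exp ((γ : ℂ) * Complex.I) / T) / (r : ℂ))
  rw [Set.image_univ, Real.range_exp, MeasureTheory.setIntegral_univ] at h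
  rw [qLaplace, h]
  congr 2
  ext x
  have hx : ((Real.exp x : ℝ) : ℂ) ≠ 0 := by exact_mod_cast (Real.exp_pos x).ne'
  rw [qTheta_eq_thetaSeries hq, Real.abs_exp, Complex.real_smul, mul_div_cancel₀ _ hx]
  rfl

/-- The set of `T ≠ 0` such that `|1 + e^{id} r / T| ≥ η` for all `r ≥ 0`. -/
def laplaceSector (d η : ℝ) : Set ℂ :=
  {T | T ≠ 0 ∧ ∀ r : ℝ, 0 ≤ r → η ≤ ‖1 + (r : ℂ) * (Complex.exp ((d : ℂ) * Complex.I) / T)‖}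

lemma laplaceDomain_subset_laplaceSector (d η : ℝ) : laplaceDomain d η ⊆ laplaceSector d η := by
  refine fun T hT => ⟨hT.1, fun r hr => ?_⟩
  have := (hT.2 r hr).le
  rwa [mul_comm, mul_div_assoc] at this

/-- The non-strict condition survives limits at nonzero points. It is needed because the equation is
posed on the closure of the bounded sector. -/
lemma closure_laplaceDomain_diff_subset (d η : ℝ) :
    closure (laplaceDomain d η) \ {0} ⊆ laplaceSector d η := by
  rintro T ⟨hT, hT0⟩
  refine ⟨hT0, fun r hr => ?_⟩
  have : (nhdsWithin T (laplaceDomain d η)).NeBot := mem_closure_iff_nhdsWithin_neBot.1 hT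
  have hc : ContinuousAt
      (fun y : ℂ => ‖1 + (r : ℂ) * (Complex.exp ((d : ℂ) * Complex.I) / y)‖) T :=
    (continuousAt_const.add (continuousAt_const.mul
      (continuousAt_const.div continuousAt_id hT0))).norm
  refine ge_of_tendsto (hc.tendsto.mono_left
    (nhdsWithin_le_nhds (s := laplaceDomain d η))) ?_
  filter_upwards [self_mem_nhdsWithin] with y hy
  exact (laplaceDomain_subset_laplaceSector d η hy).2 r hr

lemma expDomain_subset_laplaceSector {d η : ℝ} {S R : Set ℂ} (hS : S ⊆ laplaceDomain d η)
    (hR : R ⊆ laplaceDomain d η) : expDomain S R ⊆ laplaceSector d η := by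
  rintro T ⟨hT | hT, hT0⟩
  · exact laplaceDomain_subset_laplaceSector d η (hS hT)
  · exact closure_laplaceDomain_diff_subset d η ⟨closure_mono hR hT, hT0⟩

lemma ray_div_mem_awayFromNegReals {d η : ℝ} {T : ℂ} (hT : T ∈ laplaceSector d η) (x : ℝ) :
    ray d x / T ∈ awayFromNegReals η := by
  have h : Complex.exp ((d : ℂ) * Complex.I) / T ∈ awayFromNegReals η :=
    ⟨div_ne_zero (Complex.exp_ne_zero _) hT.1, hT.2⟩
  have := mul_mem_awayFromNegReals h (Real.exp_pos x)
  rwa [← mul_div_assoc] at this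

lemma log_norm_ray_div (d x : ℝ) {T : ℂ} (hT : T ≠ 0) :
    Real.log ‖ray d x / T‖ = x - Real.log ‖T‖ := by
  rw [norm_div, norm_ray, Real.log_div (Real.exp_pos x).ne' (norm_ne_zero_iff.2 hT), Real.log_exp]

lemma EqParams.Admissible.log_q_pos {P : EqParams} (hP : P.Admissible) : 0 < Real.log P.q :=
  Real.log_pos hP.one_lt_q

lemma EqParams.Admissible.k₁_pos {P : EqParams} (hP : P.Admissible) : 0 < (P.k₁ : ℝ) := by
  exact_mod_cast hP.one_le_k₁

lemma EqParams.Admissible.k₁_lt_k₂' {P : EqParams} (hP : P.Admissible) : (P.k₁ : ℝ) < P.k₂ := by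
  exact_mod_cast hP.k₁_lt_k₂

lemma EqParams.Admissible.k₂_pos {P : EqParams} (hP : P.Admissible) : 0 < (P.k₂ : ℝ) :=
  hP.k₁_pos.trans hP.k₁_lt_k₂'

lemma EqParams.Admissible.κ_eq {P : EqParams} (hP : P.Admissible) :
    P.κ = P.k₁ * P.k₂ / (P.k₂ - P.k₁) := by
  have h1 := hP.k₁_pos
  have h2 := hP.k₂_pos
  have h3 := sub_pos.2 hP.k₁_lt_k₂'
  unfold EqParams.κ
  rw [div_sub_div _ _ h1.ne' h2.ne']
  rw [one_mul, mul_one, one_div_div]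

/-- The parameter of the theta series in the acceleration operator. -/
noncomputable def EqParams.accelRate (P : EqParams) : ℝ := Real.log P.q / P.κ

lemma EqParams.Admissible.accelRate_pos {P : EqParams} (hP : P.Admissible) : 0 < P.accelRate := by
  have h1 := hP.k₁_pos
  have h2 := hP.k₂_pos
  have h3 := sub_pos.2 hP.k₁_lt_k₂'
  have := hP.log_q_pos
  rw [EqParams.accelRate, hP.κ_eq]
  positivity

/-- This is k₁ < κ, which makes the acceleration integral converge. -/
lemma EqParams.Admissible.growth_lt {P : EqParams} (hP : P.Admissible) :
    (P.k₁ : ℝ) / (2 * Real.log P.q) < 1 / (2 * P.accelRate) := by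
  have h1 := hP.k₁_pos
  have h2 := hP.k₂_pos
  have h3 := sub_pos.2 hP.k₁_lt_k₂'
  have h4 := hP.log_q_pos
  rw [EqParams.accelRate, hP.κ_eq, div_lt_div_iff₀ (by positivity) (by positivity)]
  field_simp
  linarith

/-- On reciprocals, the relation 1/k₁ - 1/κ = 1/k₂. -/
lemma EqParams.Admissible.accel_growth {P : EqParams} (hP : P.Admissible) :
    (P.k₁ : ℝ) / (2 * Real.log P.q) * (1 / (2 * P.accelRate)) /
      (1 / (2 * P.accelRate) - (P.k₁ : ℝ) / (2 * Real.log P.q)) =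
    (P.k₂ : ℝ) / (2 * Real.log P.q) := by
  have h1 := hP.k₁_pos
  have h2 := hP.k₂_pos
  have h3 := sub_pos.2 hP.k₁_lt_k₂'
  have h4 := hP.log_q_pos
  rw [div_eq_iff (sub_pos.2 hP.growth_lt).ne', EqParams.accelRate, hP.κ_eq]
  field_simp
  ring

lemma EqParams.accel_eq {P : EqParams} (hP : P.Admissible) (d : ℝ) (ψ : ℂ → ℝ → ℂ → ℂ)
    (τ : ℂ) (m : ℝ) (ε : ℂ) :
    P.accel d ψ τ m ε = 1 / (qPi P.q P.κ : ℂ) *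
      ∫ x : ℝ, ψ (ray d x) m ε / thetaSeries P.accelRate (ray d x / τ) :=
  qLaplace_eq hP.one_lt_q _ _

/-- The weight `e^{-β|m|} (1+|m|)^{-μ}`. -/
noncomputable def mWeight (β μ m : ℝ) : ℝ := Real.exp (-(β * |m|)) * (1 + |m|) ^ (-μ)

lemma mWeight_pos (β μ m : ℝ) : 0 < mWeight β μ m :=
  mul_pos (Real.exp_pos _) (Real.rpow_pos_of_pos (by positivity) _)

lemma mWeight_le_one {β μ : ℝ} (hβ : 0 ≤ β) (hμ : 0 ≤ μ) (m : ℝ) : mWeight β μ m ≤ 1 := by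
  refine mul_le_one₀ (Real.exp_le_one_iff.2 ?_) (by positivity)
    (Real.rpow_le_one_of_one_le_of_nonpos ?_ (by linarith))
  · have := abs_nonneg m
    have : 0 ≤ β * |m| := by positivity
    linarith
  · linarith [abs_nonneg m]

/-- Above, |u + δ₀| ≤ e^{max(x,0)}(1 + δ₀); below, the distance c keeps the logarithm bounded. So no
quadratic growth arises as u → 0, and max(x,0) enters instead of |x|. -/
lemma abs_log_norm_ray_add_le {d δ₀ c : ℝ} (hδ₀ : 0 < δ₀) (hc : 0 < c) {x : ℝ}
    (h : c ≤ ‖ray d x + (δ₀ : ℂ)‖) :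
    |Real.log ‖ray d x + (δ₀ : ℂ)‖| ≤ max x 0 + (Real.log (1 + δ₀) + |Real.log c|) := by
  have h0 : 0 ≤ Real.log (1 + δ₀) := Real.log_nonneg (by linarith)
  have hm := le_max_right x 0
  rw [abs_le]
  constructor
  · have := Real.log_le_log hc h
    linarith [neg_abs_le (Real.log c)]
  · have h1 : ‖ray d x + (δ₀ : ℂ)‖ ≤ Real.exp (max x 0) * (1 + δ₀) := by
      refine (norm_add_le _ _).trans ?_
      rw [norm_ray, Complex.norm_real, Real.norm_eq_abs, abs_of_pos hδ₀, mul_add, mul_one]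
      have h2 : Real.exp x ≤ Real.exp (max x 0) := Real.exp_le_exp.2 (le_max_left _ _)
      have h3 : 1 ≤ Real.exp (max x 0) := Real.one_le_exp hm
      nlinarith
    have h2 := Real.log_le_log (hc.trans_le h) h1
    rw [Real.log_mul (Real.exp_pos _).ne' (by linarith), Real.log_exp] at h2
    linarith [abs_nonneg (Real.log c)]

/-! ### Growth and regularity of the accelerated forcing term. -/

section Acceleration

variable {P : EqParams} {d θ ρ δ₀ α η : ℝ}

/-- The additive constant in the exponent dominating the integrand of the acceleration. -/
noncomputable def accelShift (d θ ρ δ₀ : ℝ) : ℝ :=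
  Real.log (1 + δ₀) +
    |Real.log (Metric.infDist (-(δ₀ : ℂ)) (infiniteSector d θ ∪ Metric.ball 0 ρ))|

lemma accelShift_nonneg (hδ₀ : 0 < δ₀) : 0 ≤ accelShift d θ ρ δ₀ :=
  add_nonneg (Real.log_nonneg (by linarith)) (abs_nonneg _)

/-- The function dominating the integrand of the acceleration. -/
noncomputable def accelMajorant (P : EqParams) (d θ ρ δ₀ α t x : ℝ) : ℝ :=
  Real.exp (laplaceExponent ((P.k₁ : ℝ) / (2 * Real.log P.q)) (accelShift d θ ρ δ₀) |α|
    (1 / (2 * P.accelRate)) t x)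

/-- The growth of ψ along the ray is divided by the theta lower bound. The sector condition makes
the latter uniform in arg τ, so the majorant sees τ only through log|τ|. Only C depends on ψ. -/
lemma IsForcing.exists_norm_integrand_le {F : ℕ → ℝ → ℂ → ℂ} {ψ : ℂ → ℝ → ℂ → ℂ}
    (hP : P.Admissible) (hθ : 0 < θ) (hδ₀ : 0 < δ₀) (hη : 0 < η)
    (hdist : 0 < Metric.infDist (-(δ₀ : ℂ)) (infiniteSector d θ ∪ Metric.ball 0 ρ))
    (h : IsForcing P (infiniteSector d θ) ρ δ₀ α F ψ) :
    ∃ C : ℝ, 0 < C ∧ ∀ τ ∈ laplaceSector d η, ∀ m : ℝ, ∀ ε ∈ Metric.ball (0 : ℂ) P.ε₀, ∀ x : ℝ,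
      ‖ψ (ray d x) m ε / thetaSeries P.accelRate (ray d x / τ)‖ ≤
        C * mWeight P.β P.μ m * accelMajorant P d θ ρ δ₀ α (Real.log ‖τ‖) x := by
  obtain ⟨Cψ, hCψ, hgr⟩ := h.growth
  obtain ⟨c, hc, hth⟩ := exists_thetaWeight_le_norm_thetaSeries hP.accelRate_pos hη
  refine ⟨Cψ / c, by positivity, fun τ hτ m ε hε x => ?_⟩
  have hray : ray d x ∈ infiniteSector d θ := ray_mem_infiniteSector hθ x
  have hg := hgr ε hε (ray d x) (Or.inl hray) m
  have ht := hth _ (ray_div_mem_awayFromNegReals hτ x)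
  have hdist' : Metric.infDist (-(δ₀ : ℂ)) (infiniteSector d θ ∪ Metric.ball 0 ρ) ≤
      ‖ray d x + (δ₀ : ℂ)‖ := by
    refine (Metric.infDist_le_dist_of_mem (Set.mem_union_left _ hray)).trans (le_of_eq ?_)
    rw [dist_comm, dist_eq_norm, sub_neg_eq_add]
  have hlog := abs_log_norm_ray_add_le hδ₀ hdist hdist'
  have hlog0 := abs_nonneg (Real.log ‖ray d x + (δ₀ : ℂ)‖)
  have hq := hP.log_q_pos
  have hexp : Real.exp ((P.k₁ : ℝ) * Real.log ‖ray d x + (δ₀ : ℂ)‖ ^ 2 / (2 * Real.log P.q) +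
      α * Real.log ‖ray d x + (δ₀ : ℂ)‖) ≤
      Real.exp ((P.k₁ : ℝ) / (2 * Real.log P.q) * (max x 0 + accelShift d θ ρ δ₀) ^ 2 +
        |α| * (max x 0 + accelShift d θ ρ δ₀)) := by
    refine Real.exp_le_exp.2 (add_le_add ?_ ?_)
    · rw [mul_div_right_comm, ← sq_abs (Real.log _)]
      have := hP.k₁_pos
      exact mul_le_mul_of_nonneg_left (pow_le_pow_left₀ hlog0 hlog 2) (by positivity)
    · refine (le_abs_self _).trans ?_
      rw [abs_mul]
      exact mul_le_mul_of_nonneg_left hlog (abs_nonneg _)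
  have hwpos : 0 < thetaWeight P.accelRate (ray d x / τ) := Real.exp_pos _
  have hm0 : 0 < Real.exp (-(P.β * |m|)) / (1 + |m|) ^ P.μ := by positivity
  rw [norm_div]
  calc ‖ψ (ray d x) m ε‖ / ‖thetaSeries P.accelRate (ray d x / τ)‖
      ≤ (Cψ * (Real.exp (-(P.β * |m|)) / (1 + |m|) ^ P.μ) *
        Real.exp ((P.k₁ : ℝ) / (2 * Real.log P.q) * (max x 0 + accelShift d θ ρ δ₀) ^ 2 +
        |α| * (max x 0 + accelShift d θ ρ δ₀))) / (c * thetaWeight P.accelRate (ray d x / τ)) :=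
      div_le_div₀ (by positivity) (hg.trans (mul_le_mul_of_nonneg_left hexp (by positivity)))
        (by positivity) ht
    _ = Cψ / c * (Real.exp (-(P.β * |m|)) / (1 + |m|) ^ P.μ) *
        (Real.exp ((P.k₁ : ℝ) / (2 * Real.log P.q) * (max x 0 + accelShift d θ ρ δ₀) ^ 2 +
        |α| * (max x 0 + accelShift d θ ρ δ₀)) / thetaWeight P.accelRate (ray d x / τ)) := by
      field_simp
    _ = _ := by
      rw [thetaWeight, ← Real.exp_sub, log_norm_ray_div d x hτ.1, mWeight, Real.rpow_neg
        (by positivity), div_eq_mul_inv (Real.exp _), accelMajorant, laplaceExponent]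
      congr 2
      ring

lemma thetaSeries_ray_div_ne_zero (hP : P.Admissible) (hη : 0 < η) {τ : ℂ}
    (hτ : τ ∈ laplaceSector d η) (x : ℝ) : thetaSeries P.accelRate (ray d x / τ) ≠ 0 :=
  thetaSeries_ne_zero hP.accelRate_pos (ray_div_mem_awayFromNegReals hτ x).1
    (one_add_mul_ne_zero hη (ray_div_mem_awayFromNegReals hτ x))

lemma differentiableAt_thetaSeries_ray_div (hP : P.Admissible) {τ : ℂ}
    (hτ : τ ≠ 0) (x : ℝ) :
    DifferentiableAt ℂ (fun z => thetaSeries P.accelRate (ray d x / z)) τ :=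
  (differentiableAt_thetaSeries hP.accelRate_pos (div_ne_zero (ray_ne_zero d x) hτ)).comp τ
    ((differentiableAt_const _).div differentiableAt_id hτ)

lemma IsForcing.continuous_integrand {F : ℕ → ℝ → ℂ → ℂ} {ψ : ℂ → ℝ → ℂ → ℂ}
    (hP : P.Admissible) (hθ : 0 < θ) (hη : 0 < η)
    (h : IsForcing P (infiniteSector d θ) ρ δ₀ α F ψ) {τ : ℂ} (hτ : τ ∈ laplaceSector d η) (m : ℝ)
    {ε : ℂ} (hε : ε ∈ Metric.ball (0 : ℂ) P.ε₀) :
    Continuous fun x : ℝ => ψ (ray d x) m ε / thetaSeries P.accelRate (ray d x / τ) := by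
  refine continuous_iff_continuousAt.2 fun x => ContinuousAt.div ?_ ?_
    (thetaSeries_ray_div_ne_zero hP hη hτ x)
  · have h1 : Continuous fun x : ℝ => ψ (ray d x) m ε :=
      (h.cont ε hε).comp_continuous (f := fun x : ℝ => (ray d x, m))
        ((continuous_ray d).prodMk continuous_const)
        fun x => ⟨Set.mem_union_left _ (ray_mem_infiniteSector hθ x), Set.mem_univ _⟩
    exact h1.continuousAt
  · exact ContinuousAt.comp (f := fun x : ℝ => ray d x / τ)
      (differentiableAt_thetaSeries hP.accelRate_pos
        (div_ne_zero (ray_ne_zero d x) hτ.1)).continuousAt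
      ((continuous_ray d).continuousAt.div_const _)

lemma EqParams.Admissible.μ_nonneg (hP : P.Admissible) : 0 ≤ P.μ := by
  have := hP.lt_μ
  have : (0 : ℝ) ≤ (P.R P.D).natDegree := Nat.cast_nonneg _
  linarith

/-- Local domination of the integrand of the acceleration. -/
lemma IsForcing.exists_local_majorant {F : ℕ → ℝ → ℂ → ℂ} {ψ : ℂ → ℝ → ℂ → ℂ}
    (hP : P.Admissible) (hθ : 0 < θ) (hδ₀ : 0 < δ₀) (hη : 0 < η)
    (hdist : 0 < Metric.infDist (-(δ₀ : ℂ)) (infiniteSector d θ ∪ Metric.ball 0 ρ))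
    (h : IsForcing P (infiniteSector d θ) ρ δ₀ α F ψ) {τ₀ : ℂ} (hτ₀ : τ₀ ≠ 0) :
    ∃ V ∈ nhds τ₀, ∃ g : ℝ → ℝ, MeasureTheory.Integrable g ∧ ∀ τ ∈ V, τ ∈ laplaceSector d η →
      ∀ m : ℝ, ∀ ε ∈ Metric.ball (0 : ℂ) P.ε₀, ∀ x : ℝ,
        ‖ψ (ray d x) m ε / thetaSeries P.accelRate (ray d x / τ)‖ ≤ g x := by
  obtain ⟨C, hC, hbd⟩ := h.exists_norm_integrand_le hP hθ hδ₀ hη hdist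
  have ha : 0 < (P.k₁ : ℝ) / (2 * Real.log P.q) :=
    div_pos hP.k₁_pos (mul_pos two_pos hP.log_q_pos)
  obtain ⟨g, hg, hle⟩ := exists_integrable_laplace_bound ha
    (accelShift_nonneg (d := d) (θ := θ) (ρ := ρ) hδ₀) (abs_nonneg α) hP.growth_lt
    (|Real.log ‖τ₀‖| + 1)
  have hl : ContinuousAt (fun y : ℂ => |Real.log ‖y‖|) τ₀ :=
    ((Real.continuousAt_log (norm_ne_zero_iff.2 hτ₀)).comp continuous_norm.continuousAt).abs
  refine ⟨_, hl.preimage_mem_nhds (Iio_mem_nhds (lt_add_one _)), fun x => C * g x,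
    hg.const_mul C, fun τ hτV hτ m ε hε x => ?_⟩
  refine (hbd τ hτ m ε hε x).trans ?_
  rw [mul_assoc]
  refine mul_le_mul_of_nonneg_left ?_ hC.le
  refine (mul_le_of_le_one_left (Real.exp_pos _).le
    (mWeight_le_one hP.β_pos.le hP.μ_nonneg m)).trans ?_
  exact hle _ (le_of_lt hτV) x

lemma IsForcing.continuousOn_accel {F : ℕ → ℝ → ℂ → ℂ} {ψ : ℂ → ℝ → ℂ → ℂ}
    (hP : P.Admissible) (hθ : 0 < θ) (hδ₀ : 0 < δ₀) (hη : 0 < η)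
    (hdist : 0 < Metric.infDist (-(δ₀ : ℂ)) (infiniteSector d θ ∪ Metric.ball 0 ρ))
    (h : IsForcing P (infiniteSector d θ) ρ δ₀ α F ψ) {ε : ℂ}
    (hε : ε ∈ Metric.ball (0 : ℂ) P.ε₀) :
    ContinuousOn (fun p : ℂ × ℝ => P.accel d ψ p.1 p.2 ε) (laplaceSector d η ×ˢ Set.univ) := by
  simp_rw [EqParams.accel_eq hP]
  refine continuousOn_const.mul ?_
  rintro ⟨τ₀, m₀⟩ ⟨hτ₀, -⟩
  obtain ⟨V, hV, g, hg, hle⟩ := h.exists_local_majorant hP hθ hδ₀ hη hdist hτ₀.1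
  refine MeasureTheory.continuousWithinAt_of_dominated (bound := g) ?_ ?_ hg
    (Filter.Eventually.of_forall fun x => ?_)
  · filter_upwards [self_mem_nhdsWithin] with p hp
    exact (h.continuous_integrand hP hθ hη hp.1 p.2 hε).aestronglyMeasurable
  · filter_upwards [self_mem_nhdsWithin, nhdsWithin_le_nhds (prod_mem_nhds hV Filter.univ_mem)]
      with p hp hpV
    exact Filter.Eventually.of_forall (hle p.1 hpV.1 hp.1 p.2 ε hε)
  · have h1 : Continuous fun m : ℝ => ψ (ray d x) m ε :=
      (h.cont ε hε).comp_continuous (f := fun m : ℝ => (ray d x, m))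
        (continuous_const.prodMk continuous_id)
        fun m => ⟨Set.mem_union_left _ (ray_mem_infiniteSector hθ x), Set.mem_univ _⟩
    refine ContinuousAt.continuousWithinAt (ContinuousAt.div
      (h1.comp continuous_snd).continuousAt ?_ (thetaSeries_ray_div_ne_zero hP hη hτ₀ x))
    exact ContinuousAt.comp (f := Prod.fst) (x := (τ₀, m₀))
      (differentiableAt_thetaSeries_ray_div hP hτ₀.1 x).continuousAt continuousAt_fst

lemma IsForcing.differentiableOn_accel {F : ℕ → ℝ → ℂ → ℂ} {ψ : ℂ → ℝ → ℂ → ℂ}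
    (hP : P.Admissible) (hθ : 0 < θ) (hδ₀ : 0 < δ₀) (hη : 0 < η)
    (hdist : 0 < Metric.infDist (-(δ₀ : ℂ)) (infiniteSector d θ ∪ Metric.ball 0 ρ))
    (h : IsForcing P (infiniteSector d θ) ρ δ₀ α F ψ) {ε : ℂ}
    (hε : ε ∈ Metric.ball (0 : ℂ) P.ε₀) (m : ℝ) {U : Set ℂ} (hU : IsOpen U)
    (hUs : U ⊆ laplaceSector d η) :
    DifferentiableOn ℂ (fun τ => P.accel d ψ τ m ε) U := by
  simp_rw [EqParams.accel_eq hP]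
  refine DifferentiableOn.const_mul (differentiableOn_integral_of_locally_dominated hU
    (fun x τ hτ => ?_) (fun τ hτ => ?_) fun τ hτ => ?_) _
  · exact ((differentiableAt_const _).div (differentiableAt_thetaSeries_ray_div hP (hUs hτ).1 x)
      (thetaSeries_ray_div_ne_zero hP hη (hUs hτ) x)).differentiableWithinAt
  · exact (h.continuous_integrand hP hθ hη (hUs hτ) m hε).aestronglyMeasurable
  · obtain ⟨V, hV, g, hg, hle⟩ := h.exists_local_majorant hP hθ hδ₀ hη hdist (hUs hτ).1
    exact ⟨V, hV, g, hg, fun w hw x => hle w hw.1 (hUs hw.2) m ε hε x⟩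

lemma IsForcing.differentiableOn_accel_param {F : ℕ → ℝ → ℂ → ℂ} {ψ : ℂ → ℝ → ℂ → ℂ}
    (hP : P.Admissible) (hθ : 0 < θ) (hδ₀ : 0 < δ₀) (hη : 0 < η)
    (hdist : 0 < Metric.infDist (-(δ₀ : ℂ)) (infiniteSector d θ ∪ Metric.ball 0 ρ))
    (h : IsForcing P (infiniteSector d θ) ρ δ₀ α F ψ) {τ : ℂ} (hτ : τ ∈ laplaceSector d η)
    (m : ℝ) : DifferentiableOn ℂ (fun ε => P.accel d ψ τ m ε) (Metric.ball (0 : ℂ) P.ε₀) := by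
  simp_rw [EqParams.accel_eq hP]
  refine DifferentiableOn.const_mul (differentiableOn_integral_of_locally_dominated
    Metric.isOpen_ball (fun x => ?_) (fun ε hε => ?_) fun ε hε => ?_) _
  · exact (h.hol_ε _ (Set.mem_union_left _ (ray_mem_infiniteSector hθ x)) m).div_const _
  · exact (h.continuous_integrand hP hθ hη hτ m hε).aestronglyMeasurable
  · obtain ⟨V, hV, g, hg, hle⟩ := h.exists_local_majorant hP hθ hδ₀ hη hdist hτ.1
    exact ⟨Set.univ, Filter.univ_mem, g, hg,
      fun w hw x => hle τ (mem_of_mem_nhds hV) hτ m w hw.2 x⟩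

/-- The growth estimate for the accelerated forcing terms. -/
lemma exists_accelBound (hP : P.Admissible) (hθ : 0 < θ) (hδ₀ : 0 < δ₀) (hη : 0 < η)
    (hdist : 0 < Metric.infDist (-(δ₀ : ℂ)) (infiniteSector d θ ∪ Metric.ball 0 ρ)) :
    ∃ ν : ℝ, ∀ (F : ℕ → ℝ → ℂ → ℂ) (ψ : ℂ → ℝ → ℂ → ℂ),
      IsForcing P (infiniteSector d θ) ρ δ₀ α F ψ →
        ∃ Cψ₂ : ℝ, 0 < Cψ₂ ∧ AccelBound P d η ν Cψ₂ (P.accel d ψ) := by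
  have ha : 0 < (P.k₁ : ℝ) / (2 * Real.log P.q) :=
    div_pos hP.k₁_pos (mul_pos two_pos hP.log_q_pos)
  have hA := accelShift_nonneg (d := d) (θ := θ) (ρ := ρ) hδ₀
  obtain ⟨ν, M, hM, hint⟩ := exists_integral_exp_laplaceExponent_le ha hA (abs_nonneg α)
    hP.growth_lt
  refine ⟨ν, fun F ψ h => ?_⟩
  obtain ⟨C, hC, hbd⟩ := h.exists_norm_integrand_le hP hθ hδ₀ hη hdist
  have hN : 0 ≤ ‖1 / (qPi P.q P.κ : ℂ)‖ := norm_nonneg _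
  refine ⟨(‖1 / (qPi P.q P.κ : ℂ)‖ + 1) * (C * M), by positivity, fun τ hτ m ε hε => ?_⟩
  have hm := mWeight_pos P.β P.μ m
  have hI : ‖∫ x : ℝ, ψ (ray d x) m ε / thetaSeries P.accelRate (ray d x / τ)‖ ≤
      C * mWeight P.β P.μ m * (M * Real.exp ((P.k₂ : ℝ) * Real.log ‖τ‖ ^ 2 /
        (2 * Real.log P.q) + ν * Real.log ‖τ‖)) := by
    refine (MeasureTheory.norm_integral_le_of_norm_le
      ((integrable_exp_laplaceExponent ha hA (abs_nonneg α) hP.growth_lt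
        (Real.log ‖τ‖)).const_mul (C * mWeight P.β P.μ m)) (Filter.Eventually.of_forall
        (hbd τ (laplaceDomain_subset_laplaceSector d η hτ) m ε hε))).trans ?_
    rw [MeasureTheory.integral_const_mul]
    refine mul_le_mul_of_nonneg_left ((hint (Real.log ‖τ‖)).trans (le_of_eq ?_)) (by positivity)
    rw [hP.accel_growth, mul_div_right_comm]
  rw [EqParams.accel_eq hP, norm_mul]
  refine (mul_le_mul (le_add_of_nonneg_right zero_le_one) hI (norm_nonneg _)
    (by positivity)).trans (le_of_eq ?_)
  rw [mWeight]
  ring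

end Acceleration

/-! ### Polynomials on the imaginary axis and convolution estimates. -/

lemma exists_norm_eval_I_mul_le (R : ℂ[X]) {n : ℕ} (hn : R.natDegree ≤ n) :
    ∃ c : ℝ, 0 < c ∧ ∀ m : ℝ, ‖R.eval (Complex.I * (m : ℂ))‖ ≤ c * (1 + |m|) ^ n := by
  refine ⟨∑ i ∈ Finset.range (R.natDegree + 1), ‖R.coeff i‖ + 1, by positivity, fun m => ?_⟩
  rw [Polynomial.eval_eq_sum_range, add_mul, Finset.sum_mul]
  refine (norm_sum_le _ _).trans ((Finset.sum_le_sum fun i hi => ?_).trans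
    (le_add_of_nonneg_right (by positivity)))
  rw [norm_mul, norm_pow, norm_mul, Complex.norm_I, one_mul, Complex.norm_real, Real.norm_eq_abs]
  have hm := abs_nonneg m
  have h1 : |m| ^ i ≤ (1 + |m|) ^ i := pow_le_pow_left₀ hm (by linarith) i
  have h2 : (1 + |m|) ^ i ≤ (1 + |m|) ^ n :=
    pow_le_pow_right₀ (by linarith) (by have := Finset.mem_range.1 hi; omega)
  exact mul_le_mul_of_nonneg_left (h1.trans h2) (norm_nonneg _)

/-- Induction on the degree, splitting off a root z. Since R has no zero on the imaginary axis, Re z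
≠ 0. Then |im - z| ≥ |Re z| controls small m and |im - z| ≥ |m| - |z| controls large m. -/
lemma exists_le_norm_eval_I_mul (n : ℕ) : ∀ R : ℂ[X], R.natDegree = n →
    (∀ m : ℝ, R.eval (Complex.I * (m : ℂ)) ≠ 0) →
    ∃ c : ℝ, 0 < c ∧ ∀ m : ℝ, c * (1 + |m|) ^ n ≤ ‖R.eval (Complex.I * (m : ℂ))‖ := by
  induction n with
  | zero =>
    intro R hR hne
    rw [Polynomial.natDegree_eq_zero] at hR
    obtain ⟨a, rfl⟩ := hR
    have := hne 0
    simp only [Polynomial.eval_C] at this ⊢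
    exact ⟨‖a‖, norm_pos_iff.2 this, fun m => by simp⟩
  | succ n ih =>
    intro R hR hne
    have hdeg : R.degree ≠ 0 := by
      intro h
      have := Polynomial.natDegree_eq_zero_iff_degree_le_zero.2 h.le
      omega
    obtain ⟨z, hz⟩ := IsAlgClosed.exists_root R hdeg
    obtain ⟨S, rfl⟩ := Polynomial.dvd_iff_isRoot.2 hz
    simp only [Polynomial.eval_mul, Polynomial.eval_sub, Polynomial.eval_X, Polynomial.eval_C]
      at hne ⊢
    have hS0 : S ≠ 0 := by
      rintro rfl
      simpa using hne 0
    rw [Polynomial.natDegree_mul (Polynomial.X_sub_C_ne_zero z) hS0,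
      Polynomial.natDegree_X_sub_C] at hR
    obtain ⟨c, hc, hcS⟩ := ih S (by omega) fun m => right_ne_zero_of_mul (hne m)
    have hre : 0 < |z.re| := by
      rw [abs_pos]
      intro h
      refine left_ne_zero_of_mul (hne z.im) ?_
      apply Complex.ext <;> simp [h]
    set B := (1 + ‖z‖) / |z.re| + 1
    have hB : 0 < B := by positivity
    refine ⟨1 / B * c, by positivity, fun m => ?_⟩
    have h1 : |z.re| ≤ ‖Complex.I * (m : ℂ) - z‖ := by
      have := Complex.abs_re_le_norm (Complex.I * (m : ℂ) - z)
      simpa using this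
    have h2 : |m| ≤ ‖Complex.I * (m : ℂ) - z‖ + ‖z‖ := by
      have := norm_add_le (Complex.I * (m : ℂ) - z) z
      simpa using this
    have h3 : 1 / B * (1 + |m|) ≤ ‖Complex.I * (m : ℂ) - z‖ := by
      rw [one_div, inv_mul_le_iff₀ hB]
      have h4 : (1 + ‖z‖) / |z.re| * |z.re| ≤ (1 + ‖z‖) / |z.re| * ‖Complex.I * (m : ℂ) - z‖ :=
        mul_le_mul_of_nonneg_left h1 (by positivity)
      rw [div_mul_cancel₀ _ hre.ne'] at h4
      simp only [B]
      linarith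
    rw [norm_mul, pow_succ]
    calc 1 / B * c * ((1 + |m|) ^ n * (1 + |m|)) = (1 / B * (1 + |m|)) * (c * (1 + |m|) ^ n) := by
          ring
      _ ≤ _ := mul_le_mul h3 (hcS m) (by positivity) (norm_nonneg _)

lemma integrable_one_add_abs_rpow {a : ℝ} (ha : 1 < a) :
    MeasureTheory.Integrable fun m : ℝ => (1 + |m|) ^ (-a) := by
  have := integrable_one_add_norm (E := ℝ) (μ := MeasureTheory.volume) (r := a) (by simpa using ha)
  simpa using this

/-- One of |m - m₁| and |m₁| is at least |m|/2, so one of the two factors already carries the decay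
in m. -/
lemma one_add_abs_rpow_mul_le {a : ℝ} (ha : 0 ≤ a) (m m₁ : ℝ) :
    (1 + |m - m₁|) ^ (-a) * (1 + |m₁|) ^ (-a) ≤
      2 ^ a * (1 + |m|) ^ (-a) * ((1 + |m₁|) ^ (-a) + (1 + |m - m₁|) ^ (-a)) := by
  have h0 : ∀ x : ℝ, 0 < 1 + |x| := fun x => by positivity
  have hx := Real.rpow_pos_of_pos (h0 (m - m₁)) a
  have hy := Real.rpow_pos_of_pos (h0 m₁) a
  have hz := Real.rpow_pos_of_pos (h0 m) a
  have key : (1 + |m|) ^ a ≤ 2 ^ a * ((1 + |m - m₁|) ^ a + (1 + |m₁|) ^ a) := by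
    have htri : |m| ≤ |m - m₁| + |m₁| := by
      have := abs_add_le (m - m₁) m₁
      simpa using this
    rcases le_total (|m - m₁|) (|m₁|) with h | h
    · have h1 : (1 + |m|) ^ a ≤ (2 * (1 + |m₁|)) ^ a :=
        Real.rpow_le_rpow (h0 m).le (by linarith) ha
      rw [Real.mul_rpow two_pos.le (h0 _).le] at h1
      exact h1.trans (mul_le_mul_of_nonneg_left (by linarith) (by positivity))
    · have h1 : (1 + |m|) ^ a ≤ (2 * (1 + |m - m₁|)) ^ a :=
        Real.rpow_le_rpow (h0 m).le (by linarith) ha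
      rw [Real.mul_rpow two_pos.le (h0 _).le] at h1
      exact h1.trans (mul_le_mul_of_nonneg_left (by linarith) (by positivity))
  rw [Real.rpow_neg (h0 _).le, Real.rpow_neg (h0 _).le, Real.rpow_neg (h0 _).le]
  set X := (1 + |m - m₁|) ^ a
  set Y := (1 + |m₁|) ^ a
  set Z := (1 + |m|) ^ a
  have e : (2 : ℝ) ^ a * Z⁻¹ * (Y⁻¹ + X⁻¹) = (2 ^ a * (X + Y)) / Z * (X⁻¹ * Y⁻¹) := by
    field_simp
  rw [e]
  refine le_mul_of_one_le_left (by positivity) ((one_le_div hz).2 key)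

lemma exists_integral_one_add_abs_rpow_mul_le {a : ℝ} (ha : 1 < a) :
    ∃ L : ℝ, 0 < L ∧ ∀ m : ℝ,
      ∫ m₁ : ℝ, (1 + |m - m₁|) ^ (-a) * (1 + |m₁|) ^ (-a) ≤ L * (1 + |m|) ^ (-a) := by
  have hi := integrable_one_add_abs_rpow ha
  have hI : 0 ≤ ∫ m : ℝ, (1 + |m|) ^ (-a) := MeasureTheory.integral_nonneg fun m => by positivity
  refine ⟨2 ^ a * (2 * (∫ m : ℝ, (1 + |m|) ^ (-a)) + 1), by positivity, fun m => ?_⟩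
  have hi2 : MeasureTheory.Integrable fun m₁ : ℝ => (1 + |m - m₁|) ^ (-a) := hi.comp_sub_left m
  refine (MeasureTheory.integral_mono_of_nonneg (Filter.Eventually.of_forall fun m₁ => by positivity)
    ((hi.add hi2).const_mul (2 ^ a * (1 + |m|) ^ (-a))) (Filter.Eventually.of_forall fun m₁ =>
      one_add_abs_rpow_mul_le (by linarith) m m₁)).trans ?_
  rw [MeasureTheory.integral_const_mul, MeasureTheory.integral_add' hi hi2,
    MeasureTheory.integral_sub_left_eq_self (fun x : ℝ => (1 + |x|) ^ (-a))]
  have : 0 < (1 + |m|) ^ (-a) := by positivity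
  have h2 : (0 : ℝ) < 2 ^ a := by positivity
  nlinarith [mul_pos h2 this]

/-- Pointwise domination of the integrand of the convolution. -/
lemma norm_conv_integrand_le {β μ c K₁ K₂ : ℝ} {n : ℕ} {R : ℂ[X]} {h₁ h₂ : ℝ → ℂ} (hβ : 0 ≤ β)
    (hK₁ : 0 ≤ K₁) (hK₂ : 0 ≤ K₂)
    (hR : ∀ m : ℝ, ‖R.eval (Complex.I * (m : ℂ))‖ ≤ c * (1 + |m|) ^ n)
    (hh₁ : ∀ m, ‖h₁ m‖ ≤ K₁ * mWeight β μ m) (hh₂ : ∀ m, ‖h₂ m‖ ≤ K₂ * mWeight β μ m) (m m₁ : ℝ) :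
    ‖h₁ (m - m₁) * R.eval (Complex.I * (m₁ : ℂ)) * h₂ m₁‖ ≤
      K₁ * K₂ * c * Real.exp (-(β * |m|)) *
        ((1 + |m - m₁|) ^ (-(μ - n)) * (1 + |m₁|) ^ (-(μ - n))) := by
  have h0 : ∀ x : ℝ, 0 < 1 + |x| := fun x => by positivity
  have hc : 0 ≤ c := by simpa using (norm_nonneg _).trans (hR 0)
  have hp := fun x => (mWeight_pos β μ x).le
  rw [norm_mul, norm_mul]
  have e1 : Real.exp (-(β * |m - m₁|)) * Real.exp (-(β * |m₁|)) ≤ Real.exp (-(β * |m|)) := by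
    rw [← Real.exp_add, Real.exp_le_exp]
    have htri : |m| ≤ |m - m₁| + |m₁| := by
      have := abs_add_le (m - m₁) m₁
      simpa using this
    nlinarith
  have e2 : (1 + |m₁|) ^ n * (1 + |m₁|) ^ (-μ) = (1 + |m₁|) ^ (-(μ - n)) := by
    rw [← Real.rpow_natCast, ← Real.rpow_add (h0 _)]
    congr 1
    ring
  -- The first decay is weakened from μ to μ - n to match the second, which loses n to the
  -- polynomial.
  have e3 : (1 + |m - m₁|) ^ (-μ) ≤ (1 + |m - m₁|) ^ (-(μ - n)) :=
    Real.rpow_le_rpow_of_exponent_le (by linarith [abs_nonneg (m - m₁)])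
      (by linarith [(Nat.cast_nonneg n : (0 : ℝ) ≤ n)])
  calc _ ≤ (K₁ * mWeight β μ (m - m₁)) * (c * (1 + |m₁|) ^ n) * (K₂ * mWeight β μ m₁) :=
        mul_le_mul (mul_le_mul (hh₁ _) (hR _) (norm_nonneg _) (mul_nonneg hK₁ (hp _))) (hh₂ _)
          (norm_nonneg _) (mul_nonneg (mul_nonneg hK₁ (hp _)) (by positivity))
    _ = K₁ * K₂ * c * (Real.exp (-(β * |m - m₁|)) * Real.exp (-(β * |m₁|))) *
        ((1 + |m - m₁|) ^ (-μ) * ((1 + |m₁|) ^ n * (1 + |m₁|) ^ (-μ))) := by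
      unfold mWeight
      ring
    _ ≤ _ := by
      rw [e2]
      gcongr

/-- A bound free of m and integrable in m₁, for dominated convergence in the parameters. -/
lemma norm_conv_integrand_le' {β μ c K₁ K₂ : ℝ} {n : ℕ} {R : ℂ[X]} {h₁ h₂ : ℝ → ℂ} (hβ : 0 ≤ β)
    (hμ : n ≤ μ) (hK₁ : 0 ≤ K₁) (hK₂ : 0 ≤ K₂)
    (hR : ∀ m : ℝ, ‖R.eval (Complex.I * (m : ℂ))‖ ≤ c * (1 + |m|) ^ n)
    (hh₁ : ∀ m, ‖h₁ m‖ ≤ K₁ * mWeight β μ m) (hh₂ : ∀ m, ‖h₂ m‖ ≤ K₂ * mWeight β μ m) (m m₁ : ℝ) :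
    ‖h₁ (m - m₁) * R.eval (Complex.I * (m₁ : ℂ)) * h₂ m₁‖ ≤
      K₁ * K₂ * c * (1 + |m₁|) ^ (-(μ - n)) := by
  have hc : 0 ≤ c := by simpa using (norm_nonneg _).trans (hR 0)
  refine (norm_conv_integrand_le hβ hK₁ hK₂ hR hh₁ hh₂ m m₁).trans ?_
  have h1 : Real.exp (-(β * |m|)) ≤ 1 := Real.exp_le_one_iff.2 (by
    have : 0 ≤ β * |m| := by positivity
    linarith)
  have h2 : (1 + |m - m₁|) ^ (-(μ - n)) ≤ 1 :=
    Real.rpow_le_one_of_one_le_of_nonpos (by linarith [abs_nonneg (m - m₁)]) (by linarith)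
  refine mul_le_mul (mul_le_of_le_one_right (by positivity) h1)
    (mul_le_of_le_one_left (by positivity) h2) (by positivity) (by positivity)

/-- The convolution estimate in the weighted spaces. -/
lemma exists_norm_convQ_le {β μ : ℝ} {n : ℕ} {R : ℂ[X]} (hβ : 0 ≤ β) (hμ : n + 1 < μ)
    (hR : R.natDegree ≤ n) :
    ∃ L : ℝ, 0 < L ∧ ∀ (K₁ K₂ : ℝ) (h₁ h₂ : ℝ → ℂ), 0 ≤ K₁ → 0 ≤ K₂ →
      (∀ m, ‖h₁ m‖ ≤ K₁ * mWeight β μ m) → (∀ m, ‖h₂ m‖ ≤ K₂ * mWeight β μ m) →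
      ∀ m, ‖convQ R h₁ h₂ m‖ ≤ L * K₁ * K₂ * ((1 + |m|) ^ n * mWeight β μ m) := by
  obtain ⟨c, hc, hRc⟩ := exists_norm_eval_I_mul_le R hR
  obtain ⟨L, hL, hint⟩ := exists_integral_one_add_abs_rpow_mul_le (a := μ - n) (by linarith)
  refine ⟨c * L, by positivity, fun K₁ K₂ h₁ h₂ hK₁ hK₂ hh₁ hh₂ m => ?_⟩
  have hi : MeasureTheory.Integrable fun m₁ : ℝ =>
      (1 + |m - m₁|) ^ (-(μ - n)) * (1 + |m₁|) ^ (-(μ - n)) := by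
    refine (integrable_one_add_abs_rpow (a := μ - n) (by linarith)).mono'
      (Continuous.aestronglyMeasurable ?_) (Filter.Eventually.of_forall fun m₁ => ?_)
    · refine Continuous.mul ?_ ?_
      · exact Continuous.rpow_const (by fun_prop) fun x => Or.inl (by positivity)
      · exact Continuous.rpow_const (by fun_prop) fun x => Or.inl (by positivity)
    · rw [Real.norm_eq_abs, abs_of_nonneg (by positivity)]
      exact mul_le_of_le_one_left (by positivity) (Real.rpow_le_one_of_one_le_of_nonpos
        (by linarith [abs_nonneg (m - m₁)]) (by linarith))
  refine (MeasureTheory.norm_integral_le_of_norm_le (hi.const_mul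
    (K₁ * K₂ * c * Real.exp (-(β * |m|)))) (Filter.Eventually.of_forall
      (norm_conv_integrand_le hβ hK₁ hK₂ hRc hh₁ hh₂ m))).trans ?_
  rw [MeasureTheory.integral_const_mul]
  refine (mul_le_mul_of_nonneg_left (hint m) (by positivity)).trans (le_of_eq ?_)
  -- The loss (1+|m|)^n is kept explicit, to be absorbed by the symbol.
  have e2 : (1 + |m|) ^ (-(μ - n)) = (1 + |m|) ^ n * (1 + |m|) ^ (-μ) := by
    rw [← Real.rpow_natCast, ← Real.rpow_add (by positivity)]
    congr 1
    ring
  rw [e2, mWeight]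
  ring

lemma integrable_conv_integrand {β μ K₁ K₂ : ℝ} {n : ℕ} {R : ℂ[X]} {h₁ h₂ : ℝ → ℂ} (hβ : 0 ≤ β)
    (hμ : n + 1 < μ) (hR : R.natDegree ≤ n) (hK₁ : 0 ≤ K₁) (hK₂ : 0 ≤ K₂) (hc₁ : Continuous h₁)
    (hc₂ : Continuous h₂) (hh₁ : ∀ m, ‖h₁ m‖ ≤ K₁ * mWeight β μ m)
    (hh₂ : ∀ m, ‖h₂ m‖ ≤ K₂ * mWeight β μ m) (m : ℝ) :
    MeasureTheory.Integrable
      fun m₁ : ℝ => h₁ (m - m₁) * R.eval (Complex.I * (m₁ : ℂ)) * h₂ m₁ := by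
  obtain ⟨c, hc, hRc⟩ := exists_norm_eval_I_mul_le R hR
  refine ((integrable_one_add_abs_rpow (a := μ - n) (by linarith)).const_mul (K₁ * K₂ * c)).mono'
    (Continuous.aestronglyMeasurable ?_) (Filter.Eventually.of_forall
      (norm_conv_integrand_le' hβ (by linarith) hK₁ hK₂ hRc hh₁ hh₂ m))
  exact ((hc₁.comp (continuous_const.sub continuous_id)).mul
    (R.continuous.comp (continuous_const.mul Complex.continuous_ofReal))).mul hc₂

/-! ### The symbol P_m and its lower bound. -/

lemma qFactor_pos {q : ℝ} (hq : 0 < q) (k : ℝ) (n : ℕ) : 0 < qFactor q k n :=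
  Real.rpow_pos_of_pos (Real.rpow_pos_of_pos hq _) _

/-- The polynomial `P_m(τ)`. -/
noncomputable def EqParams.symbol (P : EqParams) (τ : ℂ) (m : ℝ) : ℂ :=
  P.Q.eval (Complex.I * (m : ℂ)) / (qFactor P.q P.k₂ P.k₂ : ℂ) -
    (P.R P.D).eval (Complex.I * (m : ℂ)) * τ ^ P.dD / (qFactor P.q P.k₂ (P.dD + P.k₂) : ℂ)

section Symbol

variable {P : EqParams}

lemma EqParams.Admissible.qFactor_ne (hP : P.Admissible) (n : ℕ) :
    (qFactor P.q P.k₂ n : ℂ) ≠ 0 := by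
  exact_mod_cast (qFactor_pos (by linarith [hP.one_lt_q]) _ _).ne'

/-- The roots are q₀(m) times the powers of a primitive d_D-th root of unity, which gives access to
the factorization of X^{d_D} - a. -/
lemma EqParams.root_eq (P : EqParams) (l : ℕ) (m : ℝ) :
    P.root l m = Complex.exp (2 * Real.pi * Complex.I / P.dD) ^ l * P.root 0 m := by
  unfold EqParams.root
  rw [mul_left_comm, ← Complex.exp_nat_mul, ← Complex.exp_add]
  congr 2
  push_cast
  ring

lemma EqParams.root_zero_pow (hP : P.Admissible) (m : ℝ) :
    P.root 0 m ^ P.dD = P.Q.eval (Complex.I * (m : ℂ)) / (P.R P.D).eval (Complex.I * (m : ℂ)) *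
      ((qFactor P.q P.k₂ (P.dD + P.k₂) : ℂ) / (qFactor P.q P.k₂ P.k₂ : ℂ)) := by
  have hd : (P.dD : ℝ) ≠ 0 := by
    have := hP.one_le_dD
    positivity
  have hq := fun n => (qFactor_pos (show 0 < P.q by linarith [hP.one_lt_q]) P.k₂ n).le
  have hdC : (P.dD : ℂ) ≠ 0 := by exact_mod_cast hd
  rw [EqParams.root, mul_pow, ← Complex.ofReal_pow, ← Real.rpow_natCast, ← Real.rpow_mul
    (mul_nonneg (by positivity) (div_nonneg (hq _) (hq _))), one_div_mul_cancel hd, Real.rpow_one,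
    ← Complex.exp_nat_mul]
  set z := P.Q.eval (Complex.I * (m : ℂ)) / (P.R P.D).eval (Complex.I * (m : ℂ)) with hz
  rw [← norm_div, ← hz]
  have e : (P.dD : ℂ) * (Complex.I * ((1 / (P.dD : ℝ) * Complex.arg z +
      2 * Real.pi * ((0 : ℕ) : ℝ) / (P.dD : ℝ) : ℝ) : ℂ)) = Complex.arg z * Complex.I := by
    push_cast
    field_simp
    ring
  rw [e]
  conv_rhs => rw [← Complex.norm_mul_exp_arg_mul_I z]
  push_cast
  ring

lemma EqParams.symbol_eq_prod (hP : P.Admissible) (τ : ℂ) (m : ℝ) :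
    P.symbol τ m = -((P.R P.D).eval (Complex.I * (m : ℂ)) /
      (qFactor P.q P.k₂ (P.dD + P.k₂) : ℂ)) * ∏ l ∈ Finset.range P.dD, (τ - P.root l m) := by
  have hd : P.dD ≠ 0 := by
    have := hP.one_le_dD
    omega
  have h := congrArg (Polynomial.eval τ) (X_pow_sub_C_eq_prod
    (Complex.isPrimitiveRoot_exp P.dD hd) (Nat.pos_of_ne_zero hd) (EqParams.root_zero_pow hP m))
  simp only [Polynomial.eval_sub, Polynomial.eval_pow, Polynomial.eval_X, Polynomial.eval_C,
    Polynomial.eval_prod] at h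
  simp_rw [← EqParams.root_eq P _ m] at h
  rw [← h, EqParams.symbol]
  have h1 := hP.R_ne m
  have h2 := hP.qFactor_ne P.k₂
  have h3 := hP.qFactor_ne (P.dD + P.k₂)
  generalize (qFactor P.q P.k₂ P.k₂ : ℂ) = u at h2 ⊢
  generalize (qFactor P.q P.k₂ (P.dD + P.k₂) : ℂ) = v at h3 ⊢
  generalize (P.R P.D).eval (Complex.I * (m : ℂ)) = w at h1 ⊢
  field_simp
  ring

/-- Each of the d_D linear factors is at least M₁(1+|τ|), and the leading coefficient R_D(im) is at
least a constant times (1+|m|)^{deg R_D}. -/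
lemma EqParams.exists_le_norm_symbol (hP : P.Admissible) {W : Set ℂ}
    (h : ∃ M₁ : ℝ, 0 < M₁ ∧ ∀ l < P.dD, ∀ m : ℝ, ∀ τ ∈ W, M₁ * (1 + ‖τ‖) ≤ ‖τ - P.root l m‖) :
    ∃ c : ℝ, 0 < c ∧ ∀ τ ∈ W, ∀ m : ℝ,
      c * ((1 + |m|) ^ (P.R P.D).natDegree * (1 + ‖τ‖) ^ P.dD) ≤ ‖P.symbol τ m‖ := by
  obtain ⟨M₁, hM₁, hroot⟩ := h
  obtain ⟨c, hc, hR⟩ := exists_le_norm_eval_I_mul _ (P.R P.D) rfl hP.R_ne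
  have hq := qFactor_pos (show 0 < P.q by linarith [hP.one_lt_q]) P.k₂ (P.dD + P.k₂)
  refine ⟨c / qFactor P.q P.k₂ (P.dD + P.k₂) * M₁ ^ P.dD, by positivity, fun τ hτ m => ?_⟩
  rw [EqParams.symbol_eq_prod hP, norm_mul, norm_neg, norm_div, Complex.norm_real,
    Real.norm_eq_abs, abs_of_pos hq, norm_prod]
  have h1 : (M₁ * (1 + ‖τ‖)) ^ P.dD ≤ ∏ l ∈ Finset.range P.dD, ‖τ - P.root l m‖ := by
    rw [← Finset.card_range P.dD, ← Finset.prod_const, Finset.card_range]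
    exact Finset.prod_le_prod (fun l _ => by positivity)
      fun l hl => hroot l (Finset.mem_range.1 hl) m τ hτ
  calc _ = (c * (1 + |m|) ^ (P.R P.D).natDegree) / qFactor P.q P.k₂ (P.dD + P.k₂) *
        (M₁ * (1 + ‖τ‖)) ^ P.dD := by
        rw [mul_pow]
        ring
    _ ≤ _ := mul_le_mul (div_le_div_of_nonneg_right (hR m) hq.le) h1 (by positivity)
      (by positivity)

end Symbol

/-! ### The weight in τ and its behaviour under dilation. -/

/-- The weight `exp(k log²|τ| / (2 log q) + ν log|τ|)`. -/
noncomputable def tWeight (q k ν : ℝ) (τ : ℂ) : ℝ :=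
  Real.exp (k * Real.log ‖τ‖ ^ 2 / (2 * Real.log q) + ν * Real.log ‖τ‖)

lemma tWeight_pos (q k ν : ℝ) (τ : ℂ) : 0 < tWeight q k ν τ := Real.exp_pos _

lemma continuousAt_tWeight (q k ν : ℝ) {τ : ℂ} (hτ : τ ≠ 0) : ContinuousAt (tWeight q k ν) τ := by
  have hl : ContinuousAt (fun y : ℂ => Real.log ‖y‖) τ :=
    (Real.continuousAt_log (norm_ne_zero_iff.2 hτ)).comp continuous_norm.continuousAt
  exact (((continuousAt_const.mul (hl.pow 2)).div_const _).add (continuousAt_const.mul hl)).rexp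

/-- The effect of the dilation `τ ↦ q^γ τ` on the weight. -/
lemma norm_pow_mul_tWeight_rpow_mul_le {q k ν γ : ℝ} {d D : ℕ} (hq : 1 < q)
    (h0 : 0 ≤ d + k * γ) (hD : d + k * γ ≤ D) {τ : ℂ} (hτ : τ ≠ 0) :
    ‖τ‖ ^ d * tWeight q k ν (((q ^ γ : ℝ) : ℂ) * τ) ≤
      Real.exp (k * γ ^ 2 * Real.log q / 2 + ν * γ * Real.log q) *
        ((1 + ‖τ‖) ^ D * tWeight q k ν τ) := by
  have hτ' : 0 < ‖τ‖ := norm_pos_iff.2 hτ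
  have hlq : 0 < Real.log q := Real.log_pos hq
  have hqγ : 0 < q ^ γ := Real.rpow_pos_of_pos (by linarith) _
  have hlog : Real.log ‖((q ^ γ : ℝ) : ℂ) * τ‖ = γ * Real.log q + Real.log ‖τ‖ := by
    rw [norm_mul, Complex.norm_real, Real.norm_eq_abs, abs_of_pos hqγ,
      Real.log_mul hqγ.ne' hτ'.ne', Real.log_rpow (by linarith)]
  -- Expanding (log|τ| + γ log q)², the cross term is kγ log|τ|: dilation by q^γ costs the power
  -- |τ|^{kγ}.
  have e : ‖τ‖ ^ d * tWeight q k ν (((q ^ γ : ℝ) : ℂ) * τ) =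
      Real.exp (k * γ ^ 2 * Real.log q / 2 + ν * γ * Real.log q) *
        (‖τ‖ ^ (d + k * γ) * tWeight q k ν τ) := by
    rw [← Real.rpow_natCast, Real.rpow_def_of_pos hτ', Real.rpow_def_of_pos hτ', tWeight, tWeight,
      hlog, ← Real.exp_add, ← Real.exp_add, ← Real.exp_add]
    congr 1
    field_simp
    ring
  rw [e]
  refine mul_le_mul_of_nonneg_left (mul_le_mul_of_nonneg_right ?_ (tWeight_pos _ _ _ _).le)
    (Real.exp_pos _).le
  rw [← Real.rpow_natCast (1 + ‖τ‖) D]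
  exact (Real.rpow_le_rpow hτ'.le (by linarith) h0).trans
    (Real.rpow_le_rpow_of_exponent_le (by linarith) hD)

/-! ### Topology of the sectors -/

lemma isOpen_infiniteSector (d θ : ℝ) : IsOpen (infiniteSector d θ) := by
  have hf : Continuous fun τ : ℂ => τ * Complex.exp (-(d : ℂ) * Complex.I) := by fun_prop
  have key : IsOpen {z : ℂ | z ≠ 0 ∧ |Complex.arg z| < θ} := by
    -- For θ > π the sector is the punctured plane. Otherwise it avoids the negative axis, where arg
    -- jumps.
    rcases lt_or_ge Real.pi θ with h | h
    · have : {z : ℂ | z ≠ 0 ∧ |Complex.arg z| < θ} = {z : ℂ | z ≠ 0} := by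
        ext z
        exact ⟨fun h => h.1, fun hz => ⟨hz, (Complex.abs_arg_le_pi z).trans_lt h⟩⟩
      rw [this]
      exact isOpen_ne
    · have : {z : ℂ | z ≠ 0 ∧ |Complex.arg z| < θ} =
          Complex.slitPlane ∩ (fun z => |Complex.arg z|) ⁻¹' Set.Iio θ := by
        ext z
        refine ⟨fun hz => ⟨Complex.mem_slitPlane_iff_arg.2 ⟨fun hpi => ?_, hz.1⟩, hz.2⟩,
          fun hz => ⟨Complex.slitPlane_ne_zero hz.1, hz.2⟩⟩
        have := hz.2
        rw [hpi, abs_of_pos Real.pi_pos] at this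
        linarith
      rw [this]
      exact ContinuousOn.isOpen_inter_preimage (fun z hz =>
        (Complex.continuousAt_arg hz).abs.continuousWithinAt) Complex.isOpen_slitPlane isOpen_Iio
  have : infiniteSector d θ = (fun τ : ℂ => τ * Complex.exp (-(d : ℂ) * Complex.I)) ⁻¹'
      {z : ℂ | z ≠ 0 ∧ |Complex.arg z| < θ} := by
    ext τ
    simp [infiniteSector, Complex.exp_ne_zero]
  rw [this]
  exact key.preimage hf

lemma ofReal_mul_mem_infiniteSector {d θ c : ℝ} (hc : 0 < c) {τ : ℂ}
    (hτ : τ ∈ infiniteSector d θ) : (c : ℂ) * τ ∈ infiniteSector d θ := by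
  refine ⟨mul_ne_zero (by exact_mod_cast hc.ne') hτ.1, ?_⟩
  rw [mul_assoc, Complex.arg_real_mul _ hc]
  exact hτ.2

lemma ofReal_mul_mem_boundedSector {d θ r c : ℝ} (hc : 0 < c) (hc1 : c ≤ 1) {τ : ℂ}
    (hτ : τ ∈ boundedSector d θ r) : (c : ℂ) * τ ∈ boundedSector d θ r := by
  refine ⟨ofReal_mul_mem_infiniteSector hc hτ.1, ?_⟩
  have := hτ.2
  rw [mem_ball_zero_iff] at this ⊢
  rw [norm_mul, Complex.norm_real, Real.norm_eq_abs, abs_of_pos hc]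
  exact (mul_le_of_le_one_left (norm_nonneg _) hc1).trans_lt this

lemma ofReal_mul_mem_expDomain {d θS θR r c : ℝ} (hc : 0 < c) (hc1 : c ≤ 1) {τ : ℂ}
    (hτ : τ ∈ expDomain (infiniteSector d θS) (boundedSector d θR r)) :
    (c : ℂ) * τ ∈ expDomain (infiniteSector d θS) (boundedSector d θR r) := by
  refine ⟨?_, mul_ne_zero (by exact_mod_cast hc.ne') hτ.2⟩
  rcases hτ.1 with h | h
  · exact Or.inl (ofReal_mul_mem_infiniteSector hc h)
  · refine Or.inr (map_mem_closure (f := fun z : ℂ => (c : ℂ) * z)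
      (continuous_const.mul continuous_id) h fun z hz => ofReal_mul_mem_boundedSector hc hc1 hz)

/-- The properties of the domains `V ⊆ Ω` of holomorphy and of definition used to solve the
equation. -/
structure SolutionDomain (P : EqParams) (Ω V : Set ℂ) : Prop where
  isOpen : IsOpen V
  subset : V ⊆ Ω
  ne_zero : ∀ τ ∈ Ω, τ ≠ 0
  mul_mem : ∀ c : ℝ, 0 < c → c ≤ 1 → ∀ τ ∈ Ω, (c : ℂ) * τ ∈ Ω
  mul_mem' : ∀ c : ℝ, 0 < c → c ≤ 1 → ∀ τ ∈ V, (c : ℂ) * τ ∈ V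
  le_symbol : ∃ c : ℝ, 0 < c ∧ ∀ τ ∈ Ω, ∀ m : ℝ,
      c * ((1 + |m|) ^ (P.R P.D).natDegree * (1 + ‖τ‖) ^ P.dD) ≤ ‖P.symbol τ m‖

lemma solutionDomain_expDomain {P : EqParams} (hP : P.Admissible) {d θS θR r ρ₁ : ℝ}
    (hRρ₁ : boundedSector d θR r ⊆ Metric.closedBall 0 ρ₁)
    (h : ∃ M₁ : ℝ, 0 < M₁ ∧ ∀ l < P.dD, ∀ m : ℝ,
      ∀ τ ∈ infiniteSector d θS ∪ Metric.closedBall 0 ρ₁, M₁ * (1 + ‖τ‖) ≤ ‖τ - P.root l m‖) :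
    SolutionDomain P (expDomain (infiniteSector d θS) (boundedSector d θR r))
      (infiniteSector d θS ∪ boundedSector d θR r) where
  isOpen := (isOpen_infiniteSector d θS).union
    ((isOpen_infiniteSector d θR).inter Metric.isOpen_ball)
  subset := by
    rintro τ (hτ | hτ)
    · exact ⟨Or.inl hτ, hτ.1⟩
    · exact ⟨Or.inr (subset_closure hτ), hτ.1.1⟩
  ne_zero := fun τ hτ => hτ.2
  mul_mem := fun c hc hc1 τ hτ => ofReal_mul_mem_expDomain hc hc1 hτ
  mul_mem' := by
    rintro c hc hc1 τ (hτ | hτ)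
    · exact Or.inl (ofReal_mul_mem_infiniteSector hc hτ)
    · exact Or.inr (ofReal_mul_mem_boundedSector hc hc1 hτ)
  le_symbol := by
    obtain ⟨c, hc, hle⟩ := EqParams.exists_le_norm_symbol hP h
    refine ⟨c, hc, fun τ hτ m => hle τ ?_ m⟩
    rcases hτ.1 with h | h
    · exact Or.inl h
    · exact Or.inr (closure_minimal hRρ₁ Metric.isClosed_closedBall h)

/-! ### The linear operator and its norm. -/

section Operator

variable {P : EqParams} {C : ℕ → ℕ → ℝ → ℂ → ℂ} {Ω V : Set ℂ} {ν z K : ℝ}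

/-- The dilation factor `q^{δ_ℓ - d_{λ,ℓ}/k₂ - 1}`. -/
noncomputable def EqParams.dilation (P : EqParams) (l j : ℕ) : ℝ :=
  P.q ^ ((P.δ l : ℝ) - (P.d l j : ℝ) / (P.k₂ : ℝ) - 1)

lemma EqParams.Admissible.dilation_pos (hP : P.Admissible) (l j : ℕ) : 0 < P.dilation l j :=
  Real.rpow_pos_of_pos (by linarith [hP.one_lt_q]) _

lemma EqParams.Admissible.dilation_le_one (hP : P.Admissible) {l j : ℕ}
    (hl : l ∈ Finset.Icc 1 (P.D - 1)) (hj : j ∈ P.I l) : P.dilation l j ≤ 1 :=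
  Real.rpow_le_one_of_one_le_of_nonpos hP.one_lt_q.le (by linarith [hP.δ_le l hl j hj])

lemma EqParams.Admissible.one_le_δ (hP : P.Admissible) {l : ℕ}
    (hl : l ∈ Finset.Icc 1 (P.D - 1)) : 1 ≤ P.δ l := by
  obtain ⟨h1, h2⟩ := Finset.mem_Icc.1 hl
  clear hl
  induction l, h1 using Nat.le_induction with
  | base => exact hP.δ_one.ge
  | succ n hn ih => exact (ih (by omega)).trans (hP.δ_lt n hn h2).le

/-- A summand of the convolution part of the equation, divided by `τ^{k₂}`. -/
noncomputable def EqParams.convTerm (P : EqParams) (C : ℕ → ℕ → ℝ → ℂ → ℂ) (l j : ℕ)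
    (u : ℂ → ℝ → ℂ) (ε τ : ℂ) (m : ℝ) : ℂ :=
  ε ^ (P.Δ l j - P.d l j) * τ ^ P.d l j / (qFactor P.q P.k₂ (P.d l j + P.k₂) : ℂ) *
    (1 / (Real.sqrt (2 * Real.pi) : ℂ)) *
    convQ (P.R l) (fun m' => C l j m' ε) (fun m' => u ((P.dilation l j : ℂ) * τ) m') m

/-- The linear operator of the fixed point equation. -/
noncomputable def EqParams.linOp (P : EqParams) (C : ℕ → ℕ → ℝ → ℂ → ℂ)
    (u : ℂ → ℝ → ℂ) (ε τ : ℂ) (m : ℝ) : ℂ :=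
  (∑ l ∈ Finset.Icc 1 (P.D - 1), ∑ j ∈ P.I l, P.convTerm C l j u ε τ m) / P.symbol τ m

/-- Coefficients that are continuous in `m`, holomorphic in `ε` and bounded by `z` times the weight
in `m`. -/
structure CoeffBound (P : EqParams) (C : ℕ → ℕ → ℝ → ℂ → ℂ) (z : ℝ) : Prop where
  cont : ∀ l ∈ Finset.Icc 1 (P.D - 1), ∀ j ∈ P.I l, ∀ ε ∈ Metric.ball (0 : ℂ) P.ε₀,
    Continuous fun m => C l j m ε
  hol : ∀ l ∈ Finset.Icc 1 (P.D - 1), ∀ j ∈ P.I l, ∀ m : ℝ,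
    DifferentiableOn ℂ (fun ε => C l j m ε) (Metric.ball (0 : ℂ) P.ε₀)
  bound : ∀ l ∈ Finset.Icc 1 (P.D - 1), ∀ j ∈ P.I l, ∀ ε ∈ Metric.ball (0 : ℂ) P.ε₀, ∀ m : ℝ,
    ‖C l j m ε‖ ≤ z * mWeight P.β P.μ m

lemma norm_le_of_normE_le {β μ K : ℝ} (hK : 0 ≤ K) {h : ℝ → ℂ}
    (hh : normE β μ h ≤ ENNReal.ofReal K) (m : ℝ) : ‖h m‖ ≤ K * mWeight β μ m := by
  have h1 := (le_iSup (fun m : ℝ => ENNReal.ofReal ((1 + |m|) ^ μ * Real.exp (β * |m|) * ‖h m‖))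
    m).trans hh
  rw [ENNReal.ofReal_le_ofReal_iff hK] at h1
  have hpos : 0 < (1 + |m|) ^ μ := by positivity
  rw [mWeight, Real.exp_neg, Real.rpow_neg (by positivity), ← mul_inv, ← div_eq_mul_inv,
    le_div_iff₀ (by positivity)]
  linarith

lemma IsCoeffFamily.coeffBound {Ct : ℕ → ℕ → ℝ} (h : IsCoeffFamily P C Ct) (hz : 0 ≤ z)
    (hle : ∀ l ∈ Finset.Icc 1 (P.D - 1), ∀ j ∈ P.I l, Ct l j ≤ z) : CoeffBound P C z where
  cont := fun l hl j hj ε hε => (h.mem l hl j hj ε hε).1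
  hol := h.hol
  bound := fun l hl j hj ε hε m => norm_le_of_normE_le hz
    ((h.bound l hl j hj ε hε).trans (ENNReal.ofReal_le_ofReal (hle l hl j hj))) m

/-- Continuous functions on `Ω × ℝ` bounded by `K` times the weight. -/
structure IsSlice (P : EqParams) (ν : ℝ) (Ω : Set ℂ) (K : ℝ) (u : ℂ → ℝ → ℂ) : Prop where
  cont : ContinuousOn (fun p : ℂ × ℝ => u p.1 p.2) (Ω ×ˢ Set.univ)
  bound : ∀ τ ∈ Ω, ∀ m : ℝ, ‖u τ m‖ ≤ K * (mWeight P.β P.μ m * tWeight P.q P.k₂ ν τ)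

lemma IsSlice.continuous {u : ℂ → ℝ → ℂ} (hu : IsSlice P ν Ω K u) {τ : ℂ} (hτ : τ ∈ Ω) :
    Continuous (u τ) :=
  hu.cont.comp_continuous (f := fun m : ℝ => (τ, m)) (continuous_const.prodMk continuous_id)
    fun _ => ⟨hτ, Set.mem_univ _⟩

lemma IsSlice.sub {K' : ℝ} {u v : ℂ → ℝ → ℂ} (hu : IsSlice P ν Ω K u) (hv : IsSlice P ν Ω K' v) :
    IsSlice P ν Ω (K + K') (fun τ m => u τ m - v τ m) where
  cont := hu.cont.sub hv.cont
  bound := fun τ hτ m => (norm_sub_le _ _).trans (by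
    rw [add_mul]
    exact add_le_add (hu.bound τ hτ m) (hv.bound τ hτ m))

lemma SolutionDomain.dilation_mem (hΩ : SolutionDomain P Ω V) (hP : P.Admissible) {l j : ℕ}
    (hl : l ∈ Finset.Icc 1 (P.D - 1)) (hj : j ∈ P.I l) {τ : ℂ} (hτ : τ ∈ Ω) :
    (P.dilation l j : ℂ) * τ ∈ Ω :=
  hΩ.mul_mem _ (hP.dilation_pos l j) (hP.dilation_le_one hl hj) τ hτ

lemma SolutionDomain.symbol_ne_zero (hΩ : SolutionDomain P Ω V) {τ : ℂ} (hτ : τ ∈ Ω) (m : ℝ) :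
    P.symbol τ m ≠ 0 := by
  obtain ⟨c, hc, hle⟩ := hΩ.le_symbol
  exact norm_pos_iff.1 (lt_of_lt_of_le (by positivity) (hle τ hτ m))

lemma IsSlice.norm_dilation_le (hP : P.Admissible) (hΩ : SolutionDomain P Ω V)
    {u : ℂ → ℝ → ℂ} (hu : IsSlice P ν Ω K u) {l j : ℕ}
    (hl : l ∈ Finset.Icc 1 (P.D - 1)) (hj : j ∈ P.I l) {τ : ℂ} (hτ : τ ∈ Ω) (m : ℝ) :
    ‖u ((P.dilation l j : ℂ) * τ) m‖ ≤
      K * tWeight P.q P.k₂ ν ((P.dilation l j : ℂ) * τ) * mWeight P.β P.μ m := by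
  have := hu.bound _ (hΩ.dilation_mem hP hl hj hτ) m
  linarith

/-- The convolution loses (1+|m|)^{deg R_D}, and τ^{d_{λ,ℓ}} with the dilation loses at most
(1+|τ|)^{d_D}. The symbol pays for both, and M is chosen before the coefficients. -/
lemma EqParams.exists_norm_convTerm_le (hP : P.Admissible) (hΩ : SolutionDomain P Ω V) (ν : ℝ)
    {l j : ℕ} (hl : l ∈ Finset.Icc 1 (P.D - 1)) (hj : j ∈ P.I l) :
    ∃ M : ℝ, 0 < M ∧ ∀ (C : ℕ → ℕ → ℝ → ℂ → ℂ) (z K : ℝ) (u : ℂ → ℝ → ℂ), 0 ≤ z → 0 ≤ K →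
      CoeffBound P C z → IsSlice P ν Ω K u → ∀ ε ∈ Metric.ball (0 : ℂ) P.ε₀, ∀ τ ∈ Ω, ∀ m : ℝ,
        ‖P.convTerm C l j u ε τ m‖ ≤ M * z * K *
          (‖P.symbol τ m‖ * (mWeight P.β P.μ m * tWeight P.q P.k₂ ν τ)) := by
  obtain ⟨L, hL, hconv⟩ := exists_norm_convQ_le hP.β_pos.le hP.lt_μ (hP.deg_R l hl)
  obtain ⟨c, hc, hsym⟩ := hΩ.le_symbol
  set N := (P.R P.D).natDegree
  set γ := (P.δ l : ℝ) - (P.d l j : ℝ) / (P.k₂ : ℝ) - 1 with hγ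
  set E := Real.exp (P.k₂ * γ ^ 2 * Real.log P.q / 2 + ν * γ * Real.log P.q)
  have hqf := qFactor_pos (show 0 < P.q by linarith [hP.one_lt_q]) P.k₂ (P.d l j + P.k₂)
  have hk := hP.k₂_pos
  -- The total power of |τ| is k₂(δ_ℓ - 1): nonnegative because δ_ℓ ≥ 1, and at most d_D - 1 by
  -- `δ_le'`.
  have hγ0 : (P.d l j : ℝ) + P.k₂ * γ = P.k₂ * (P.δ l - 1) := by
    rw [hγ]
    field_simp
    ring
  have hδ1 : (1 : ℝ) ≤ P.δ l := by exact_mod_cast hP.one_le_δ hl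
  have h0 : 0 ≤ (P.d l j : ℝ) + P.k₂ * γ := by
    rw [hγ0]
    exact mul_nonneg hk.le (by linarith)
  have hD : (P.d l j : ℝ) + P.k₂ * γ ≤ P.dD := by
    have := hP.δ_le' l hl
    rw [hγ0]
    rw [← sub_le_iff_le_add, le_div_iff₀ hk] at this
    linarith
  set Eε := P.ε₀ ^ (P.Δ l j - P.d l j)
  have hEε : 0 < Eε := pow_pos hP.ε₀_pos _
  refine ⟨Eε / qFactor P.q P.k₂ (P.d l j + P.k₂) * (1 / Real.sqrt (2 * Real.pi)) * L * E / c,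
    by positivity, fun C z K u hz hK hC hu ε hε τ hτ m => ?_⟩
  have htw := tWeight_pos P.q P.k₂ ν ((P.dilation l j : ℂ) * τ)
  have hmw := mWeight_pos P.β P.μ m
  have h1 := hconv z (K * tWeight P.q P.k₂ ν ((P.dilation l j : ℂ) * τ)) (fun m' => C l j m' ε)
    (fun m' => u ((P.dilation l j : ℂ) * τ) m') hz (by positivity) (hC.bound l hl j hj ε hε)
    (hu.norm_dilation_le hP hΩ hl hj hτ) m
  have h2 : ‖ε‖ ^ (P.Δ l j - P.d l j) ≤ Eε :=
    pow_le_pow_left₀ (norm_nonneg _) (mem_ball_zero_iff.1 hε).le _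
  have h3 := norm_pow_mul_tWeight_rpow_mul_le (ν := ν) hP.one_lt_q h0 hD (hΩ.ne_zero τ hτ)
  have h4 := hsym τ hτ m
  rw [EqParams.convTerm, norm_mul, norm_mul, norm_div, norm_mul, norm_pow, norm_pow, norm_div,
    norm_one, Complex.norm_real, Complex.norm_real, Real.norm_eq_abs, Real.norm_eq_abs,
    abs_of_pos hqf, abs_of_nonneg (Real.sqrt_nonneg _)]
  calc _ ≤ Eε * ‖τ‖ ^ P.d l j / qFactor P.q P.k₂ (P.d l j + P.k₂) *
        (1 / Real.sqrt (2 * Real.pi)) *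
        (L * z * (K * tWeight P.q P.k₂ ν ((P.dilation l j : ℂ) * τ)) *
          ((1 + |m|) ^ N * mWeight P.β P.μ m)) := by
        gcongr
    _ = Eε / qFactor P.q P.k₂ (P.d l j + P.k₂) * (1 / Real.sqrt (2 * Real.pi)) * L * z * K *
        ((‖τ‖ ^ P.d l j * tWeight P.q P.k₂ ν ((P.dilation l j : ℂ) * τ)) *
          ((1 + |m|) ^ N * mWeight P.β P.μ m)) := by ring
    _ ≤ Eε / qFactor P.q P.k₂ (P.d l j + P.k₂) * (1 / Real.sqrt (2 * Real.pi)) * L * z * K *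
        ((E * ((1 + ‖τ‖) ^ P.dD * tWeight P.q P.k₂ ν τ)) *
          ((1 + |m|) ^ N * mWeight P.β P.μ m)) :=
        mul_le_mul_of_nonneg_left (mul_le_mul_of_nonneg_right h3 (by positivity)) (by positivity)
    _ = Eε / qFactor P.q P.k₂ (P.d l j + P.k₂) * (1 / Real.sqrt (2 * Real.pi)) * L * E / c * z * K *
        ((c * ((1 + |m|) ^ N * (1 + ‖τ‖) ^ P.dD)) *
          (mWeight P.β P.μ m * tWeight P.q P.k₂ ν τ)) := by
        field_simp
    _ ≤ _ := by
        have := tWeight_pos P.q P.k₂ ν τ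
        exact mul_le_mul_of_nonneg_left (mul_le_mul_of_nonneg_right h4 (by positivity))
          (by positivity)

/-- The operator norm of the linear part is controlled by the size of the coefficients. -/
lemma EqParams.exists_norm_linOp_le (hP : P.Admissible) (hΩ : SolutionDomain P Ω V) (ν : ℝ) :
    ∃ M : ℝ, 0 < M ∧ ∀ (C : ℕ → ℕ → ℝ → ℂ → ℂ) (z K : ℝ) (u : ℂ → ℝ → ℂ), 0 ≤ z → 0 ≤ K →
      CoeffBound P C z → IsSlice P ν Ω K u → ∀ ε ∈ Metric.ball (0 : ℂ) P.ε₀, ∀ τ ∈ Ω, ∀ m : ℝ,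
        ‖P.linOp C u ε τ m‖ ≤ M * z * K * (mWeight P.β P.μ m * tWeight P.q P.k₂ ν τ) := by
  -- The index conditions sit inside the statement so that a constant can be chosen for every pair
  -- (l, j).
  have hex : ∀ l j, ∃ M : ℝ, 0 < M ∧ (l ∈ Finset.Icc 1 (P.D - 1) → j ∈ P.I l →
      ∀ (C : ℕ → ℕ → ℝ → ℂ → ℂ) (z K : ℝ) (u : ℂ → ℝ → ℂ), 0 ≤ z → 0 ≤ K →
      CoeffBound P C z → IsSlice P ν Ω K u → ∀ ε ∈ Metric.ball (0 : ℂ) P.ε₀, ∀ τ ∈ Ω, ∀ m : ℝ,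
        ‖P.convTerm C l j u ε τ m‖ ≤ M * z * K *
          (‖P.symbol τ m‖ * (mWeight P.β P.μ m * tWeight P.q P.k₂ ν τ))) := by
    intro l j
    by_cases hl : l ∈ Finset.Icc 1 (P.D - 1)
    · by_cases hj : j ∈ P.I l
      · obtain ⟨M, hM, h⟩ := EqParams.exists_norm_convTerm_le hP hΩ ν hl hj
        exact ⟨M, hM, fun _ _ => h⟩
      · exact ⟨1, one_pos, fun _ h => absurd h hj⟩
    · exact ⟨1, one_pos, fun h => absurd h hl⟩
  choose M hM hle using hex
  have hS : 0 ≤ ∑ l ∈ Finset.Icc 1 (P.D - 1), ∑ j ∈ P.I l, M l j :=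
    Finset.sum_nonneg fun l _ => Finset.sum_nonneg fun j _ => (hM l j).le
  refine ⟨∑ l ∈ Finset.Icc 1 (P.D - 1), ∑ j ∈ P.I l, M l j + 1, by positivity,
    fun C z K u hz hK hC hu ε hε τ hτ m => ?_⟩
  have hmw := mWeight_pos P.β P.μ m
  have htw := tWeight_pos P.q P.k₂ ν τ
  have hs : 0 < ‖P.symbol τ m‖ := norm_pos_iff.2 (hΩ.symbol_ne_zero hτ m)
  rw [EqParams.linOp, norm_div, div_le_iff₀ hs]
  refine (norm_sum_le _ _).trans ((Finset.sum_le_sum fun l hl => (norm_sum_le _ _).trans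
    (Finset.sum_le_sum fun j hj => hle l j hl hj C z K u hz hK hC hu ε hε τ hτ m)).trans ?_)
  simp_rw [← Finset.sum_mul]
  calc _ ≤ ((∑ l ∈ Finset.Icc 1 (P.D - 1), ∑ j ∈ P.I l, M l j) + 1) * z * K *
        (‖P.symbol τ m‖ * (mWeight P.β P.μ m * tWeight P.q P.k₂ ν τ)) := by
        gcongr
        linarith
    _ = _ := by ring

/-- Splitting the integral needs integrability, hence the slice hypotheses. -/
lemma EqParams.linOp_add (hP : P.Admissible) (hΩ : SolutionDomain P Ω V) {K' : ℝ} (hz : 0 ≤ z)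
    (hK : 0 ≤ K) (hK' : 0 ≤ K') (hC : CoeffBound P C z) {u v : ℂ → ℝ → ℂ}
    (hu : IsSlice P ν Ω K u) (hv : IsSlice P ν Ω K' v) {ε τ : ℂ}
    (hε : ε ∈ Metric.ball (0 : ℂ) P.ε₀) (hτ : τ ∈ Ω) (m : ℝ) :
    P.linOp C (fun τ m => u τ m + v τ m) ε τ m = P.linOp C u ε τ m + P.linOp C v ε τ m := by
  unfold EqParams.linOp
  rw [← add_div, ← Finset.sum_add_distrib]
  congr 1
  refine Finset.sum_congr rfl fun l hl => ?_
  rw [← Finset.sum_add_distrib]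
  refine Finset.sum_congr rfl fun j hj => ?_
  unfold EqParams.convTerm
  rw [← mul_add]
  congr 1
  unfold convQ
  have htw := tWeight_pos P.q P.k₂ ν ((P.dilation l j : ℂ) * τ)
  have hmem := hΩ.dilation_mem hP hl hj hτ
  rw [← MeasureTheory.integral_add]
  · congr 1
    ext m₁
    ring
  · exact integrable_conv_integrand hP.β_pos.le hP.lt_μ (hP.deg_R l hl) hz
      (mul_nonneg hK htw.le) (hC.cont l hl j hj ε hε) (hu.continuous hmem)
      (hC.bound l hl j hj ε hε) (hu.norm_dilation_le hP hΩ hl hj hτ) m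
  · exact integrable_conv_integrand hP.β_pos.le hP.lt_μ (hP.deg_R l hl) hz
      (mul_nonneg hK' htw.le) (hC.cont l hl j hj ε hε) (hv.continuous hmem)
      (hC.bound l hl j hj ε hε) (hv.norm_dilation_le hP hΩ hl hj hτ) m

/-- The equation as a fixed point equation. -/
lemma solvesEq_iff (hΩ : SolutionDomain P Ω V) {ψ₂ : ℂ → ℝ → ℂ → ℂ} {ε : ℂ}
    {w : ℂ → ℝ → ℂ} :
    SolvesEq P C ψ₂ ε Ω w ↔ ∀ τ ∈ Ω, ∀ m : ℝ,
      w τ m = P.linOp C w ε τ m +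
        ψ₂ τ m ε / (qFactor P.q P.k₂ P.k₂ : ℂ) / P.symbol τ m := by
  refine forall₂_congr fun τ hτ => forall_congr' fun m => ?_
  have hs := hΩ.symbol_ne_zero hτ m
  have hk : τ ^ P.k₂ ≠ 0 := pow_ne_zero _ (hΩ.ne_zero τ hτ)
  have hsum : ∑ l ∈ Finset.Icc 1 (P.D - 1), ∑ j ∈ P.I l,
          ε ^ (P.Δ l j - P.d l j) * τ ^ (P.d l j + P.k₂) /
              (qFactor P.q P.k₂ (P.d l j + P.k₂) : ℂ) *
            (1 / (Real.sqrt (2 * Real.pi) : ℂ)) *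
            convQ (P.R l) (fun m' => C l j m' ε)
              (fun m' => w (((P.q ^ ((P.δ l : ℝ) - (P.d l j : ℝ) / (P.k₂ : ℝ) - 1) : ℝ) : ℂ) * τ)
                m') m =
      τ ^ P.k₂ * ∑ l ∈ Finset.Icc 1 (P.D - 1), ∑ j ∈ P.I l, P.convTerm C l j w ε τ m := by
    rw [Finset.mul_sum]
    refine Finset.sum_congr rfl fun l _ => ?_
    rw [Finset.mul_sum]
    refine Finset.sum_congr rfl fun j _ => ?_
    unfold EqParams.convTerm EqParams.dilation
    ring
  rw [hsum, EqParams.linOp, ← add_div, eq_div_iff hs, EqParams.symbol]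
  constructor
  · intro h
    apply mul_left_cancel₀ hk
    linear_combination h
  · intro h
    linear_combination τ ^ P.k₂ * h

end Operator

/-! ### Holomorphic families and the Neumann series. -/

section FixedPoint

variable {P : EqParams} {C : ℕ → ℕ → ℝ → ℂ → ℂ} {Ω V : Set ℂ} {ν z K : ℝ}

lemma exists_nhds_tWeight_le {q k ν c : ℝ} (hc : 0 < c) {τ₀ : ℂ} (hτ₀ : τ₀ ≠ 0) :
    ∃ U ∈ nhds τ₀, ∃ T : ℝ, 0 ≤ T ∧ ∀ τ ∈ U, tWeight q k ν ((c : ℂ) * τ) ≤ T := by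
  have hcτ : (c : ℂ) * τ₀ ≠ 0 := mul_ne_zero (by exact_mod_cast hc.ne') hτ₀
  have h : ContinuousAt (fun τ : ℂ => tWeight q k ν ((c : ℂ) * τ)) τ₀ :=
    ContinuousAt.comp (f := fun τ : ℂ => (c : ℂ) * τ) (continuousAt_tWeight q k ν hcτ)
      (continuousAt_const.mul continuousAt_id)
  exact ⟨_, h.preimage_mem_nhds (Iio_mem_nhds (lt_add_one _)), _,
    (add_pos (tWeight_pos _ _ _ _) one_pos).le, fun τ hτ => le_of_lt hτ⟩

/-- Families of slices depending holomorphically on `τ` and `ε`, with a bound uniform in `ε`. -/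
structure IsFamily (P : EqParams) (ν : ℝ) (Ω V : Set ℂ) (K : ℝ) (g : ℂ → ℝ → ℂ → ℂ) : Prop where
  slice : ∀ ε ∈ Metric.ball (0 : ℂ) P.ε₀, IsSlice P ν Ω K (fun τ m => g τ m ε)
  hol : ∀ ε ∈ Metric.ball (0 : ℂ) P.ε₀, ∀ m : ℝ, DifferentiableOn ℂ (fun τ => g τ m ε) V
  hol_param : ∀ τ ∈ Ω, ∀ m : ℝ,
    DifferentiableOn ℂ (fun ε => g τ m ε) (Metric.ball (0 : ℂ) P.ε₀)

/-- Local domination of the integrand of the convolution. -/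
lemma IsFamily.exists_local_majorant (hP : P.Admissible) (hΩ : SolutionDomain P Ω V)
    (hC : CoeffBound P C z) (hz : 0 ≤ z) (hK : 0 ≤ K) {g : ℂ → ℝ → ℂ → ℂ}
    (hg : IsFamily P ν Ω V K g) {l j : ℕ} (hl : l ∈ Finset.Icc 1 (P.D - 1)) (hj : j ∈ P.I l)
    {τ₀ : ℂ} (hτ₀ : τ₀ ∈ Ω) :
    ∃ U ∈ nhds τ₀, ∃ b : ℝ → ℝ, MeasureTheory.Integrable b ∧ ∀ τ ∈ U, τ ∈ Ω →
      ∀ ε ∈ Metric.ball (0 : ℂ) P.ε₀, ∀ m m₁ : ℝ,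
        ‖C l j (m - m₁) ε * (P.R l).eval (Complex.I * (m₁ : ℂ)) *
          g ((P.dilation l j : ℂ) * τ) m₁ ε‖ ≤ b m₁ := by
  obtain ⟨U, hU, T, hT, hle⟩ := exists_nhds_tWeight_le (q := P.q) (k := P.k₂) (ν := ν)
    (hP.dilation_pos l j) (hΩ.ne_zero τ₀ hτ₀)
  obtain ⟨c, hc, hRc⟩ := exists_norm_eval_I_mul_le (P.R l) (hP.deg_R l hl)
  have hμ := hP.lt_μ
  refine ⟨U, hU, _, (integrable_one_add_abs_rpow (a := P.μ - (P.R P.D).natDegree)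
    (by linarith)).const_mul (z * (K * T) * c), fun τ hτU hτ ε hε m m₁ => ?_⟩
  refine norm_conv_integrand_le' (h₁ := fun m => C l j m ε)
    (h₂ := fun m => g ((P.dilation l j : ℂ) * τ) m ε) hP.β_pos.le (by linarith) hz
    (mul_nonneg hK hT) hRc (hC.bound l hl j hj ε hε) (fun m => ?_) m m₁
  refine ((hg.slice ε hε).norm_dilation_le hP hΩ hl hj hτ m).trans ?_
  exact mul_le_mul_of_nonneg_right (mul_le_mul_of_nonneg_left (hle τ hτU) hK)
    (mWeight_pos _ _ _).le

lemma IsFamily.continuous_conv_integrand (hP : P.Admissible) (hΩ : SolutionDomain P Ω V)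
    (hC : CoeffBound P C z) {g : ℂ → ℝ → ℂ → ℂ}
    (hg : IsFamily P ν Ω V K g) {l j : ℕ} (hl : l ∈ Finset.Icc 1 (P.D - 1)) (hj : j ∈ P.I l)
    {τ ε : ℂ} (hτ : τ ∈ Ω) (hε : ε ∈ Metric.ball (0 : ℂ) P.ε₀) (m : ℝ) :
    Continuous fun m₁ : ℝ => C l j (m - m₁) ε * (P.R l).eval (Complex.I * (m₁ : ℂ)) *
          g ((P.dilation l j : ℂ) * τ) m₁ ε :=
  (((hC.cont l hl j hj ε hε).comp (continuous_const.sub continuous_id)).mul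
    ((P.R l).continuous.comp (continuous_const.mul Complex.continuous_ofReal))).mul
    ((hg.slice ε hε).continuous (hΩ.dilation_mem hP hl hj hτ))

lemma IsFamily.continuousOn_convQ (hP : P.Admissible) (hΩ : SolutionDomain P Ω V)
    (hC : CoeffBound P C z) (hz : 0 ≤ z) (hK : 0 ≤ K) {g : ℂ → ℝ → ℂ → ℂ}
    (hg : IsFamily P ν Ω V K g) {l j : ℕ} (hl : l ∈ Finset.Icc 1 (P.D - 1)) (hj : j ∈ P.I l)
    {ε : ℂ} (hε : ε ∈ Metric.ball (0 : ℂ) P.ε₀) :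
    ContinuousOn (fun p : ℂ × ℝ => convQ (P.R l) (fun m' => C l j m' ε)
      (fun m' => g ((P.dilation l j : ℂ) * p.1) m' ε) p.2) (Ω ×ˢ Set.univ) := by
  rintro ⟨τ₀, m₀⟩ ⟨hτ₀, -⟩
  obtain ⟨U, hU, b, hb, hle⟩ := hg.exists_local_majorant hP hΩ hC hz hK hl hj hτ₀
  refine MeasureTheory.continuousWithinAt_of_dominated (bound := b) ?_ ?_ hb
    (Filter.Eventually.of_forall fun m₁ => ?_)
  · filter_upwards [self_mem_nhdsWithin] with p hp
    exact (hg.continuous_conv_integrand hP hΩ hC hl hj hp.1 hε p.2).aestronglyMeasurable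
  · filter_upwards [self_mem_nhdsWithin, nhdsWithin_le_nhds (prod_mem_nhds hU Filter.univ_mem)]
      with p hp hpU
    exact Filter.Eventually.of_forall (hle p.1 hpU.1 hp.1 ε hε p.2)
  · refine ContinuousWithinAt.mul (ContinuousWithinAt.mul ?_ continuousWithinAt_const) ?_
    · exact ((hC.cont l hl j hj ε hε).comp
        (continuous_snd.sub continuous_const)).continuousWithinAt
    · have h1 := (hg.slice ε hε).cont
      have h2 : ContinuousOn (fun p : ℂ × ℝ => ((P.dilation l j : ℂ) * p.1, m₁))
          (Ω ×ˢ Set.univ) :=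
        ((continuous_const.mul continuous_fst).prodMk continuous_const).continuousOn
      exact (h1.comp h2 fun p hp => ⟨hΩ.dilation_mem hP hl hj hp.1, Set.mem_univ _⟩)
        (τ₀, m₀) ⟨hτ₀, Set.mem_univ _⟩

lemma IsFamily.differentiableOn_convQ (hP : P.Admissible) (hΩ : SolutionDomain P Ω V)
    (hC : CoeffBound P C z) (hz : 0 ≤ z) (hK : 0 ≤ K) {g : ℂ → ℝ → ℂ → ℂ}
    (hg : IsFamily P ν Ω V K g) {l j : ℕ} (hl : l ∈ Finset.Icc 1 (P.D - 1)) (hj : j ∈ P.I l)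
    {ε : ℂ} (hε : ε ∈ Metric.ball (0 : ℂ) P.ε₀) (m : ℝ) :
    DifferentiableOn ℂ (fun τ => convQ (P.R l) (fun m' => C l j m' ε)
      (fun m' => g ((P.dilation l j : ℂ) * τ) m' ε) m) V := by
  refine differentiableOn_integral_of_locally_dominated hΩ.isOpen (fun m₁ => ?_)
    (fun τ hτ => ?_) fun τ hτ => ?_
  · refine DifferentiableOn.const_mul ((hg.hol ε hε m₁).comp
      ((differentiable_id.const_mul _).differentiableOn) fun τ hτ => ?_) _
    exact hΩ.mul_mem' _ (hP.dilation_pos l j) (hP.dilation_le_one hl hj) τ hτ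
  · exact (hg.continuous_conv_integrand hP hΩ hC hl hj (hΩ.subset hτ) hε m).aestronglyMeasurable
  · obtain ⟨U, hU, b, hb, hle⟩ := hg.exists_local_majorant hP hΩ hC hz hK hl hj (hΩ.subset hτ)
    exact ⟨U, hU, b, hb, fun w hw m₁ => hle w hw.1 (hΩ.subset hw.2) ε hε m m₁⟩

lemma IsFamily.differentiableOn_convQ_param (hP : P.Admissible) (hΩ : SolutionDomain P Ω V)
    (hC : CoeffBound P C z) (hz : 0 ≤ z) (hK : 0 ≤ K) {g : ℂ → ℝ → ℂ → ℂ}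
    (hg : IsFamily P ν Ω V K g) {l j : ℕ} (hl : l ∈ Finset.Icc 1 (P.D - 1)) (hj : j ∈ P.I l)
    {τ : ℂ} (hτ : τ ∈ Ω) (m : ℝ) :
    DifferentiableOn ℂ (fun ε => convQ (P.R l) (fun m' => C l j m' ε)
      (fun m' => g ((P.dilation l j : ℂ) * τ) m' ε) m) (Metric.ball (0 : ℂ) P.ε₀) := by
  refine differentiableOn_integral_of_locally_dominated Metric.isOpen_ball (fun m₁ => ?_)
    (fun ε hε => ?_) fun ε hε => ?_
  · exact ((hC.hol l hl j hj _).mul_const _).mul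
      (hg.hol_param _ (hΩ.dilation_mem hP hl hj hτ) m₁)
  · exact (hg.continuous_conv_integrand hP hΩ hC hl hj hτ hε m).aestronglyMeasurable
  · obtain ⟨U, hU, b, hb, hle⟩ := hg.exists_local_majorant hP hΩ hC hz hK hl hj hτ
    exact ⟨Set.univ, Filter.univ_mem, b, hb,
      fun w hw m₁ => hle τ (mem_of_mem_nhds hU) hτ w hw.2 m m₁⟩

lemma EqParams.continuous_symbol (P : EqParams) :
    Continuous fun p : ℂ × ℝ => P.symbol p.1 p.2 := by
  have h : Continuous fun p : ℂ × ℝ => Complex.I * (p.2 : ℂ) :=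
    continuous_const.mul (Complex.continuous_ofReal.comp continuous_snd)
  exact ((P.Q.continuous.comp h).div_const _).sub
    ((((P.R P.D).continuous.comp h).mul (continuous_fst.pow _)).div_const _)

lemma EqParams.differentiable_symbol (P : EqParams) (m : ℝ) :
    Differentiable ℂ fun τ => P.symbol τ m :=
  (differentiable_const _).sub (((differentiable_id.pow _).const_mul _).div_const _)

/-- Continuity and holomorphy pass through the convolution by local domination. The bound K' is left
as a hypothesis so that the halved constant can be inserted. -/
lemma IsFamily.linOp (hP : P.Admissible) (hΩ : SolutionDomain P Ω V)
    (hC : CoeffBound P C z) (hz : 0 ≤ z) (hK : 0 ≤ K) {g : ℂ → ℝ → ℂ → ℂ}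
    (hg : IsFamily P ν Ω V K g) {K' : ℝ}
    (hle : ∀ ε ∈ Metric.ball (0 : ℂ) P.ε₀, ∀ τ ∈ Ω, ∀ m : ℝ,
      ‖P.linOp C (fun τ m => g τ m ε) ε τ m‖ ≤
        K' * (mWeight P.β P.μ m * tWeight P.q P.k₂ ν τ)) :
    IsFamily P ν Ω V K' (fun τ m ε => P.linOp C (fun τ m => g τ m ε) ε τ m) where
  slice := fun ε hε => ⟨by
    refine ContinuousOn.div (continuousOn_finsetSum _ fun l hl => continuousOn_finsetSum _
      fun j hj => ?_) P.continuous_symbol.continuousOn fun p hp => hΩ.symbol_ne_zero hp.1 p.2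
    exact ((((continuous_const.mul (continuous_fst.pow _)).div_const _).mul
      continuous_const).continuousOn).mul
      (hg.continuousOn_convQ hP hΩ hC hz hK hl hj hε), hle ε hε⟩
  hol := fun ε hε m => by
    refine DifferentiableOn.div (DifferentiableOn.fun_sum fun l hl => DifferentiableOn.fun_sum
      fun j hj => ?_) (P.differentiable_symbol m).differentiableOn
      fun τ hτ => hΩ.symbol_ne_zero (hΩ.subset hτ) m
    exact (((((differentiable_id.pow _).const_mul _).div_const _).mul_const
      _).differentiableOn).mul (hg.differentiableOn_convQ hP hΩ hC hz hK hl hj hε m)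
  hol_param := fun τ hτ m => by
    refine DifferentiableOn.div_const (DifferentiableOn.fun_sum fun l hl =>
      DifferentiableOn.fun_sum fun j hj => ?_) _
    exact (((((differentiable_id.pow _).mul_const _).div_const _).mul_const
      _).differentiableOn).mul (hg.differentiableOn_convQ_param hP hΩ hC hz hK hl hj hτ m)

/-- The inhomogeneous term of the fixed point equation. -/
lemma IsFamily.exists_div_symbol (hP : P.Admissible) (hΩ : SolutionDomain P Ω V) :
    ∃ M : ℝ, 0 < M ∧ ∀ (ν K : ℝ) (g : ℂ → ℝ → ℂ → ℂ), 0 ≤ K → IsFamily P ν Ω V K g →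
      IsFamily P ν Ω V (M * K)
        (fun τ m ε => g τ m ε / (qFactor P.q P.k₂ P.k₂ : ℂ) / P.symbol τ m) := by
  obtain ⟨c, hc, hle⟩ := hΩ.le_symbol
  have hqf := qFactor_pos (show 0 < P.q by linarith [hP.one_lt_q]) P.k₂ P.k₂
  refine ⟨1 / (qFactor P.q P.k₂ P.k₂ * c), by positivity, fun ν K g hK hg => ⟨fun ε hε => ⟨?_, ?_⟩,
    fun ε hε m => ?_, fun τ hτ m => ?_⟩⟩
  · exact ((hg.slice ε hε).cont.div_const _).div P.continuous_symbol.continuousOn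
      fun p hp => hΩ.symbol_ne_zero hp.1 p.2
  · intro τ hτ m
    have hmw := mWeight_pos P.β P.μ m
    have htw := tWeight_pos P.q P.k₂ ν τ
    have h1 : c ≤ ‖P.symbol τ m‖ := by
      refine le_trans (le_mul_of_one_le_right hc.le ?_) (hle τ hτ m)
      exact one_le_mul_of_one_le_of_one_le (one_le_pow₀ (by linarith [abs_nonneg m]))
        (one_le_pow₀ (by linarith [norm_nonneg τ]))
    rw [norm_div, norm_div, Complex.norm_real, Real.norm_eq_abs, abs_of_pos hqf, div_div]
    refine (div_le_div₀ (by positivity) ((hg.slice ε hε).bound τ hτ m) (by positivity)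
      (mul_le_mul_of_nonneg_left h1 hqf.le)).trans (le_of_eq ?_)
    field_simp
  · exact ((hg.hol ε hε m).div_const _).div (P.differentiable_symbol m).differentiableOn
      fun τ hτ => hΩ.symbol_ne_zero (hΩ.subset hτ) m
  · exact ((hg.hol_param τ hτ m).div_const _).div_const _

/-- Sums of geometrically decaying families. -/
lemma IsFamily.tsum (hP : P.Admissible) (hΩ : SolutionDomain P Ω V) (hK : 0 ≤ K)
    {g : ℕ → ℂ → ℝ → ℂ → ℂ} (hg : ∀ n, IsFamily P ν Ω V (K * (1 / 2) ^ n) (g n)) :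
    IsFamily P ν Ω V (2 * K) (fun τ m ε => ∑' n, g n τ m ε) := by
  have hgeo : Summable fun n : ℕ => K * (1 / 2 : ℝ) ^ n := summable_geometric_two.mul_left K
  have hw1 : ∀ m, mWeight P.β P.μ m ≤ 1 := mWeight_le_one hP.β_pos.le hP.μ_nonneg
  -- The weight need not be bounded on Ω, so uniform convergence is only local in τ.
  have hloc : ∀ τ₀ ∈ Ω, ∃ U ∈ nhds τ₀, IsOpen U ∧ ∃ T : ℝ, 0 ≤ T ∧ ∀ n, ∀ τ ∈ U, τ ∈ Ω →
      ∀ m : ℝ, ∀ ε ∈ Metric.ball (0 : ℂ) P.ε₀, ‖g n τ m ε‖ ≤ K * (1 / 2) ^ n * T := by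
    intro τ₀ hτ₀
    obtain ⟨U, hU, T, hT, hle⟩ := exists_nhds_tWeight_le (q := P.q) (k := P.k₂) (ν := ν)
      one_pos (hΩ.ne_zero τ₀ hτ₀)
    obtain ⟨U', hU', hopen, hmem⟩ := mem_nhds_iff.1 hU
    refine ⟨U', hopen.mem_nhds hmem, hopen, T, hT, fun n τ hτU hτ m ε hε => ?_⟩
    refine (((hg n).slice ε hε).bound τ hτ m).trans
      (mul_le_mul_of_nonneg_left ?_ (by positivity))
    have := hle τ (hU' hτU)
    rw [Complex.ofReal_one, one_mul] at this
    exact (mul_le_of_le_one_left (tWeight_pos _ _ _ _).le (hw1 m)).trans this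
  refine ⟨fun ε hε => ⟨?_, fun τ hτ m => ?_⟩, fun ε hε m => ?_, fun τ hτ m => ?_⟩
  · rintro ⟨τ₀, m₀⟩ ⟨hτ₀, -⟩
    obtain ⟨U, hU, hUo, T, hT, hle⟩ := hloc τ₀ hτ₀
    have hc : ContinuousOn (fun p : ℂ × ℝ => ∑' n, g n p.1 p.2 ε) ((Ω ∩ U) ×ˢ Set.univ) := by
      refine continuousOn_tsum (fun n => ((hg n).slice ε hε).cont.mono
        (Set.prod_mono Set.inter_subset_left le_rfl)) (hgeo.mul_right T) fun n p hp => ?_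
      exact hle n p.1 hp.1.2 hp.1.1 p.2 ε hε
    have := hc (τ₀, m₀) ⟨⟨hτ₀, mem_of_mem_nhds hU⟩, Set.mem_univ _⟩
    refine this.mono_of_mem_nhdsWithin ?_
    filter_upwards [self_mem_nhdsWithin, nhdsWithin_le_nhds (prod_mem_nhds hU Filter.univ_mem)]
      with p hp hpU
    exact ⟨⟨hp.1, hpU.1⟩, Set.mem_univ _⟩
  · have hsum := hgeo.mul_right (mWeight P.β P.μ m * tWeight P.q P.k₂ ν τ)
    refine (tsum_of_norm_bounded hsum.hasSum fun n => ((hg n).slice ε hε).bound τ hτ m).trans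
      (le_of_eq ?_)
    rw [tsum_mul_right, tsum_mul_left, tsum_geometric_two]
    ring
  · intro τ₀ hτ₀
    obtain ⟨U, hU, hUo, T, hT, hle⟩ := hloc τ₀ (hΩ.subset hτ₀)
    refine ((Complex.differentiableOn_tsum_of_summable_norm (hgeo.mul_right T)
      (fun n => ((hg n).hol ε hε m).mono Set.inter_subset_left) (hΩ.isOpen.inter hUo)
      fun n τ hτ => hle n τ hτ.2 (hΩ.subset hτ.1) m ε hε).differentiableAt
      ((hΩ.isOpen.inter hUo).mem_nhds ⟨hτ₀, mem_of_mem_nhds hU⟩)).differentiableWithinAt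
  · exact Complex.differentiableOn_tsum_of_summable_norm
      (hgeo.mul_right (mWeight P.β P.μ m * tWeight P.q P.k₂ ν τ))
      (fun n => (hg n).hol_param τ hτ m) Metric.isOpen_ball
      fun n ε hε => ((hg n).slice ε hε).bound τ hτ m

/-- The linear operator halves the bounds of slices. -/
def IsHalving (P : EqParams) (C : ℕ → ℕ → ℝ → ℂ → ℂ) (ν : ℝ) (Ω : Set ℂ) : Prop :=
  ∀ (K : ℝ) (u : ℂ → ℝ → ℂ), 0 ≤ K → IsSlice P ν Ω K u →
    ∀ ε ∈ Metric.ball (0 : ℂ) P.ε₀, ∀ τ ∈ Ω, ∀ m : ℝ,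
      ‖P.linOp C u ε τ m‖ ≤ K * (1 / 2) * (mWeight P.β P.μ m * tWeight P.q P.k₂ ν τ)

lemma eq_zero_of_norm_le_geometric {K : ℝ} {x : ℂ} (h : ∀ n : ℕ, ‖x‖ ≤ K * (1 / 2) ^ n) :
    x = 0 := by
  have ht : Filter.Tendsto (fun n : ℕ => K * (1 / 2 : ℝ) ^ n) Filter.atTop (nhds (K * 0)) :=
    (tendsto_pow_atTop_nhds_zero_of_lt_one (by norm_num) (by norm_num)).const_mul K
  rw [mul_zero] at ht
  exact norm_le_zero_iff.1 (ge_of_tendsto' ht h)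

/-- Uniqueness for the fixed point equation. -/
lemma IsHalving.unique (hP : P.Admissible) (hΩ : SolutionDomain P Ω V)
    (hC : CoeffBound P C z) (hz : 0 ≤ z) (hH : IsHalving P C ν Ω) {K' : ℝ} (hK : 0 ≤ K)
    (hK' : 0 ≤ K') {u v f : ℂ → ℝ → ℂ} {ε : ℂ} (hε : ε ∈ Metric.ball (0 : ℂ) P.ε₀)
    (hu : IsSlice P ν Ω K u) (hv : IsSlice P ν Ω K' v)
    (hfu : ∀ τ ∈ Ω, ∀ m : ℝ, u τ m = P.linOp C u ε τ m + f τ m)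
    (hfv : ∀ τ ∈ Ω, ∀ m : ℝ, v τ m = P.linOp C v ε τ m + f τ m) :
    ∀ τ ∈ Ω, ∀ m : ℝ, u τ m = v τ m := by
  have hd : IsSlice P ν Ω (K + K') (fun τ m => u τ m - v τ m) := hu.sub hv
  have hfix : ∀ τ ∈ Ω, ∀ m : ℝ,
      u τ m - v τ m = P.linOp C (fun τ m => u τ m - v τ m) ε τ m := by
    intro τ hτ m
    -- Writing u = (u - v) + v, additivity alone yields the equation for the difference.
    have h := EqParams.linOp_add hP hΩ hz (by positivity) hK' hC hd hv hε hτ m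
    simp only [sub_add_cancel] at h
    rw [hfu τ hτ m, hfv τ hτ m, add_sub_add_right_eq_sub, sub_eq_iff_eq_add]
    exact h
  -- Since u - v is a fixed point of the linear operator, each application halves its own bound.
  have hn : ∀ n : ℕ, IsSlice P ν Ω ((K + K') * (1 / 2) ^ n) (fun τ m => u τ m - v τ m) := by
    intro n
    induction n with
    | zero => simpa using hd
    | succ n ih =>
      refine ⟨ih.cont, fun τ hτ m => ?_⟩
      rw [hfix τ hτ m, pow_succ, ← mul_assoc (K + K')]
      exact hH _ _ (by positivity) ih ε hε τ hτ m
  intro τ hτ m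
  refine sub_eq_zero.1 (eq_zero_of_norm_le_geometric
    (K := (K + K') * (mWeight P.β P.μ m * tWeight P.q P.k₂ ν τ)) fun n => ?_)
  refine ((hn n).bound τ hτ m).trans (le_of_eq ?_)
  ring

/-- Existence for the fixed point equation, by the Neumann series. -/
lemma IsHalving.exists_fixedPoint (hP : P.Admissible) (hΩ : SolutionDomain P Ω V)
    (hC : CoeffBound P C z) (hz : 0 ≤ z) (hH : IsHalving P C ν Ω) (hK : 0 ≤ K)
    {f : ℂ → ℝ → ℂ → ℂ} (hf : IsFamily P ν Ω V K f) :
    ∃ w : ℂ → ℝ → ℂ → ℂ, IsFamily P ν Ω V (2 * K) w ∧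
      ∀ ε ∈ Metric.ball (0 : ℂ) P.ε₀, ∀ τ ∈ Ω, ∀ m : ℝ,
        w τ m ε = P.linOp C (fun τ m => w τ m ε) ε τ m + f τ m ε := by
  set step : (ℂ → ℝ → ℂ → ℂ) → ℂ → ℝ → ℂ → ℂ :=
    fun g τ m ε => P.linOp C (fun τ m => g τ m ε) ε τ m with hstep
  set g : ℕ → ℂ → ℝ → ℂ → ℂ := fun n => step^[n] f with hgdef
  have hgs : ∀ n, g (n + 1) = step (g n) := fun n => Function.iterate_succ_apply' _ _ _
  have hg : ∀ n, IsFamily P ν Ω V (K * (1 / 2) ^ n) (g n) := by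
    intro n
    induction n with
    | zero => simpa [g] using hf
    | succ n ih =>
      rw [hgs]
      refine ih.linOp hP hΩ hC hz (by positivity) fun ε hε τ hτ m => ?_
      rw [pow_succ, ← mul_assoc K]
      exact hH _ _ (by positivity) (ih.slice ε hε) ε hε τ hτ m
  -- The tails of the Neumann series; w 0 is the solution.
  set w : ℕ → ℂ → ℝ → ℂ → ℂ := fun N τ m ε => ∑' n, g (n + N) τ m ε with hwdef
  have hw : ∀ N, IsFamily P ν Ω V (2 * (K * (1 / 2) ^ N)) (w N) := by
    intro N
    refine IsFamily.tsum hP hΩ (by positivity) fun n => ?_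
    have := hg (n + N)
    rwa [pow_add, mul_comm ((1 / 2 : ℝ) ^ n), ← mul_assoc] at this
  have hgeo : Summable fun n : ℕ => K * (1 / 2 : ℝ) ^ n := summable_geometric_two.mul_left K
  have hrec : ∀ N, ∀ ε ∈ Metric.ball (0 : ℂ) P.ε₀, ∀ τ ∈ Ω, ∀ m : ℝ,
      w N τ m ε = g N τ m ε + w (N + 1) τ m ε := by
    intro N ε hε τ hτ m
    have hs : Summable fun n => g n τ m ε :=
      Summable.of_norm_bounded (hgeo.mul_right (mWeight P.β P.μ m * tWeight P.q P.k₂ ν τ))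
        fun n => ((hg n).slice ε hε).bound τ hτ m
    have hs' := (summable_nat_add_iff N).2 hs
    simp only [w]
    rw [hs'.tsum_eq_zero_add, zero_add]
    congr 2
    ext n
    rw [add_right_comm, add_assoc]
  -- This avoids interchanging the operator with an infinite sum: by additivity the defect L(w N) -
  -- w (N+1) does not depend on N, and it is O(2^{-N}), hence zero.
  have hshift : ∀ N, ∀ ε ∈ Metric.ball (0 : ℂ) P.ε₀, ∀ τ ∈ Ω, ∀ m : ℝ,
      step (w N) τ m ε - w (N + 1) τ m ε = step (w 0) τ m ε - w 1 τ m ε := by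
    intro N ε hε τ hτ m
    induction N with
    | zero => rfl
    | succ N ih =>
      rw [← ih, hrec (N + 1) ε hε τ hτ m, hgs]
      have h := EqParams.linOp_add hP hΩ hz (by positivity) (by positivity) hC
        ((hg N).slice ε hε) ((hw (N + 1)).slice ε hε) hε hτ m
      -- The recursion for the tails is known on Ω only; it applies because dilations map Ω into
      -- itself.
      have hcongr : step (w N) τ m ε =
          P.linOp C (fun τ m => g N τ m ε + w (N + 1) τ m ε) ε τ m := by
        simp only [step, EqParams.linOp, EqParams.convTerm]
        congr 1
        refine Finset.sum_congr rfl fun l hl => Finset.sum_congr rfl fun j hj => ?_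
        congr 2
        ext m'
        exact hrec N ε hε _ (hΩ.dilation_mem hP hl hj hτ) m'
      rw [hcongr, h]
      simp only [step]
      ring
  have hzero : ∀ ε ∈ Metric.ball (0 : ℂ) P.ε₀, ∀ τ ∈ Ω, ∀ m : ℝ,
      step (w 0) τ m ε - w 1 τ m ε = 0 := by
    intro ε hε τ hτ m
    refine eq_zero_of_norm_le_geometric
      (K := 2 * K * (mWeight P.β P.μ m * tWeight P.q P.k₂ ν τ)) fun N => ?_
    rw [← hshift N ε hε τ hτ m]
    have h1 := hH _ _ (by positivity) ((hw N).slice ε hε) ε hε τ hτ m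
    have h2 := ((hw (N + 1)).slice ε hε).bound τ hτ m
    refine (norm_sub_le _ _).trans ((add_le_add h1 h2).trans (le_of_eq ?_))
    ring
  refine ⟨w 0, by simpa using hw 0, fun ε hε τ hτ m => ?_⟩
  rw [hrec 0 ε hε τ hτ m, ← sub_eq_zero.1 (hzero ε hε τ hτ m), add_comm]
  rfl

end FixedPoint

/-! ### Comparison of norms with pointwise bounds, and the conclusion. -/

section Main

variable {P : EqParams} {S R Ω V : Set ℂ} {ν K : ℝ}

/-- The dictionary between the supremum defining the norm and the pointwise bounds of `IsSlice`. -/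
lemma expWeight_mul_le_iff (P : EqParams) (ν K : ℝ) (τ : ℂ) (m : ℝ) (x : ℝ) :
    (1 + |m|) ^ P.μ * Real.exp (P.β * |m|) *
      Real.exp (-(P.k₂ * Real.log ‖τ‖ ^ 2 / (2 * Real.log P.q)) - ν * Real.log ‖τ‖) * x ≤ K ↔
    x ≤ K * (mWeight P.β P.μ m * tWeight P.q P.k₂ ν τ) := by
  have h : (1 + |m|) ^ P.μ * Real.exp (P.β * |m|) *
      Real.exp (-(P.k₂ * Real.log ‖τ‖ ^ 2 / (2 * Real.log P.q)) - ν * Real.log ‖τ‖) =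
      (mWeight P.β P.μ m * tWeight P.q P.k₂ ν τ)⁻¹ := by
    rw [mWeight, tWeight, mul_inv, mul_inv, ← Real.exp_neg, ← Real.exp_neg, neg_neg,
      Real.rpow_neg (by positivity), inv_inv]
    ring_nf
  rw [h, inv_mul_le_iff₀ (mul_pos (mWeight_pos _ _ _) (tWeight_pos _ _ _ _)), mul_comm]

lemma normExp_le (hu : IsSlice P ν (expDomain S R) K u) :
    normExp S R P.q P.k₂ P.β P.μ ν u ≤ ENNReal.ofReal K :=
  iSup₂_le fun τ hτ => iSup_le fun m =>
    ENNReal.ofReal_le_ofReal ((expWeight_mul_le_iff P ν K τ m _).2 (hu.bound τ hτ m))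

lemma MemExp.exists_isSlice {u : ℂ → ℝ → ℂ} (hu : MemExp S R P.q P.k₂ P.β P.μ ν u) :
    ∃ K : ℝ, 0 ≤ K ∧ IsSlice P ν (expDomain S R) K u := by
  refine ⟨(normExp S R P.q P.k₂ P.β P.μ ν u).toReal, ENNReal.toReal_nonneg, hu.1,
    fun τ hτ m => (expWeight_mul_le_iff P ν _ τ m _).1 ?_⟩
  refine (ENNReal.ofReal_le_iff_le_toReal hu.2.2.ne).1 ?_
  exact (le_iSup (fun m : ℝ => ENNReal.ofReal ((1 + |m|) ^ P.μ * Real.exp (P.β * |m|) *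
    Real.exp (-(P.k₂ * Real.log ‖τ‖ ^ 2 / (2 * Real.log P.q)) - ν * Real.log ‖τ‖) * ‖u τ m‖))
    m).trans (le_iSup₂ (f := fun τ (_ : τ ∈ expDomain S R) => ⨆ m : ℝ, ENNReal.ofReal
      ((1 + |m|) ^ P.μ * Real.exp (P.β * |m|) * Real.exp
      (-(P.k₂ * Real.log ‖τ‖ ^ 2 / (2 * Real.log P.q)) - ν * Real.log ‖τ‖) * ‖u τ m‖)) τ hτ)

/-- The accelerated forcing term on the domain of the equation. -/
lemma IsForcing.isFamily_accel {d θ ρ δ₀ δt α : ℝ} {F : ℕ → ℝ → ℂ → ℂ} {ψ : ℂ → ℝ → ℂ → ℂ}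
    {Cψ₂ : ℝ} (hP : P.Admissible) (hθ : 0 < θ) (hδ₀ : 0 < δ₀) (hδt : 0 < δt)
    (hdist : 0 < Metric.infDist (-(δ₀ : ℂ)) (infiniteSector d θ ∪ Metric.ball 0 ρ))
    (hS : S ⊆ laplaceDomain d δt) (hR : R ⊆ laplaceDomain d δt) (hopen : IsOpen (S ∪ R))
    (h : IsForcing P (infiniteSector d θ) ρ δ₀ α F ψ)
    (hb : AccelBound P d δt ν Cψ₂ (P.accel d ψ)) (hle : Cψ₂ ≤ K) :
    IsFamily P ν (expDomain S R) (S ∪ R) K (P.accel d ψ) := by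
  have hΩ := expDomain_subset_laplaceSector hS hR
  have hSR : S ∪ R ⊆ laplaceDomain d δt := Set.union_subset hS hR
  have hcont := fun ε (hε : ε ∈ Metric.ball (0 : ℂ) P.ε₀) =>
    (h.continuousOn_accel hP hθ hδ₀ hδt hdist hε).mono (Set.prod_mono hΩ (le_refl Set.univ))
  have hbd : ∀ τ ∈ laplaceDomain d δt, ∀ m : ℝ, ∀ ε ∈ Metric.ball (0 : ℂ) P.ε₀,
      ‖P.accel d ψ τ m ε‖ ≤ K * (mWeight P.β P.μ m * tWeight P.q P.k₂ ν τ) := by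
    intro τ hτ m ε hε
    refine (hb τ hτ m ε hε).trans ?_
    rw [mul_assoc Cψ₂, mul_assoc Cψ₂]
    exact mul_le_mul_of_nonneg_right hle
      (mul_pos (mWeight_pos P.β P.μ m) (tWeight_pos P.q P.k₂ ν τ)).le
  refine ⟨fun ε hε => ⟨hcont ε hε, fun τ hτ m => ?_⟩, fun ε hε m =>
    h.differentiableOn_accel hP hθ hδ₀ hδt hdist hε m hopen
      (hSR.trans (laplaceDomain_subset_laplaceSector d δt)), fun τ hτ m =>
    h.differentiableOn_accel_param hP hθ hδ₀ hδt hdist (hΩ hτ) m⟩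
  -- The growth estimate holds on the open sectors; it reaches the boundary of the bounded sector by
  -- continuity of both sides.
  have hcl : τ ∈ closure (S ∪ R) := by
    rw [closure_union]
    exact hτ.1.imp (fun h => subset_closure h) id
  have : (nhdsWithin τ (S ∪ R)).NeBot := mem_closure_iff_nhdsWithin_neBot.1 hcl
  have hsub : S ∪ R ⊆ expDomain S R := fun y hy =>
    ⟨hy.imp id fun h => subset_closure h, (hSR hy).1⟩
  have hc1 : ContinuousWithinAt (fun y => P.accel d ψ y m ε) (S ∪ R) τ := by
    have hc2 : ContinuousOn (fun y => P.accel d ψ y m ε) (expDomain S R) :=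
      (hcont ε hε).comp (f := fun y : ℂ => (y, m))
        (continuous_id.prodMk continuous_const).continuousOn fun y hy => ⟨hy, Set.mem_univ _⟩
    exact (hc2 τ hτ).mono hsub
  have hc3 : ContinuousWithinAt (fun y => K * (mWeight P.β P.μ m * tWeight P.q P.k₂ ν y))
      (S ∪ R) τ :=
    (continuousAt_const.mul (continuousAt_const.mul
      (continuousAt_tWeight _ _ _ hτ.2))).continuousWithinAt
  refine le_of_tendsto_of_tendsto hc1.norm.tendsto hc3.tendsto ?_
  filter_upwards [self_mem_nhdsWithin] with y hy
  exact hbd y (hSR hy) m ε hε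

end Main

theorem proposition571
    (P : EqParams) (hP : P.Admissible)
    -- direction, infinite sector `S_d`, bounded sector `R_d^b`, sector `U_d`, disc radii
    (d θS θR rR θU ρ ρ₁ δ₀ δt α : ℝ)
    (hθS : 0 < θS) (hθR : 0 < θR) (hrR : 0 < rR) (hθU : 0 < θU)
    (hρ : 0 < ρ) (hρ₁ : 0 < ρ₁) (hδ₀ : 0 < δ₀) (hδt : 0 < δt)
    (hdist : 0 < Metric.infDist (-(δ₀ : ℂ)) (infiniteSector d θU ∪ Metric.ball 0 ρ))
    (hRρ₁ : boundedSector d θR rR ⊆ Metric.closedBall 0 ρ₁)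
    (hS : infiniteSector d θS ⊆ laplaceDomain d δt)
    (hR : boundedSector d θR rR ⊆ laplaceDomain d δt)
    -- `Q / R_D` takes its values in the sector `S_{Q,R_D}`
    (rQR dQR ηQR : ℝ) (hrQR : 0 < rQR) (hηQR : 0 < ηQR)
    (hQR : ∀ m : ℝ, P.Q.eval (Complex.I * (m : ℂ)) / (P.R P.D).eval (Complex.I * (m : ℂ)) ∈
      closedSectorOutside rQR dQR ηQR)
    -- assumption 1)
    (h1 : ∃ M₁ : ℝ, 0 < M₁ ∧ ∀ l < P.dD, ∀ m : ℝ,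
      ∀ τ ∈ infiniteSector d θS ∪ Metric.closedBall 0 ρ₁, M₁ * (1 + ‖τ‖) ≤ ‖τ - P.root l m‖)
    -- assumption 2)
    (h2 : ∃ M₂ : ℝ, 0 < M₂ ∧ ∃ l₀ < P.dD, ∀ m : ℝ,
      ∀ τ ∈ infiniteSector d θS ∪ Metric.closedBall 0 ρ₁,
        M₂ * ‖P.root l₀ m‖ ≤ ‖τ - P.root l₀ m‖) :
    -- exponents `ν` for which the accelerated forcing terms obey the growth estimate exist
    (∃ ν : ℝ, ∀ (F : ℕ → ℝ → ℂ → ℂ) (ψ : ℂ → ℝ → ℂ → ℂ),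
      IsForcing P (infiniteSector d θU) ρ δ₀ α F ψ →
        ∃ Cψ₂ : ℝ, 0 < Cψ₂ ∧ AccelBound P d δt ν Cψ₂ (P.accel d ψ)) ∧
    -- and for all such `ν` the equation is uniquely solvable if the data are small enough
    (∀ (ν ϖ : ℝ), 0 < ϖ →
      ∃ (ζψ : ℝ) (ζ : ℕ → ℕ → ℝ), 0 < ζψ ∧
        (∀ l ∈ Finset.Icc 1 (P.D - 1), ∀ j ∈ P.I l, 0 < ζ l j) ∧
        ∀ (C : ℕ → ℕ → ℝ → ℂ → ℂ) (Ct : ℕ → ℕ → ℝ) (F : ℕ → ℝ → ℂ → ℂ) (ψ : ℂ → ℝ → ℂ → ℂ)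
          (Cψ₂ : ℝ),
          IsCoeffFamily P C Ct →
          IsForcing P (infiniteSector d θU) ρ δ₀ α F ψ →
          AccelBound P d δt ν Cψ₂ (P.accel d ψ) →
          (∀ l ∈ Finset.Icc 1 (P.D - 1), ∀ j ∈ P.I l, Ct l j ≤ ζ l j) →
          Cψ₂ ≤ ζψ →
          ∃ w : ℂ → ℝ → ℂ → ℂ,
            (∀ ε ∈ Metric.ball (0 : ℂ) P.ε₀,
              MemExp (infiniteSector d θS) (boundedSector d θR rR) P.q P.k₂ P.β P.μ ν
                (fun τ m => w τ m ε) ∧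
              SolvesEq P C (P.accel d ψ) ε
                (expDomain (infiniteSector d θS) (boundedSector d θR rR))
                (fun τ m => w τ m ε) ∧
              (∀ v : ℂ → ℝ → ℂ,
                MemExp (infiniteSector d θS) (boundedSector d θR rR) P.q P.k₂ P.β P.μ ν v →
                SolvesEq P C (P.accel d ψ) ε
                  (expDomain (infiniteSector d θS) (boundedSector d θR rR)) v →
                ∀ τ ∈ expDomain (infiniteSector d θS) (boundedSector d θR rR), ∀ m : ℝ,
                  v τ m = w τ m ε) ∧
              normExp (infiniteSector d θS) (boundedSector d θR rR) P.q P.k₂ P.β P.μ ν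
                (fun τ m => w τ m ε) ≤ ENNReal.ofReal ϖ) ∧
            (∀ τ ∈ expDomain (infiniteSector d θS) (boundedSector d θR rR), ∀ m : ℝ,
              DifferentiableOn ℂ (fun ε => w τ m ε) (Metric.ball (0 : ℂ) P.ε₀))) := by
  have hΩ := solutionDomain_expDomain hP hRρ₁ h1
  refine ⟨exists_accelBound hP hθU hδ₀ hδt hdist, fun ν ϖ hϖ => ?_⟩
  obtain ⟨M, hM, hlin⟩ := EqParams.exists_norm_linOp_le hP hΩ ν
  obtain ⟨N, hN, hfam⟩ := IsFamily.exists_div_symbol hP hΩ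
  -- Coefficients of size 1/(2M) give the operator norm at most 1/2. The inhomogeneous term then has
  -- size at most N·ϖ/(2N) = ϖ/2, which the Neumann series at most doubles.
  refine ⟨ϖ / (2 * N), fun _ _ => 1 / (2 * M), by positivity, fun _ _ _ _ => by positivity,
    fun C Ct F ψ Cψ₂ hC hF hacc hCt hCψ => ?_⟩
  have hz : 0 ≤ 1 / (2 * M) := by positivity
  have hCB := hC.coeffBound hz hCt
  have hhalf : IsHalving P C ν
      (expDomain (infiniteSector d θS) (boundedSector d θR rR)) := by
    intro K u hK hu ε hε τ hτ m
    refine (hlin C _ K u hz hK hCB hu ε hε τ hτ m).trans (le_of_eq ?_)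
    field_simp
  have hψ₂ := hF.isFamily_accel hP hθU hδ₀ hδt hdist hS hR hΩ.isOpen hacc hCψ
  have hf := hfam ν _ _ (by positivity) hψ₂
  have hK : 0 ≤ N * (ϖ / (2 * N)) := by positivity
  obtain ⟨w, hw, hfix⟩ := hhalf.exists_fixedPoint hP hΩ hCB hz hK hf
  rw [show 2 * (N * (ϖ / (2 * N))) = ϖ by field_simp] at hw
  refine ⟨w, fun ε hε => ⟨⟨(hw.slice ε hε).cont, hw.hol ε hε,
    (normExp_le (hw.slice ε hε)).trans_lt ENNReal.ofReal_lt_top⟩,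
    (solvesEq_iff hΩ).2 (hfix ε hε), fun v hv hveq => ?_, normExp_le (hw.slice ε hε)⟩,
    hw.hol_param⟩
  obtain ⟨K', hK', hvs⟩ := hv.exists_isSlice
  exact hhalf.unique hP hΩ hCB hz hK' hϖ.le hε hvs (hw.slice ε hε)
    ((solvesEq_iff hΩ).1 hveq) (hfix ε hε)
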